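/- Let $k$ be a field and let $A$ be a unital associative $k$-algebra. Put $\overline A=A/(k\cdot 1)$, let $\pi:A\to\overline A$ be the projection and $\mu$ the multiplication of $A$, and write $\otimes=\otimes_k$, $\operatorname{Hom}=\operatorname{Hom}_k$. **Complexes.** For $p\ge 0$ let $\Omega^p=A\otimes\overline A^{\otimes p}$, with the left action of $A$ by multiplication on the first factor and the right action $$(a_0\otimes\overline a_1\otimes\cdots\otimes\overline a_p)\blacktriangleleft a_{p+1}=\sum_{i=0}^{p}(-1)^{p-i}\,a_0\otimes\overline a_1\otimes\cdots\otimes\overline{a_ia_{i+1}}\otimes\cdots\otimes\overline a_{p+1},$$ where the term $i=0$ is $(-1)^p a_0a_1\otimes\overline a_2\otimes\cdots\otimes\overline a_{p+1}$. For $m,p\ge0$ let $C^{m-p}(A,\Omega^p)=\operatorname{Hom}(\overline A^{\otimes m},A\otimes\overline A^{\otimes p})$; its elements have degree $m-p$. The differential $\delta:C^{m-p}(A,\Omega^p)\to C^{m-p+1}(A,\Omega^p)$ is $$(-1)^{m-p+1}\delta(f)(\overline a_1\otimes\cdots\otimes\overline a_{m+1})=a_1f(\overline a_2\otimes\cdots\otimes\overline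 a_{m+1})+\sum_{j=1}^m(-1)^jf(\overline a_1\otimes\cdots\otimes\overline{a_ja_{j+1}}\otimes\cdots\otimes\overline a_{m+1})+(-1)^{m+1}f(\overline a_1\otimes\cdots\otimes\overline a_m)\blacktriangleleft a_{m+1}$$ (it does not depend on the choice of the lifts $a_j$ of $\overline a_j$, taken linearly in $\overline a_j$). The maps $\theta_p:C^{*}(A,\Omega^p)\to C^{*}(A,\Omega^{p+1})$, $f\mapsto f\otimes\mathrm{id}_{\overline A}$, are morphisms of complexes. Let $C^*(A,A)=C^*(A,\Omega^0)$ and $C_{\mathrm{sg}}^*(A,A)=\operatorname{colim}_{\theta_p}C^*(A,\Omega^p)$, with cohomology $HH^*(A,A)$ and $HH_{\mathrm{sg}}^*(A,A)$. Let $\rho:HH^*(A,A)\to HH^*_{\mathrm{sg}}(A,A)$ be the map induced by the canonical map $C^*(A,\Omega^0)\to C^*_{\mathrm{sg}}(A,A)$. **Operations.** Tensor products of maps are formed without signs. For $f\in C^{m-p}(A,\Omega^p)$ and $g\in C^{n-q}(A,\Omega^q)$ put $$f\cup g=(\mu\otimes\mathrm{id}^{\otimes(p+q)})(\mathrm{id}_A\otimes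 f\otimes\mathrm{id}^{\otimes q})(g\otimes\mathrm{id}^{\otimes m})\in C^{m+n-p-q}(A,\Omega^{p+q}),$$ and, with $\overline g=(\pi\otimes\mathrm{id}^{\otimes q})g$, $$f\circ_ig=(f\otimes\mathrm{id}^{\otimes q})(\mathrm{id}^{\otimes(i-1)}\otimes\overline g\otimes\mathrm{id}^{\otimes(m-i)})\quad(1\le i\le m),$$ $$f\circ_{-i}g=(\mathrm{id}_A\otimes\mathrm{id}^{\otimes(i-1)}\otimes\overline g\otimes\mathrm{id}^{\otimes(p-i)})(f\otimes\mathrm{id}^{\otimes(n-1)})\quad(1\le i\le p,\ n\ge1),$$ $$f\circ g=\sum_{i=1}^m(-1)^{(n-q-1)(i-1)}f\circ_ig-\sum_{i=1}^p(-1)^{(n-q-1)(i-m-p-1)}f\circ_{-i}g,\qquad [f,g]=f\circ g-(-1)^{(m-p-1)(n-q-1)}g\circ f.$$ If $p=0$ the second sum is empty and $f\circ g$ is defined for every $n\ge 0$; in particular $[f,g]$ is defined for all $f,g\in C^*(A,A)$. These operations commute with $\theta$ in each argument, that is $\theta(f)\cup g=f\cup\theta(g)=\theta(f\cup g)$ and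 $\theta(f)\circ g=f\circ\theta(g)=\theta(f\circ g)$ (for $n\ge 1$ in the case of $\circ$), and so define bilinear operations $\cup$ (of degree $0$) and $[\cdot,\cdot]$ (of degree $-1$) on $C_{\mathrm{sg}}^*(A,A)$; the bracket is computed on representatives with at least one input, which exist because $\theta(g)$ represents the same element as $g$. **Gerstenhaber algebras.** A Gerstenhaber algebra over $k$ is a graded $k$-module $G=\bigoplus_{i\in\mathbb Z}G^i$ with bilinear operations $\cup$ of degree $0$ and $[\cdot,\cdot]$ of degree $-1$ such that, for homogeneous $f,g,h$: (i) $\cup$ is associative with a unit $1\in G^0$, and $f\cup g=(-1)^{|f||g|}g\cup f$; (ii) $[f,g]=-(-1)^{(|f|-1)(|g|-1)}[g,f]$ and $$(-1)^{(|f|-1)(|h|-1)}[f,[g,h]]+(-1)^{(|f|-1)(|g|-1)}[g,[h,f]]+(-1)^{(|g|-1)(|h|-1)}[h,[f,g]]=0;$$ (iii) $[f,g\cup h]=[f,g]\cup h+(-1)^{(|f|-1)|g|}g\cup[f,h]$. A morphism of Gerstenhaber algebras is a $k$-linear map that preserves degrees, $\cup$, $[\cdot,\cdot]$ and $1$. **Statement.**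 On both $C^*(A,A)$ and $C_{\mathrm{sg}}^*(A,A)$, the operations $\cup$ and $[\cdot,\cdot]$ take cocycles to cocycles and induce well-defined operations on cohomology. With these operations, and with the class of $1\in A=C^0(A,A)$ as unit, $HH_{\mathrm{sg}}^*(A,A)$ and $HH^*(A,A)$ are Gerstenhaber algebras, and $\rho:HH^*(A,A)\to HH_{\mathrm{sg}}^*(A,A)$ is a morphism of Gerstenhaber algebras. -/

import Mathlib

universe u v

open scoped TensorProduct DirectSum

noncomputable section

namespace TateHochschild

section TensorPowers

variable (k : Type u) [CommRing k] (B : Type v) [AddCommGroup B] [Module k B]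
variable (V : Type v) [AddCommGroup V] [Module k V]

/-- The tensor power `V^{⊗n}`. -/
def Tens (n : ℕ) : Type (max u v) := ⨂[k]^n V

instance (n : ℕ) : AddCommGroup (Tens k V n) := by unfold Tens; infer_instance
instance (n : ℕ) : Module k (Tens k V n) := (inferInstance : Module k (⨂[k]^n V))
instance (n : ℕ) : AddCommMonoid (Tens k V n) := AddCommGroup.toAddCommMonoid

/-- The tensor product `B ⊗ V^{⊗p}`. -/
def Forms (p : ℕ) : Type (max u v) := B ⊗[k] Tens k V p

instance (p : ℕ) : AddCommGroup (Forms k B V p) := by unfold Forms; infer_instance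
instance (p : ℕ) : Module k (Forms k B V p) := (inferInstance : Module k (B ⊗[k] Tens k V p))
instance (p : ℕ) : AddCommMonoid (Forms k B V p) := AddCommGroup.toAddCommMonoid

variable {k B V}

/-- The tautological identification of `B ⊗ V^{⊗p}` with `Forms k B V p`. -/
def forms (p : ℕ) : B ⊗[k] Tens k V p ≃ₗ[k] Forms k B V p :=
  LinearEquiv.refl k (B ⊗[k] Tens k V p)

/-- Concatenation `V^{⊗a} ⊗ V^{⊗b} ≅ V^{⊗c}`, where `a + b = c`. -/
def concat {a b c : ℕ} (h : a + b = c) : Tens k V a ⊗[k] Tens k V b ≃ₗ[k] Tens k V c :=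
  (TensorPower.mulEquiv.trans (TensorPower.cast k V h) : (⨂[k]^a V) ⊗[k] (⨂[k]^b V) ≃ₗ[k] ⨂[k]^c V)

/-- The map `id^{⊗a} ⊗ h ⊗ id^{⊗b}` for a linear map `h : V^{⊗n} → V^{⊗q}`. -/
def whisker (a b : ℕ) {n q N N' : ℕ} (hN : a + n + b = N) (hN' : a + q + b = N')
    (h : Tens k V n →ₗ[k] Tens k V q) : Tens k V N →ₗ[k] Tens k V N' :=
  (concat hN').toLinearMap ∘ₗ
    ((concat rfl).toLinearMap ∘ₗ h.lTensor (Tens k V a) ∘ₗ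
      (concat rfl).symm.toLinearMap).rTensor (Tens k V b) ∘ₗ
    (concat hN).symm.toLinearMap

/-- The map `id_B ⊗ h : B ⊗ V^{⊗p} → B ⊗ V^{⊗q}` for a linear map `h : V^{⊗p} → V^{⊗q}`. -/
def idTensor {p q : ℕ} (h : Tens k V p →ₗ[k] Tens k V q) : Forms k B V p →ₗ[k] Forms k B V q :=
  (forms q).toLinearMap ∘ₗ h.lTensor B ∘ₗ (forms p).symm.toLinearMap

/-- Concatenation `(B ⊗ V^{⊗p}) ⊗ V^{⊗r} → B ⊗ V^{⊗P}`, where `p + r = P`. -/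
def append {p r P : ℕ} (h : p + r = P) : Forms k B V p ⊗[k] Tens k V r →ₗ[k] Forms k B V P :=
  (forms P).toLinearMap ∘ₗ (concat h).toLinearMap.lTensor B ∘ₗ
    (TensorProduct.assoc k B _ _).toLinearMap ∘ₗ (forms p).symm.toLinearMap.rTensor (Tens k V r)

/-- The map `f ⊗ id^{⊗r}` for a linear map `f : V^{⊗m} → B ⊗ V^{⊗p}`, linearly in `f`. -/
def extend (r : ℕ) {m p M P : ℕ} (hM : m + r = M) (hP : p + r = P) :
    (Tens k V m →ₗ[k] Forms k B V p) →ₗ[k] Tens k V M →ₗ[k] Forms k B V P where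
  toFun f := append hP ∘ₗ f.rTensor (Tens k V r) ∘ₗ (concat hM).symm.toLinearMap
  map_add' f g := by simp [LinearMap.rTensor_add, LinearMap.add_comp, LinearMap.comp_add]
  map_smul' c f := by simp [LinearMap.rTensor_smul, LinearMap.smul_comp, LinearMap.comp_smul]

theorem mulEquiv_assoc {a b c d e N : ℕ} (h1 : a + b = d) (h2 : d + c = N) (h3 : b + c = e)
    (h4 : a + e = N) (x : ⨂[k]^a V) (y : (⨂[k]^b) V) (z : (⨂[k]^c) V) :
    TensorPower.cast k V h2 (TensorPower.mulEquiv
      (TensorPower.cast k V h1 (TensorPower.mulEquiv (x ⊗ₜ[k] y)) ⊗ₜ[k] z)) =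
    TensorPower.cast k V h4 (TensorPower.mulEquiv
      (x ⊗ₜ[k] TensorPower.cast k V h3 (TensorPower.mulEquiv (y ⊗ₜ[k] z)))) := by
  subst h1 h3 h2
  have := TensorPower.mul_assoc x y z
  simp only [TensorPower.gMul_def] at this
  simp only [TensorPower.cast_refl, LinearEquiv.refl_apply]
  rw [← this]
  simp

theorem concat_assoc {a b c d e N : ℕ} (h1 : a + b = d) (h2 : d + c = N) (h3 : b + c = e)
    (h4 : a + e = N) (x : Tens k V a) (y : Tens k V b) (z : Tens k V c) :
    concat h2 (concat h1 (x ⊗ₜ y) ⊗ₜ z) = concat h4 (x ⊗ₜ concat h3 (y ⊗ₜ z)) :=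
  mulEquiv_assoc h1 h2 h3 h4 x y z

theorem ext_concat {M : Type*} [AddCommMonoid M] [Module k M] {a b c : ℕ} (h : a + b = c)
    {F G : Tens k V c →ₗ[k] M}
    (H : ∀ x y, F (concat h (x ⊗ₜ y)) = G (concat h (x ⊗ₜ y))) : F = G := by
  have : F ∘ₗ (concat h).toLinearMap = G ∘ₗ (concat h).toLinearMap :=
    TensorProduct.ext' H
  refine LinearMap.ext fun x => ?_
  simpa using LinearMap.congr_fun this ((concat h).symm x)

theorem append_forms {p r P : ℕ} (h : p + r = P) (b : B) (x : Tens k V p) (y : Tens k V r) :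
    append h (forms p (b ⊗ₜ x) ⊗ₜ y) = forms P (b ⊗ₜ concat h (x ⊗ₜ y)) := by
  simp [append]

theorem idTensor_forms {p q : ℕ} (h : Tens k V p →ₗ[k] Tens k V q) (b : B) (x : Tens k V p) :
    idTensor h (forms p (b ⊗ₜ x)) = forms q (b ⊗ₜ h x) := by
  simp [idTensor]

theorem forms_induction {p : ℕ} {C : Forms k B V p → Prop} (x : Forms k B V p) (h0 : C 0)
    (hadd : ∀ x y, C x → C y → C (x + y)) (h : ∀ b t, C (forms p (b ⊗ₜ t))) : C x := by
  obtain ⟨x, rfl⟩ := (forms p).surjective x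
  induction x with
  | zero => simpa using h0
  | add x y hx hy => rw [map_add]; exact hadd _ _ hx hy
  | tmul b t => exact h b t

theorem concat_induction {a b c : ℕ} (h : a + b = c) {C : Tens k V c → Prop} (x : Tens k V c)
    (h0 : C 0) (hadd : ∀ x y, C x → C y → C (x + y)) (H : ∀ s t, C (concat h (s ⊗ₜ t))) :
    C x := by
  obtain ⟨x, rfl⟩ := (concat h).surjective x
  induction x with
  | zero => simpa using h0
  | add x y hx hy => rw [map_add]; exact hadd _ _ hx hy
  | tmul b t => exact H b t

theorem append_append {p r s P Q t : ℕ} (h1 : p + r = P) (h2 : P + s = Q) (h3 : r + s = t)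
    (h4 : p + t = Q) (x : Forms k B V p) (y : Tens k V r) (z : Tens k V s) :
    append h2 (append h1 (x ⊗ₜ y) ⊗ₜ z) = append h4 (x ⊗ₜ concat h3 (y ⊗ₜ z)) := by
  induction x using forms_induction with
  | h0 => simp
  | hadd x y hx hy => simp only [TensorProduct.add_tmul, map_add, hx, hy]
  | h b w => rw [append_forms, append_forms, append_forms, concat_assoc h1 h2 h3 h4]

theorem extend_concat (r : ℕ) {m p M P : ℕ} (hM : m + r = M) (hP : p + r = P)
    (f : Tens k V m →ₗ[k] Forms k B V p) (x : Tens k V m) (y : Tens k V r) :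
    extend r hM hP f (concat hM (x ⊗ₜ y)) = append hP (f x ⊗ₜ y) := by
  simp [extend]

theorem whisker_concat (a b : ℕ) {n q N N' c d : ℕ} (hN : a + n + b = N) (hN' : a + q + b = N')
    (h : Tens k V n →ₗ[k] Tens k V q) (hc : a + n = c) (hcN : c + b = N) (hd : a + q = d)
    (hdN : d + b = N') (x : Tens k V a) (y : Tens k V n) (z : Tens k V b) :
    whisker a b hN hN' h (concat hcN (concat hc (x ⊗ₜ y) ⊗ₜ z)) =
      concat hdN (concat hd (x ⊗ₜ h y) ⊗ₜ z) := by
  subst hc hd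
  simp [whisker]

theorem extend_extend (r s : ℕ) {m p M P M' P' : ℕ} (hM : m + r = M) (hP : p + r = P)
    (hM' : M + s = M') (hP' : P + s = P') (f : Tens k V m →ₗ[k] Forms k B V p) {t : ℕ}
    (ht : r + s = t) (h1 : m + t = M') (h2 : p + t = P') :
    extend s hM' hP' (extend r hM hP f) = extend t h1 h2 f := by
  refine ext_concat h1 fun x w => ?_
  induction w using concat_induction ht with
  | h0 => simp
  | hadd x y hx hy => simp only [TensorProduct.tmul_add, map_add, hx, hy]
  | H y z =>
    rw [← concat_assoc hM hM' ht h1, extend_concat, extend_concat, concat_assoc hM hM' ht h1,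
      extend_concat, append_append _ _ ht h2]

theorem ext_concat₃ {M : Type*} [AddCommMonoid M] [Module k M] {a b c d N : ℕ} (h : a + b = d)
    (h' : d + c = N) {F G : Tens k V N →ₗ[k] M}
    (H : ∀ x y z, F (concat h' (concat h (x ⊗ₜ y) ⊗ₜ z)) =
      G (concat h' (concat h (x ⊗ₜ y) ⊗ₜ z))) : F = G := by
  refine ext_concat h' fun w z => ?_
  induction w using concat_induction h with
  | h0 => simp
  | hadd x y hx hy => simp only [TensorProduct.add_tmul, map_add, hx, hy]
  | H x y => exact H x y z

/-- `(id^{⊗a} ⊗ h ⊗ id^{⊗b}) ⊗ id = id^{⊗a} ⊗ h ⊗ id^{⊗(b+1)}` on concatenated tensors. -/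
theorem whisker_concat_one (a b : ℕ) {n q N N' N₁ N₁' : ℕ} (hN : a + n + b = N)
    (hN' : a + q + b = N') (h : Tens k V n →ₗ[k] Tens k V q) (e : N + 1 = N₁) (e' : N' + 1 = N₁')
    (h1 : a + n + (b + 1) = N₁) (h2 : a + q + (b + 1) = N₁') (w : Tens k V N) (z : Tens k V 1) :
    whisker a (b + 1) h1 h2 h (concat e (w ⊗ₜ z)) =
      concat e' (whisker a b hN hN' h w ⊗ₜ z) := by
  induction w using concat_induction hN with
  | h0 => simp
  | hadd x y hx hy => simp only [TensorProduct.add_tmul, map_add, hx, hy]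
  | H w y =>
    induction w using concat_induction (rfl : a + n = _) with
    | h0 => simp
    | hadd x y hx hy => simp only [TensorProduct.add_tmul, map_add, hx, hy]
    | H u x =>
      rw [whisker_concat a b hN hN' h rfl hN rfl hN', concat_assoc hN e rfl h1,
        whisker_concat a (b + 1) h1 h2 h rfl h1 rfl h2, ← concat_assoc hN' e' rfl h2]

/-- `(F ∘ (id^{⊗a} ⊗ h ⊗ id^{⊗b})) ⊗ id = (F ⊗ id) ∘ (id^{⊗a} ⊗ h ⊗ id^{⊗(b+1)})`. -/
theorem extend_comp_whisker (a b : ℕ) {n q N N' P : ℕ} (hN : a + n + b = N)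
    (hN' : a + q + b = N') (h : Tens k V n →ₗ[k] Tens k V q)
    (F : Tens k V N' →ₗ[k] Forms k B V P) {N₁ N₁' : ℕ} (e : N + 1 = N₁)
    (e' : N' + 1 = N₁') {P₁ : ℕ} (eP : P + 1 = P₁) (h1 : a + n + (b + 1) = N₁)
    (h2 : a + q + (b + 1) = N₁') :
    extend 1 e eP (F ∘ₗ whisker a b hN hN' h) =
      extend 1 e' eP F ∘ₗ whisker a (b + 1) h1 h2 h := by
  refine ext_concat e fun w y => ?_
  rw [extend_concat, LinearMap.comp_apply, LinearMap.comp_apply,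
    whisker_concat_one a b hN hN' h e e' h1 h2, extend_concat]

/-- `(id_B ⊗ id^{⊗a} ⊗ h ⊗ id^{⊗(b+1)}) ∘ (F ⊗ id) = ((id_B ⊗ id^{⊗a} ⊗ h ⊗ id^{⊗b}) ∘ F) ⊗ id`. -/
theorem idTensor_whisker_comp_extend (a b : ℕ) {n q N N' m : ℕ} (hN : a + n + b = N)
    (hN' : a + q + b = N') (h : Tens k V n →ₗ[k] Tens k V q)
    (F : Tens k V m →ₗ[k] Forms k B V N) {N₁ N₁' m₁ : ℕ} (e : N + 1 = N₁)
    (e' : N' + 1 = N₁') (em : m + 1 = m₁) (h1 : a + n + (b + 1) = N₁)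
    (h2 : a + q + (b + 1) = N₁') :
    idTensor (whisker a (b + 1) h1 h2 h) ∘ₗ extend 1 em e F =
      extend 1 em e' (idTensor (whisker a b hN hN' h) ∘ₗ F) := by
  refine ext_concat em fun u y => ?_
  rw [extend_concat, LinearMap.comp_apply, extend_concat, LinearMap.comp_apply]
  induction F u using forms_induction with
  | h0 => simp
  | hadd x y hx hy => simp only [TensorProduct.add_tmul, map_add, hx, hy]
  | h c w =>
    rw [append_forms, idTensor_forms, idTensor_forms, append_forms,
      whisker_concat_one a b hN hN' h e e' h1 h2]

/-- The two ways of composing `f` and `h` side by side agree. -/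
theorem extend_comp_whisker_zero {m p n q M M' P P' : ℕ} (f : Tens k V m →ₗ[k] Forms k B V p)
    (h : Tens k V n →ₗ[k] Tens k V q) (h1 : m + n + 0 = M) (h2 : m + q + 0 = M') (h3 : m + q = M')
    (h4 : p + q = P') (h5 : m + n = M) (h6 : p + n = P) (h7 : p + n + 0 = P)
    (h8 : p + q + 0 = P') :
    extend q h3 h4 f ∘ₗ whisker m 0 h1 h2 h =
      idTensor (whisker p 0 h7 h8 h) ∘ₗ extend n h5 h6 f := by
  refine ext_concat₃ h5 (add_zero M) fun x y z => ?_
  rw [LinearMap.comp_apply, LinearMap.comp_apply,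
    whisker_concat m 0 h1 h2 h h5 (add_zero _) h3 (add_zero _),
    concat_assoc h3 (add_zero _) (add_zero _) h3, extend_concat,
    concat_assoc h5 (add_zero _) (add_zero _) h5, extend_concat]
  induction f x using forms_induction with
  | h0 => simp
  | hadd x y hx hy => simp only [TensorProduct.add_tmul, map_add, hx, hy]
  | h c w =>
    rw [append_forms, append_forms, idTensor_forms,
      ← concat_assoc h4 (add_zero _) (add_zero _) h4,
      ← concat_assoc h6 (add_zero _) (add_zero _) h6,
      whisker_concat p 0 h7 h8 h h6 (add_zero _) h4 (add_zero _)]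

theorem whisker_congr {a b a' b' : ℕ} (ha : a = a') (hb : b = b') {n q N N' : ℕ}
    (hN : a + n + b = N) (hN' : a + q + b = N') (h : Tens k V n →ₗ[k] Tens k V q) :
    whisker a b hN hN' h = whisker a' b' (by omega) (by omega) h := by
  subst ha hb; rfl

end TensorPowers

section Algebra

variable (k : Type u) [Field k] (A : Type v) [Ring A] [Algebra k A]

/-- The quotient `Ā = A / (k · 1)` of the `k`-module `A`. -/
abbrev Bar : Type v := A ⧸ Submodule.span k {(1 : A)}

/-- The canonical projection `π : A → Ā`. -/
def proj : A →ₗ[k] Bar k A := Submodule.mkQ _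

/-- The noncommutative differential forms `A ⊗ Ā^{⊗p}`, placed in degree `-p`. -/
abbrev Omega (p : ℕ) : Type (max u v) := Forms k A (Bar k A) p

/-- The cochains `Hom(Ā^{⊗m}, A ⊗ Ā^{⊗p})`; this is `C^{m-p}(A, Ω^p)`. -/
abbrev Cochain (m p : ℕ) : Type (max u v) := Tens k (Bar k A) m →ₗ[k] Omega k A p

theorem exists_section : ∃ σ : Bar k A →ₗ[k] A, proj k A ∘ₗ σ = LinearMap.id :=
  (proj k A).exists_rightInverse_of_surjective (Submodule.range_mkQ _)

variable {k A}

/-- The identification `Ā = Ā^{⊗1}`. -/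
def tensOne : Bar k A ≃ₗ[k] Tens k (Bar k A) 1 :=
  ((PiTensorProduct.subsingletonEquiv (R := k) (s := fun _ : Fin 1 => Bar k A) 0).symm :
    Bar k A ≃ₗ[k] ⨂[k]^1 (Bar k A))

/-- Left multiplication `μ ⊗ id : A ⊗ (A ⊗ Ā^{⊗p}) → A ⊗ Ā^{⊗p}`, that is, the left action of `A`
on the differential forms. -/
def leftMul (p : ℕ) : A ⊗[k] Omega k A p →ₗ[k] Omega k A p :=
  (forms p).toLinearMap ∘ₗ (LinearMap.mul' k A).rTensor _ ∘ₗ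
    (TensorProduct.assoc k A A _).symm.toLinearMap ∘ₗ (forms p).symm.toLinearMap.lTensor A

/-- The embedding `θ_p : f ↦ f ⊗ id`. -/
def theta {m p : ℕ} : Cochain k A m p →ₗ[k] Cochain k A (m + 1) (p + 1) := extend 1 rfl rfl

theorem theta_concat {m p : ℕ} (f : Cochain k A m p) (x : Tens k (Bar k A) m)
    (y : Tens k (Bar k A) 1) : theta f (concat rfl (x ⊗ₜ y)) = append rfl (f x ⊗ₜ y) :=
  extend_concat 1 rfl rfl f x y

variable (k) in
/-- The sign `(-1)^n` as an element of `k`. -/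
def sgn (n : ℤ) : k := ((n.negOnePow : ℤ) : k)

theorem sgn_congr {a b : ℤ} (h : Even (a - b)) : sgn k a = sgn k b := by
  unfold sgn; rw [(Int.negOnePow_eq_iff a b).2 h]

theorem sgn_succ (a : ℤ) : sgn k (a + 1) = -sgn k a := by
  unfold sgn; rw [Int.negOnePow_succ]; push_cast; rfl

/-! ### The Hochschild differential -/

/-- The product `Ā^{⊗2} → Ā^{⊗1}`, `x ⊗ y ↦ π(σ x · σ y)`, formed with lifts `σ` to `A`. -/
def barMul (σ : Bar k A →ₗ[k] A) : Tens k (Bar k A) 2 →ₗ[k] Tens k (Bar k A) 1 :=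
  (tensOne.toLinearMap ∘ₗ proj k A ∘ₗ LinearMap.mul' k A ∘ₗ TensorProduct.map σ σ) ∘ₗ
    TensorProduct.map tensOne.symm.toLinearMap tensOne.symm.toLinearMap ∘ₗ
    (concat (rfl : 1 + 1 = 2)).symm.toLinearMap

/-- The map `a₀ ⊗ ā₁ ⊗ ⋯ ⊗ ā_{p+1} ↦ a₀ σ(ā₁) ⊗ ā₂ ⊗ ⋯ ⊗ ā_{p+1}`. -/
def mulFirst (σ : Bar k A →ₗ[k] A) (p : ℕ) : Omega k A (p + 1) →ₗ[k] Omega k A p :=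
  leftMul p ∘ₗ ((forms p).toLinearMap ∘ₗ (σ ∘ₗ tensOne.symm.toLinearMap).rTensor _ ∘ₗ
    (concat (add_comm 1 p)).symm.toLinearMap).lTensor A ∘ₗ (forms (p + 1)).symm.toLinearMap

/-- The right action of `A` on the differential forms, as the map
`ω ⊗ ā ↦ ω ◂ σ(ā)`, `A ⊗ Ā^{⊗(p+1)} → A ⊗ Ā^{⊗p}`, so that
`a₀ ⊗ ā₁ ⊗ ⋯ ⊗ ā_{p+1} ↦ ∑_{i=0}^p (-1)^{p-i} a₀ ⊗ ā₁ ⊗ ⋯ ⊗ π(a_i a_{i+1}) ⊗ ⋯ ⊗ ā_{p+1}`,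
where `a_i = σ(ā_i)` for `i > 0`. The term of `i : Fin p` is the one of index `i + 1`. -/
def rightAct (σ : Bar k A →ₗ[k] A) (p : ℕ) : Omega k A (p + 1) →ₗ[k] Omega k A p :=
  sgn k p • mulFirst σ p +
    ∑ i : Fin p, sgn k (p - (i + 1)) •
      idTensor (whisker (N := p + 1) (N' := p) i (p - 1 - i) (by omega) (by omega) (barMul σ))

/-- The map `ā₁ ⊗ ⋯ ⊗ ā_{m+1} ↦ σ(ā₁) f(ā₂ ⊗ ⋯ ⊗ ā_{m+1})`. -/
def leftAct (σ : Bar k A →ₗ[k] A) {m p : ℕ} (f : Cochain k A m p) : Cochain k A (m + 1) p :=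
  leftMul p ∘ₗ TensorProduct.map (σ ∘ₗ tensOne.symm.toLinearMap) f ∘ₗ
    (concat (add_comm 1 m)).symm.toLinearMap

/-- The Hochschild differential on `C^{m-p}(A, Ω^p)`, computed with lifts `σ` to `A`:
`(-1)^{m-p+1} δ(f)(ā₁ ⊗ ⋯ ⊗ ā_{m+1}) = a₁ f(ā₂ ⊗ ⋯ ⊗ ā_{m+1}) +
∑_{j=1}^m (-1)^j f(ā₁ ⊗ ⋯ ⊗ π(a_j a_{j+1}) ⊗ ⋯ ⊗ ā_{m+1}) +
(-1)^{m+1} f(ā₁ ⊗ ⋯ ⊗ ā_m) ◂ a_{m+1}`. The term of `j : Fin m` is the one of index `j + 1`. -/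
def hochschild (σ : Bar k A →ₗ[k] A) {m p : ℕ} : Cochain k A m p →ₗ[k] Cochain k A (m + 1) p where
  toFun f := sgn k (m - p + 1) •
    (leftAct σ f +
      ∑ j : Fin m, sgn k (j + 1) • (f ∘ₗ whisker (N := m + 1) (N' := m) j (m - 1 - j)
        (by omega) (by omega) (barMul σ)) +
      sgn k (m + 1) • (rightAct σ p ∘ₗ theta f))
  map_add' f g := by
    simp only [leftAct, TensorProduct.map_add_right, map_add, LinearMap.add_comp,
      LinearMap.comp_add, smul_add, Finset.sum_add_distrib]
    abel
  map_smul' c f := by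
    simp only [leftAct, TensorProduct.map_smul_right, map_smul, LinearMap.smul_comp,
      LinearMap.comp_smul, smul_comm _ c, ← Finset.smul_sum, ← smul_add, RingHom.id_apply]

theorem hochschild_apply (σ : Bar k A →ₗ[k] A) {m p : ℕ} (f : Cochain k A m p) :
    hochschild σ f = sgn k (m - p + 1) •
      (leftAct σ f +
        ∑ j : Fin m, sgn k (j + 1) • (f ∘ₗ whisker (N := m + 1) (N' := m) j (m - 1 - j)
          (by omega) (by omega) (barMul σ)) +
        sgn k (m + 1) • (rightAct σ p ∘ₗ theta f)) := rfl

theorem leftMul_forms (p : ℕ) (a b : A) (x : Tens k (Bar k A) p) :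
    leftMul p (a ⊗ₜ forms p (b ⊗ₜ x)) = forms p ((a * b) ⊗ₜ x) := by
  simp [leftMul]

theorem leftMul_append {p r P : ℕ} (h : p + r = P) (a : A) (x : Omega k A p)
    (y : Tens k (Bar k A) r) :
    leftMul P (a ⊗ₜ append h (x ⊗ₜ y)) = append h (leftMul p (a ⊗ₜ x) ⊗ₜ y) := by
  induction x using forms_induction with
  | h0 => simp
  | hadd x y hx hy => simp only [TensorProduct.add_tmul, TensorProduct.tmul_add, map_add, hx, hy]
  | h b w => rw [append_forms, leftMul_forms, leftMul_forms, append_forms]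

theorem leftAct_concat (σ : Bar k A →ₗ[k] A) {m p : ℕ} (f : Cochain k A m p)
    (x : Tens k (Bar k A) 1) (y : Tens k (Bar k A) m) :
    leftAct σ f (concat (add_comm 1 m) (x ⊗ₜ y)) = leftMul p (σ (tensOne.symm x) ⊗ₜ f y) := by
  simp [leftAct]

theorem leftAct_theta (σ : Bar k A →ₗ[k] A) {m p : ℕ} (f : Cochain k A m p) :
    leftAct σ (theta f) = theta (leftAct σ f) := by
  refine ext_concat₃ (add_comm 1 m) rfl fun x y z => ?_
  rw [theta_concat, leftAct_concat, concat_assoc _ _ rfl (add_comm 1 (m + 1)),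
    leftAct_concat, theta_concat, leftMul_append]

theorem mulFirst_append (σ : Bar k A →ₗ[k] A) {p : ℕ} (x : Omega k A (p + 1))
    (y : Tens k (Bar k A) 1) :
    mulFirst σ (p + 1) (append rfl (x ⊗ₜ y)) = append rfl (mulFirst σ p x ⊗ₜ y) := by
  induction x using forms_induction with
  | h0 => simp
  | hadd x y hx hy => simp only [TensorProduct.add_tmul, map_add, hx, hy]
  | h a w =>
    induction w using concat_induction (add_comm 1 p) with
    | h0 => simp
    | hadd x y hx hy => simp only [TensorProduct.add_tmul, TensorProduct.tmul_add, map_add, hx, hy]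
    | H u x =>
      rw [append_forms, concat_assoc (add_comm 1 p) rfl rfl (add_comm 1 (p + 1))]
      simp [mulFirst, leftMul_forms, append_forms]

theorem sum_comp' {M N P ι : Type*} [AddCommMonoid M] [AddCommMonoid N] [AddCommMonoid P]
    [Module k M] [Module k N] [Module k P] (s : Finset ι) (F : ι → N →ₗ[k] P) (G : M →ₗ[k] N) :
    (∑ i ∈ s, F i) ∘ₗ G = ∑ i ∈ s, F i ∘ₗ G := by
  ext x; simp

theorem rightAct_theta_theta (σ : Bar k A →ₗ[k] A) {m p : ℕ} (f : Cochain k A m p) :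
    rightAct σ (p + 1) ∘ₗ theta (theta f) =
      idTensor (whisker p 0 rfl rfl (barMul σ)) ∘ₗ theta (theta f) -
        theta (rightAct σ p ∘ₗ theta f) := by
  have h1 : mulFirst σ (p + 1) ∘ₗ theta (theta f) = theta (mulFirst σ p ∘ₗ theta f) := by
    refine ext_concat rfl fun x y => ?_
    rw [LinearMap.comp_apply, theta_concat, theta_concat, mulFirst_append]
    rfl
  have h2 : ∀ i : Fin p, sgn k ((p + 1 : ℕ) - ((i.castSucc : ℕ) + 1)) •
      (idTensor (whisker (N := p + 1 + 1) (N' := p + 1) i.castSucc (p + 1 - 1 - i.castSucc)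
        (by simp; omega) (by simp; omega) (barMul σ)) ∘ₗ theta (theta f)) =
      - (sgn k (p - (i + 1)) • theta (idTensor (whisker (N := p + 1) (N' := p) i (p - 1 - i)
        (by omega) (by omega) (barMul σ)) ∘ₗ theta f)) := by
    intro i
    have e : sgn k ((p + 1 : ℕ) - ((i.castSucc : ℕ) + 1)) = -sgn k (p - (i + 1)) := by
      rw [← sgn_succ]; congr 1; simp; ring
    rw [e, neg_smul]
    congr 2
    have hb : p + 1 - 1 - (i.castSucc : ℕ) = p - 1 - i + 1 := by
      have := i.2
      simp only [Fin.val_castSucc]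
      omega
    rw [whisker_congr (Fin.val_castSucc i) hb]
    exact idTensor_whisker_comp_extend _ _ _ _ _ _ _ _ _ _ _
  have h3 : sgn k (((p + 1 : ℕ) : ℤ) - ((Fin.last p : ℕ) + 1)) = 1 := by
    simp [sgn]
  rw [rightAct, rightAct, Fin.sum_univ_castSucc]
  simp only [LinearMap.add_comp, LinearMap.smul_comp, sum_comp', map_add, map_sum, map_smul]
  rw [h1, Finset.sum_congr rfl fun i _ => h2 i, Finset.sum_neg_distrib, h3, one_smul,
    whisker_congr (Fin.val_last p) (show p + 1 - 1 - (Fin.last p : ℕ) = 0 by simp),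
    Nat.cast_succ, sgn_succ, neg_smul]
  abel

/-- The maps `θ_p` are morphisms of cochain complexes. -/
theorem hochschild_theta (σ : Bar k A →ₗ[k] A) {m p : ℕ} (f : Cochain k A m p) :
    hochschild σ (theta f) = theta (hochschild σ f) := by
  have h2 : ∀ j : Fin m, sgn k ((j.castSucc : ℕ) + 1) • (theta f ∘ₗ
      whisker (N := m + 1 + 1) (N' := m + 1) j.castSucc (m + 1 - 1 - j.castSucc) (by simp; omega)
        (by simp; omega) (barMul σ)) =
      sgn k (j + 1) • theta (f ∘ₗ whisker (N := m + 1) (N' := m) j (m - 1 - j)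
        (by omega) (by omega) (barMul σ)) := by
    intro j
    congr 1
    have hb : m + 1 - 1 - (j.castSucc : ℕ) = m - 1 - j + 1 := by
      have := j.2
      simp only [Fin.val_castSucc]
      omega
    rw [whisker_congr (Fin.val_castSucc j) hb]
    exact (extend_comp_whisker _ _ _ _ _ _ _ _ _ _ _).symm
  have h4 : theta f ∘ₗ whisker (N := m + 1 + 1) (N' := m + 1) (Fin.last m : ℕ)
      (m + 1 - 1 - (Fin.last m : ℕ)) (by simp) (by simp) (barMul σ) =
      idTensor (whisker p 0 rfl rfl (barMul σ)) ∘ₗ theta (theta f) := by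
    rw [whisker_congr (Fin.val_last m) (show m + 1 - 1 - (Fin.last m : ℕ) = 0 by simp),
      theta, theta, extend_extend 1 1 rfl rfl rfl rfl f rfl rfl rfl]
    exact extend_comp_whisker_zero f _ _ _ _ _ _ _ _ _
  rw [hochschild_apply, hochschild_apply, map_smul, map_add, map_add, map_sum, leftAct_theta,
    rightAct_theta_theta, map_smul]
  congr 1
  · apply sgn_congr; push_cast; simp
  rw [Fin.sum_univ_castSucc, Finset.sum_congr rfl fun i _ => h2 i, h4, Fin.val_last,
    Nat.cast_succ, sgn_succ ((m : ℤ) + 1), neg_smul, smul_sub]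
  simp only [map_smul]
  abel

/-! ### Cup product and circle product of cochains -/

/-- The cup product
`f ∪ g = (μ ⊗ id^{⊗(p+q)}) (id_A ⊗ f ⊗ id^{⊗q}) (g ⊗ id^{⊗m})` of `f ∈ C^{m-p}(A, Ω^p)` and
`g ∈ C^{n-q}(A, Ω^q)`, where `M = m + n` and `P = p + q`. -/
def cup {m p n q M P : ℕ} (hM : n + m = M) (hP : p + q = P) :
    Cochain k A m p →ₗ[k] Cochain k A n q →ₗ[k] Cochain k A M P :=
  LinearMap.mk₂ k
    (fun f g => leftMul P ∘ₗ (extend q rfl hP f).lTensor A ∘ₗ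
      (forms (m + q)).symm.toLinearMap ∘ₗ extend m hM (add_comm q m) g)
    (fun f f' g => by simp [LinearMap.lTensor_add, LinearMap.add_comp, LinearMap.comp_add])
    (fun c f g => by simp [LinearMap.lTensor_smul, LinearMap.smul_comp, LinearMap.comp_smul])
    (fun f g g' => by simp [LinearMap.comp_add])
    (fun c f g => by simp [LinearMap.comp_smul])

/-- The map `π ⊗ id^{⊗q} : A ⊗ Ā^{⊗q} → Ā^{⊗(q+1)}`. -/
def projOmega (q : ℕ) : Omega k A q →ₗ[k] Tens k (Bar k A) (q + 1) :=
  (concat (add_comm 1 q)).toLinearMap ∘ₗ (tensOne.toLinearMap ∘ₗ proj k A).rTensor _ ∘ₗ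
    (forms q).symm.toLinearMap

/-- For `i : Fin m`, the composition
`f ∘_{i+1} g = (f ⊗ id^{⊗q}) (id^{⊗i} ⊗ ḡ ⊗ id^{⊗(m-1-i)})`, where `ḡ = (π ⊗ id^{⊗q}) g`,
`M = m + n - 1` and `P = p + q`. -/
def circIn {m p n q M P : ℕ} (hM : m + n - 1 = M) (hP : p + q = P) (i : Fin m) :
    Cochain k A m p →ₗ[k] Cochain k A n q →ₗ[k] Cochain k A M P :=
  LinearMap.mk₂ k
    (fun f g => extend q rfl hP f ∘ₗ
      whisker (N := M) (N' := m + q) i (m - 1 - i) (by omega) (by omega) (projOmega q ∘ₗ g))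
    (fun f f' g => by simp [LinearMap.add_comp])
    (fun c f g => by simp [LinearMap.smul_comp])
    (fun f g g' => by simp [whisker, LinearMap.lTensor_add, LinearMap.rTensor_add,
      LinearMap.add_comp, LinearMap.comp_add])
    (fun c f g => by simp [whisker, LinearMap.lTensor_smul, LinearMap.rTensor_smul,
      LinearMap.smul_comp, LinearMap.comp_smul])

/-- For `i : Fin p`, the composition
`f ∘_{-(i+1)} g = (id_A ⊗ id^{⊗i} ⊗ ḡ ⊗ id^{⊗(p-1-i)}) (f ⊗ id^{⊗n})`, where `g` has `n + 1` inputs,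
`ḡ = (π ⊗ id^{⊗q}) g`, `M = m + n` and `P = p + q`. -/
def circOut {m p n q M P : ℕ} (hM : m + n = M) (hP : p + q = P) (i : Fin p) :
    Cochain k A m p →ₗ[k] Cochain k A (n + 1) q →ₗ[k] Cochain k A M P :=
  LinearMap.mk₂ k
    (fun f g => idTensor (whisker (N := p + n) (N' := P) i (p - 1 - i) (by omega) (by omega)
      (projOmega q ∘ₗ g)) ∘ₗ extend n hM rfl f)
    (fun f f' g => by simp [LinearMap.comp_add])
    (fun c f g => by simp [LinearMap.comp_smul])
    (fun f g g' => by simp [whisker, idTensor, LinearMap.lTensor_add, LinearMap.rTensor_add,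
      LinearMap.add_comp, LinearMap.comp_add])
    (fun c f g => by simp [whisker, idTensor, LinearMap.lTensor_smul, LinearMap.rTensor_smul,
      LinearMap.smul_comp, LinearMap.comp_smul])

/-- The circle product of `f ∈ C^{m-p}(A, Ω^p)` and `g ∈ C^{n+1-q}(A, Ω^q)`,
`f ∘ g = ∑_{i=1}^m (-1)^{(n-q)(i-1)} f ∘_i g - ∑_{i=1}^p (-1)^{(n-q)(i-m-p-1)} f ∘_{-i} g`. -/
def circ {m p n q M P : ℕ} (hM : m + n = M) (hP : p + q = P) :
    Cochain k A m p →ₗ[k] Cochain k A (n + 1) q →ₗ[k] Cochain k A M P :=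
  ∑ i : Fin m, sgn k ((n - q) * i) • circIn hM hP i -
    ∑ i : Fin p, sgn k ((n - q) * ((i + 1) - m - p - 1)) • circOut hM hP i

theorem cup_apply {m p n q M P : ℕ} (hM : n + m = M) (hP : p + q = P)
    (f : Cochain k A m p) (g : Cochain k A n q) : cup hM hP f g =
      leftMul P ∘ₗ (extend q rfl hP f).lTensor A ∘ₗ
        (forms (m + q)).symm.toLinearMap ∘ₗ extend m hM (add_comm q m) g := rfl

theorem circIn_apply {m p n q M P : ℕ} (hM : m + n - 1 = M) (hP : p + q = P) (i : Fin m)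
    (f : Cochain k A m p) (g : Cochain k A n q) : circIn hM hP i f g =
      extend q rfl hP f ∘ₗ whisker (N := M) (N' := m + q) i (m - 1 - i) (by omega) (by omega)
        (projOmega q ∘ₗ g) := rfl

theorem circOut_apply {m p n q M P : ℕ} (hM : m + n = M) (hP : p + q = P) (i : Fin p)
    (f : Cochain k A m p) (g : Cochain k A (n + 1) q) : circOut hM hP i f g =
      idTensor (whisker (N := p + n) (N' := P) i (p - 1 - i) (by omega) (by omega)
        (projOmega q ∘ₗ g)) ∘ₗ extend n hM rfl f := rfl

theorem circ_apply {m p n q M P : ℕ} (hM : m + n = M) (hP : p + q = P)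
    (f : Cochain k A m p) (g : Cochain k A (n + 1) q) : circ hM hP f g =
      ∑ i : Fin m, sgn k ((n - q) * i) • circIn hM hP i f g -
        ∑ i : Fin p, sgn k ((n - q) * ((i + 1) - m - p - 1)) • circOut hM hP i f g := by
  simp [circ]

theorem leftMul_lTensor_append {m p P N : ℕ} (F : Cochain k A m p) (h : p + 1 = P)
    (hN : m + 1 = N) (x : Omega k A m) (z : Tens k (Bar k A) 1) :
    leftMul P ((extend 1 hN h F).lTensor A ((forms N).symm (append hN (x ⊗ₜ z)))) =
      append h (leftMul p (F.lTensor A ((forms m).symm x)) ⊗ₜ z) := by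
  induction x using forms_induction with
  | h0 => simp
  | hadd x y hx hy => simp only [TensorProduct.add_tmul, map_add, hx, hy]
  | h b w =>
    rw [append_forms, LinearEquiv.symm_apply_apply, LinearEquiv.symm_apply_apply,
      LinearMap.lTensor_tmul, LinearMap.lTensor_tmul, extend_concat, leftMul_append]

theorem cup_extend_extend {m p n q M P r s M' P' : ℕ} (hM : n + m = M) (hP : p + q = P)
    (f : Cochain k A m p) (g : Cochain k A n q) (hr : q + 1 = r) (hs : m + 1 = s)
    (h1 : m + r = m + q + 1) (h2 : p + r = P') (h3 : n + s = M') (h4 : q + s = m + q + 1)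
    (eM : M + 1 = M') (eP : P + 1 = P') :
    leftMul P' ∘ₗ (extend r h1 h2 f).lTensor A ∘ₗ
        (forms (m + q + 1)).symm.toLinearMap ∘ₗ extend s h3 h4 g =
      extend 1 eM eP (cup hM hP f g) := by
  subst hr hs
  refine ext_concat eM fun u z => ?_
  rw [extend_concat, cup_apply, ← extend_extend q 1 rfl hP rfl eP f rfl h1 h2,
    ← extend_extend m 1 hM (add_comm q m) eM rfl g rfl h3 h4]
  simp only [LinearMap.comp_apply, LinearEquiv.coe_coe]
  rw [extend_concat, leftMul_lTensor_append]

theorem cup_theta_right {m p n q M P M' P' : ℕ} (hM : n + m = M) (hP : p + q = P)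
    (f : Cochain k A m p) (g : Cochain k A n q) (h1 : n + 1 + m = M') (h2 : p + (q + 1) = P')
    (eM : M + 1 = M') (eP : P + 1 = P') :
    cup h1 h2 f (theta g) = extend 1 eM eP (cup hM hP f g) := by
  rw [← cup_extend_extend hM hP f g rfl rfl rfl h2 (by omega) (by omega) eM eP, cup_apply, theta,
    extend_extend 1 m rfl rfl h1 (add_comm (q + 1) m) g (add_comm 1 m) (by omega) (by omega)]
  rfl

theorem cup_theta_left {m p n q M P M' P' : ℕ} (hM : n + m = M) (hP : p + q = P)
    (f : Cochain k A m p) (g : Cochain k A n q) (h1 : n + (m + 1) = M') (h2 : p + 1 + q = P')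
    (eM : M + 1 = M') (eP : P + 1 = P') :
    cup h1 h2 (theta f) g = extend 1 eM eP (cup hM hP f g) := by
  rw [← cup_extend_extend hM hP f g rfl rfl rfl (by omega) h1 (by omega) eM eP, cup_apply, theta,
    extend_extend 1 q rfl rfl rfl h2 f (add_comm 1 q) (by omega) (by omega)]
  have : ∀ (N : ℕ) (a : m + 1 + q = N) (b : m + (q + 1) = N) (c : q + (m + 1) = N),
    leftMul P' ∘ₗ (extend (q + 1) b (by omega) f).lTensor A ∘ₗ
        (forms N).symm.toLinearMap ∘ₗ extend (m + 1) h1 c g =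
    leftMul P' ∘ₗ (extend (q + 1) rfl (by omega) f).lTensor A ∘ₗ
        (forms (m + (q + 1))).symm.toLinearMap ∘ₗ extend (m + 1) h1 (by omega) g := by
    intro N a b c
    subst b
    rfl
  exact this _ rfl (by omega) (by omega)

theorem projOmega_append {q r P : ℕ} (h : q + r = P) (h' : q + 1 + r = P + 1) (x : Omega k A q)
    (y : Tens k (Bar k A) r) :
    projOmega P (append h (x ⊗ₜ y)) = concat h' (projOmega q x ⊗ₜ y) := by
  induction x using forms_induction with
  | h0 => simp
  | hadd x y hx hy => simp only [TensorProduct.add_tmul, map_add, hx, hy]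
  | h b w =>
    rw [append_forms]
    simp only [projOmega, LinearMap.comp_apply, LinearEquiv.coe_coe, LinearEquiv.symm_apply_apply,
      LinearMap.rTensor_tmul]
    rw [concat_assoc (add_comm 1 q) h' h (by omega)]

/-- Appending one strand to `ḡ` is the same as having one more strand to its right. -/
theorem whisker_projOmega_theta (a b : ℕ) {n q N N' : ℕ} (g : Cochain k A n q)
    (hN : a + (n + 1) + b = N) (hN' : a + (q + 1 + 1) + b = N') (h1 : a + n + (b + 1) = N)
    (h2 : a + (q + 1) + (b + 1) = N') :
    whisker a b hN hN' (projOmega (q + 1) ∘ₗ theta g) =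
      whisker a (b + 1) h1 h2 (projOmega q ∘ₗ g) := by
  refine ext_concat₃ (rfl : a + (n + 1) = _) hN fun x w z => ?_
  rw [whisker_concat a b hN hN' _ rfl hN rfl hN']
  induction w using concat_induction (rfl : n + 1 = n + 1) with
  | h0 => simp
  | hadd x y hx hy =>
    simp only [TensorProduct.add_tmul, TensorProduct.tmul_add, map_add, hx, hy]
  | H y t =>
    rw [LinearMap.comp_apply, theta_concat, projOmega_append rfl rfl,
      ← concat_assoc (rfl : a + n = _) rfl rfl rfl, concat_assoc _ hN (add_comm 1 b) h1,
      whisker_concat a (b + 1) h1 h2 _ rfl h1 rfl h2,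
      ← concat_assoc (rfl : a + (q + 1) = _) rfl rfl rfl, concat_assoc _ hN' (add_comm 1 b) h2]
    rfl

theorem circIn_theta_right {m p n q M P M' P' : ℕ} (hM : m + (n + 1) - 1 = M) (hP : p + q = P)
    (i : Fin m) (f : Cochain k A m p) (g : Cochain k A (n + 1) q) (h1 : m + (n + 1 + 1) - 1 = M')
    (h2 : p + (q + 1) = P') (eM : M + 1 = M') (eP : P + 1 = P') :
    circIn h1 h2 i f (theta g) = extend 1 eM eP (circIn hM hP i f g) := by
  have hi := i.2
  rw [circIn_apply, circIn_apply]
  rw [extend_comp_whisker _ _ _ _ _ _ _ (rfl : m + q + 1 = _) _ (by omega) (by omega),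
    extend_extend q 1 rfl hP rfl eP f rfl (by omega) h2,
    whisker_projOmega_theta _ _ _ _ _ (by omega) (by omega)]

theorem circOut_theta_right {m p n q M P M' P' : ℕ} (hM : m + n = M) (hP : p + q = P)
    (i : Fin p) (f : Cochain k A m p) (g : Cochain k A (n + 1) q) (h1 : m + (n + 1) = M')
    (h2 : p + (q + 1) = P') (eM : M + 1 = M') (eP : P + 1 = P') :
    circOut h1 h2 i f (theta g) = extend 1 eM eP (circOut hM hP i f g) := by
  have hi := i.2
  rw [circOut_apply, circOut_apply]
  rw [← idTensor_whisker_comp_extend _ _ _ _ _ _ (rfl : p + n + 1 = _) _ _ (by omega) (by omega),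
    extend_extend n 1 hM rfl eM rfl f rfl h1 rfl,
    whisker_projOmega_theta _ _ _ _ _ (by omega) (by omega)]

theorem circ_theta_right {m p n q M P M' P' : ℕ} (hM : m + n = M) (hP : p + q = P)
    (f : Cochain k A m p) (g : Cochain k A (n + 1) q) (h1 : m + (n + 1) = M')
    (h2 : p + (q + 1) = P') (eM : M + 1 = M') (eP : P + 1 = P') :
    circ h1 h2 f (theta g) = extend 1 eM eP (circ hM hP f g) := by
  rw [circ_apply, circ_apply, map_sub, map_sum, map_sum]
  refine congrArg₂ _ ?_ ?_
  · refine Finset.sum_congr rfl fun i _ => ?_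
    rw [map_smul, circIn_theta_right hM hP i f g h1 h2 eM eP]
    refine congrArg₂ _ (congrArg (sgn k) ?_) rfl
    push_cast
    ring
  · refine Finset.sum_congr rfl fun i _ => ?_
    rw [map_smul, circOut_theta_right hM hP i f g h1 h2 eM eP]
    refine congrArg₂ _ (congrArg (sgn k) ?_) rfl
    push_cast
    ring

theorem circIn_theta_left {m p n q M P M' P' : ℕ} (hM : m + (n + 1) - 1 = M) (hP : p + q = P)
    (i : Fin m) (f : Cochain k A m p) (g : Cochain k A (n + 1) q) (h1 : m + 1 + (n + 1) - 1 = M')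
    (h2 : p + 1 + q = P') (eM : M + 1 = M') (eP : P + 1 = P') :
    circIn h1 h2 i.castSucc (theta f) g = extend 1 eM eP (circIn hM hP i f g) := by
  have hi := i.2
  have hb : m + 1 - 1 - (i.castSucc : ℕ) = m - 1 - i + 1 := by
    simp only [Fin.val_castSucc]
    omega
  rw [circIn_apply, circIn_apply]
  rw [extend_comp_whisker _ _ _ _ _ _ _ (by omega : m + q + 1 = m + 1 + q) _ (by omega)
      (by omega), extend_extend q 1 rfl hP _ eP f rfl (by omega) (by omega), theta,
    extend_extend 1 q rfl rfl rfl h2 f (add_comm 1 q) (by omega) (by omega),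
    whisker_congr (Fin.val_castSucc i) hb]

theorem circOut_theta_left {m p n q M P M' P' : ℕ} (hM : m + n = M) (hP : p + q = P)
    (i : Fin p) (f : Cochain k A m p) (g : Cochain k A (n + 1) q) (h1 : m + 1 + n = M')
    (h2 : p + 1 + q = P') (eM : M + 1 = M') (eP : P + 1 = P') :
    circOut h1 h2 i.castSucc (theta f) g = extend 1 eM eP (circOut hM hP i f g) := by
  have hi := i.2
  have hb : p + 1 - 1 - (i.castSucc : ℕ) = p - 1 - i + 1 := by
    simp only [Fin.val_castSucc]
    omega
  rw [circOut_apply, circOut_apply]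
  rw [← idTensor_whisker_comp_extend _ _ _ _ _ _ (by omega : p + n + 1 = p + 1 + n) _ _ (by omega)
      (by omega), extend_extend n 1 hM rfl eM _ f rfl (by omega) (by omega), theta,
    extend_extend 1 n rfl rfl h1 rfl f (add_comm 1 n) (by omega) (by omega),
    whisker_congr (Fin.val_castSucc i) hb]

/-- The two extra terms in the circle product of `θ f` and `g` coincide. -/
theorem circIn_last_eq_circOut_last {m p n q M P : ℕ} (f : Cochain k A m p)
    (g : Cochain k A (n + 1) q) (h1 : m + 1 + n = M) (h2 : p + 1 + q = P) :
    circIn h1 h2 (Fin.last m) (theta f) g = circOut h1 h2 (Fin.last p) (theta f) g := by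
  rw [circIn_apply, circOut_apply]
  rw [whisker_congr (Fin.val_last m) (show m + 1 - 1 - (Fin.last m : ℕ) = 0 by simp),
    whisker_congr (Fin.val_last p) (show p + 1 - 1 - (Fin.last p : ℕ) = 0 by simp), theta,
    extend_extend 1 q rfl rfl rfl h2 f (add_comm 1 q) (by omega) (by omega),
    extend_extend 1 n rfl rfl h1 rfl f (add_comm 1 n) (by omega) (by omega)]
  exact extend_comp_whisker_zero f _ _ _ _ _ _ _ _ _

theorem circ_theta_left {m p n q M P M' P' : ℕ} (hM : m + n = M) (hP : p + q = P)
    (f : Cochain k A m p) (g : Cochain k A (n + 1) q) (h1 : m + 1 + n = M')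
    (h2 : p + 1 + q = P') (eM : M + 1 = M') (eP : P + 1 = P') :
    circ h1 h2 (theta f) g = extend 1 eM eP (circ hM hP f g) := by
  have e1 : ∀ i : Fin m, sgn k (((n : ℤ) - q) * (i.castSucc : ℕ)) •
      circIn h1 h2 i.castSucc (theta f) g =
      extend 1 eM eP (sgn k ((n - q) * i) • circIn hM hP i f g) := by
    intro i
    rw [map_smul, circIn_theta_left hM hP i f g h1 h2 eM eP, Fin.val_castSucc]
  have e2 : ∀ i : Fin p, sgn k (((n : ℤ) - q) *
      (((i.castSucc : ℕ) + 1) - (m + 1 : ℕ) - (p + 1 : ℕ) - 1)) •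
      circOut h1 h2 i.castSucc (theta f) g =
      extend 1 eM eP (sgn k ((n - q) * ((i + 1) - m - p - 1)) • circOut hM hP i f g) := by
    intro i
    rw [map_smul, circOut_theta_left hM hP i f g h1 h2 eM eP, Fin.val_castSucc]
    congr 1
    apply sgn_congr
    push_cast
    ring_nf
    exact ⟨-n + q, by ring⟩
  have e3 : sgn k (((n : ℤ) - q) *
      (((Fin.last p : ℕ) + 1) - (m + 1 : ℕ) - (p + 1 : ℕ) - 1)) =
      sgn k (((n : ℤ) - q) * (Fin.last m : ℕ)) := by
    apply sgn_congr
    push_cast [Fin.val_last]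
    exact ⟨-(n - q) * (m + 1), by ring⟩
  rw [circ_apply, circ_apply, Fin.sum_univ_castSucc, Fin.sum_univ_castSucc, map_sub, map_sum,
    map_sum, Finset.sum_congr rfl fun i _ => e1 i, Finset.sum_congr rfl fun i _ => e2 i, e3,
    circIn_last_eq_circOut_last]
  abel

/-! ### The Hochschild differential does not depend on the lifts -/

/-- The generator of `Ā^{⊗0}`. -/
def unitTens : Tens k (Bar k A) 0 := (PiTensorProduct.tprod k Fin.elim0 : ⨂[k]^0 (Bar k A))

theorem mulEquiv_unit_left {V : Type*} [AddCommGroup V] [Module k V] {n : ℕ} (h : 0 + n = n)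
    (x : ⨂[k]^n V) : TensorPower.cast k V h (TensorPower.mulEquiv
      ((PiTensorProduct.tprod k Fin.elim0 : ⨂[k]^0 V) ⊗ₜ[k] x)) = x := by
  have := TensorPower.one_mul x
  rwa [TensorPower.gMul_def, TensorPower.gOne_def] at this

theorem mulEquiv_unit_right {V : Type*} [AddCommGroup V] [Module k V] {n : ℕ} (h : n + 0 = n)
    (x : ⨂[k]^n V) : TensorPower.cast k V h (TensorPower.mulEquiv
      (x ⊗ₜ[k] (PiTensorProduct.tprod k Fin.elim0 : ⨂[k]^0 V))) = x := by
  have := TensorPower.mul_one x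
  rwa [TensorPower.gMul_def, TensorPower.gOne_def] at this

theorem concat_unitTens_left {n : ℕ} (h : 0 + n = n) (x : Tens k (Bar k A) n) :
    concat h (unitTens ⊗ₜ x) = x := mulEquiv_unit_left h x

theorem concat_unitTens_right {n : ℕ} (h : n + 0 = n) (x : Tens k (Bar k A) n) :
    concat h (x ⊗ₜ unitTens) = x := mulEquiv_unit_right h x

/-- Contraction of one tensor factor with a linear form `c`. -/
def contract (c : Bar k A →ₗ[k] k) : Tens k (Bar k A) 1 →ₗ[k] Tens k (Bar k A) 0 :=
  LinearMap.toSpanSingleton k _ unitTens ∘ₗ c ∘ₗ tensOne.symm.toLinearMap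

theorem whisker_contract (c : Bar k A →ₗ[k] k) {a b N N' d : ℕ} (hN : a + 1 + b = N)
    (hN' : a + 0 + b = N') (hd : a + 1 = d) (hdN : d + b = N) (h : a + b = N')
    (x : Tens k (Bar k A) a) (u : Tens k (Bar k A) 1) (z : Tens k (Bar k A) b) :
    whisker a b hN hN' (contract c) (concat hdN (concat hd (x ⊗ₜ u) ⊗ₜ z)) =
      c (tensOne.symm u) • concat h (x ⊗ₜ z) := by
  rw [whisker_concat a b hN hN' _ hd hdN (add_zero a) h]
  simp only [contract, LinearMap.comp_apply, LinearEquiv.coe_coe, LinearMap.toSpanSingleton_apply,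
    TensorProduct.tmul_smul, map_smul, concat_unitTens_right, ← TensorProduct.smul_tmul']

theorem barMul_concat (σ : Bar k A →ₗ[k] A) (u v : Tens k (Bar k A) 1) :
    barMul σ (concat rfl (u ⊗ₜ v)) = tensOne (proj k A (σ (tensOne.symm u) * σ (tensOne.symm v))) := by
  simp [barMul]

section Lifts

variable {σ τ : Bar k A →ₗ[k] A} {c : Bar k A →ₗ[k] k}

theorem exists_difference (hσ : proj k A ∘ₗ σ = LinearMap.id) (hτ : proj k A ∘ₗ τ = LinearMap.id) :
    ∃ c : Bar k A →ₗ[k] k, ∀ x, τ x = σ x + c x • 1 := by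
  obtain ⟨s, hs⟩ := (LinearMap.toSpanSingleton k A 1).rangeRestrict.exists_rightInverse_of_surjective
    (LinearMap.range_rangeRestrict _)
  have h : ∀ x, (τ - σ) x ∈ LinearMap.range (LinearMap.toSpanSingleton k A 1) := by
    intro x
    have h1 : proj k A (τ x - σ x) = 0 := by
      rw [map_sub, ← LinearMap.comp_apply, ← LinearMap.comp_apply, hσ, hτ, sub_self]
    rw [LinearMap.range_toSpanSingleton]
    exact (Submodule.Quotient.mk_eq_zero _).1 h1
  refine ⟨s ∘ₗ (τ - σ).codRestrict _ h, fun x => ?_⟩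
  have := congrArg Subtype.val (LinearMap.congr_fun hs ⟨_, h x⟩)
  rw [LinearMap.comp_apply]
  change _ = σ x + s ⟨(τ - σ) x, h x⟩ • (1 : A)
  rw [eq_comm, ← eq_sub_iff_add_eq']
  exact this

theorem barMul_difference (hσ : proj k A ∘ₗ σ = LinearMap.id) (hc : ∀ x, τ x = σ x + c x • 1)
    (u v : Tens k (Bar k A) 1) : barMul τ (concat rfl (u ⊗ₜ v)) =
      barMul σ (concat rfl (u ⊗ₜ v)) + (c (tensOne.symm u) • v + c (tensOne.symm v) • u) := by
  have h1 : proj k A 1 = 0 :=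
    (Submodule.Quotient.mk_eq_zero _).2 (Submodule.mem_span_singleton_self _)
  have h2 : ∀ x, proj k A (σ x) = x := LinearMap.congr_fun hσ
  rw [barMul_concat, barMul_concat, hc, hc, add_mul, mul_add, mul_add]
  simp only [map_add, smul_mul_assoc, mul_smul_comm, one_mul, mul_one, map_smul, h1, h2, smul_zero, add_zero, LinearEquiv.apply_symm_apply]
  abel

theorem whisker_barMul_difference (hσ : proj k A ∘ₗ σ = LinearMap.id)
    (hc : ∀ x, τ x = σ x + c x • 1) {a b N N' : ℕ} (hN : a + 2 + b = N) (hN' : a + 1 + b = N')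
    (h1 : a + 1 + (b + 1) = N) (h2 : a + 0 + (b + 1) = N') (h3 : a + 1 + 1 + b = N)
    (h4 : a + 1 + 0 + b = N') :
    whisker a b hN hN' (barMul τ) = whisker a b hN hN' (barMul σ) +
      (whisker a (b + 1) h1 h2 (contract c) + whisker (a + 1) b h3 h4 (contract c)) := by
  refine ext_concat₃ (rfl : a + 2 = _) hN fun x w z => ?_
  induction w using concat_induction (rfl : 1 + 1 = 2) with
  | h0 => simp
  | hadd x y hx hy =>
    simp only [TensorProduct.tmul_add, TensorProduct.add_tmul, map_add] at hx hy ⊢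
    rw [hx, hy]
  | H u v =>
    have e : concat (rfl : a + 2 = a + 2) (x ⊗ₜ concat (rfl : 1 + 1 = 2) (u ⊗ₜ v)) =
        concat (rfl : a + 1 + 1 = a + 2) (concat (rfl : a + 1 = a + 1) (x ⊗ₜ u) ⊗ₜ v) :=
      (concat_assoc _ _ _ _ _ _ _).symm
    rw [LinearMap.add_apply, LinearMap.add_apply, whisker_concat a b hN hN' _ rfl hN rfl hN',
      whisker_concat a b hN hN' _ rfl hN rfl hN', barMul_difference hσ hc, e, whisker_contract c h3 h4 rfl h3 hN',
      concat_assoc rfl h3 (add_comm 1 b) h1, whisker_contract c h1 h2 rfl h1 (by omega)]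
    simp only [TensorProduct.tmul_add, TensorProduct.add_tmul, map_add, TensorProduct.tmul_smul,
      ← TensorProduct.smul_tmul', map_smul]
    rw [concat_assoc rfl hN' (add_comm 1 b) (by omega) x v z]

theorem sum_telescope {M : Type*} [AddCommGroup M] [Module k M] (T : ℕ → M) (m : ℕ) :
    ∑ j : Fin m, sgn k (j + 1) • (T j + T (j + 1)) = sgn k m • T m - T 0 := by
  induction m with
  | zero => simp [sgn]
  | succ m ih =>
    rw [Fin.sum_univ_castSucc]
    simp only [Fin.val_castSucc, Fin.val_last]
    rw [ih, Nat.cast_succ, sgn_succ, smul_add, neg_smul, neg_smul]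
    abel

theorem sgn_mul_self (a : ℤ) : sgn k a * sgn k a = 1 := by
  unfold sgn
  rw [← Int.cast_mul, ← Units.val_mul, ← Int.negOnePow_add]
  simp [Int.negOnePow_even _ (Even.add_self a)]

theorem sgn_sub_eq (a b : ℤ) : sgn k (a - b) = sgn k a * sgn k b := by
  unfold sgn
  rw [Int.negOnePow_sub]
  push_cast
  rfl

theorem mulFirst_difference (hc : ∀ x, τ x = σ x + c x • 1) (p : ℕ) (h1 : 0 + 1 + p = p + 1)
    (h2 : 0 + 0 + p = p) : mulFirst τ p = mulFirst σ p +
      idTensor (whisker (N' := p) 0 p h1 h2 (contract c)) := by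
  refine LinearMap.ext fun x => ?_
  induction x using forms_induction with
  | h0 => simp
  | hadd x y hx hy => rw [map_add, map_add, hx, hy]
  | h a w =>
    induction w using concat_induction (add_comm 1 p) with
    | h0 => simp
    | hadd x y hx hy => simp only [TensorProduct.tmul_add, map_add, hx, hy]
    | H u x =>
      rw [LinearMap.add_apply, idTensor_forms]
      have : concat (add_comm 1 p) (u ⊗ₜ x) =
          concat (add_comm 1 p) (concat (zero_add 1) (unitTens ⊗ₜ u) ⊗ₜ x) := by
        rw [concat_unitTens_left]
      rw [this, whisker_contract c h1 h2 (zero_add 1) (add_comm 1 p) (zero_add p), ← this,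
        concat_unitTens_left]
      simp [mulFirst, leftMul_forms, hc, TensorProduct.add_tmul, TensorProduct.tmul_add,
        TensorProduct.smul_tmul']

theorem rightAct_difference (hσ : proj k A ∘ₗ σ = LinearMap.id)
    (hc : ∀ x, τ x = σ x + c x • 1) (p : ℕ) (h1 : p + 1 + 0 = p + 1) (h2 : p + 0 + 0 = p) :
    rightAct τ p = rightAct σ p + idTensor (whisker (q := 0) (N' := p) p 0 h1 h2 (contract c)) := by
  let T : ℕ → Omega k A (p + 1) →ₗ[k] Omega k A p := fun j =>
    if h : j ≤ p then idTensor (whisker (N := p + 1) (N' := p) j (p - j) (by omega) (by omega)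
      (contract c)) else 0
  have hT : ∀ i : Fin p, sgn k (p - (i + 1)) •
      idTensor (B := A) (whisker (N := p + 1) (N' := p) i (p - 1 - i) (by omega) (by omega)
        (barMul τ)) =
      sgn k (p - (i + 1)) •
      idTensor (B := A) (whisker (N := p + 1) (N' := p) i (p - 1 - i) (by omega) (by omega)
        (barMul σ)) + sgn k p • sgn k (i + 1) • (T i + T (i + 1)) := by
    intro i
    have hi := i.2
    rw [whisker_barMul_difference hσ hc _ _ (by omega) (by omega) (by omega) (by omega),
      smul_smul, ← sgn_sub_eq, ← smul_add]
    congr 1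
    simp only [T]
    rw [dif_pos (by omega), dif_pos (by omega),
      whisker_congr (rfl : (i : ℕ) = i) (show p - 1 - i + 1 = p - i by omega),
      whisker_congr (rfl : (i : ℕ) + 1 = i + 1) (show p - 1 - i = p - (i + 1) by omega)]
    simp only [idTensor, LinearMap.lTensor_add, LinearMap.add_comp, LinearMap.comp_add]
  rw [rightAct, rightAct, Finset.sum_congr rfl fun i _ => hT i, Finset.sum_add_distrib,
    ← Finset.smul_sum, sum_telescope, smul_sub, smul_smul, sgn_mul_self, one_smul,
    mulFirst_difference hc p (by omega) (by omega), smul_add]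
  simp only [T]
  rw [dif_pos le_rfl, dif_pos (Nat.zero_le p), whisker_congr (rfl : p = p) (Nat.sub_self p),
    whisker_congr (rfl : 0 = 0) (Nat.sub_zero p)]
  abel

/-- The Hochschild differential does not depend on the choice of the lifts. -/
theorem hochschild_eq_of_lifts (hσ : proj k A ∘ₗ σ = LinearMap.id)
    (hτ : proj k A ∘ₗ τ = LinearMap.id) {m p : ℕ} (f : Cochain k A m p) :
    hochschild τ f = hochschild σ f := by
  obtain ⟨c, hc⟩ := exists_difference hσ hτ
  let T : ℕ → Cochain k A (m + 1) p := fun j =>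
    if h : j ≤ m then f ∘ₗ whisker (N := m + 1) (N' := m) j (m - j) (by omega) (by omega)
      (contract c) else 0
  have hT : ∀ j : Fin m, sgn k (j + 1) •
      (f ∘ₗ whisker (N := m + 1) (N' := m) j (m - 1 - j) (by omega) (by omega) (barMul τ)) =
      sgn k (j + 1) •
      (f ∘ₗ whisker (N := m + 1) (N' := m) j (m - 1 - j) (by omega) (by omega) (barMul σ)) +
        sgn k (j + 1) • (T j + T (j + 1)) := by
    intro j
    have hj := j.2
    rw [whisker_barMul_difference hσ hc _ _ (by omega) (by omega) (by omega) (by omega), ← smul_add]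
    congr 1
    simp only [T]
    rw [dif_pos (by omega), dif_pos (by omega),
      whisker_congr (rfl : (j : ℕ) = j) (show m - 1 - j + 1 = m - j by omega),
      whisker_congr (rfl : (j : ℕ) + 1 = j + 1) (show m - 1 - j = m - (j + 1) by omega),
      LinearMap.comp_add, LinearMap.comp_add]
  have hL : leftAct τ f = leftAct σ f + T 0 := by
    refine ext_concat (add_comm 1 m) fun u x => ?_
    simp only [T]
    rw [dif_pos (Nat.zero_le m), LinearMap.add_apply, leftAct_concat, leftAct_concat,
      whisker_congr (rfl : 0 = 0) (Nat.sub_zero m), LinearMap.comp_apply]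
    have : concat (add_comm 1 m) (u ⊗ₜ x) =
        concat (add_comm 1 m) (concat (zero_add 1) (unitTens ⊗ₜ u) ⊗ₜ x) := by
      rw [concat_unitTens_left]
    rw [this, whisker_contract c _ _ (zero_add 1) (add_comm 1 m) (zero_add m),
      concat_unitTens_left, hc, TensorProduct.add_tmul, map_add, map_smul,
      ← TensorProduct.smul_tmul', map_smul]
    congr 2
    induction f x using forms_induction with
    | h0 => simp
    | hadd x y hx hy => rw [TensorProduct.tmul_add, map_add, hx, hy]
    | h b w => rw [leftMul_forms, one_mul]
  have hR : idTensor (whisker (N' := p) p 0 rfl rfl (contract c)) ∘ₗ theta f = T m := by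
    refine ext_concat rfl fun x u => ?_
    simp only [T]
    rw [dif_pos le_rfl, whisker_congr (rfl : m = m) (Nat.sub_self m), LinearMap.comp_apply,
      LinearMap.comp_apply, theta_concat, ← concat_unitTens_right (add_zero (m + 1))
      (concat rfl (x ⊗ₜ u)), whisker_contract c _ _ rfl (add_zero _) (add_zero _),
      concat_unitTens_right, map_smul]
    induction f x using forms_induction with
    | h0 => simp
    | hadd x y hx hy => rw [TensorProduct.add_tmul, map_add, map_add, hx, hy, smul_add]
    | h b w =>
      rw [append_forms, idTensor_forms, ← concat_unitTens_right (add_zero (p + 1))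
        (concat rfl (w ⊗ₜ u)), whisker_contract c _ _ rfl (add_zero _) (add_zero _),
        concat_unitTens_right, TensorProduct.tmul_smul, map_smul]
  rw [hochschild_apply, hochschild_apply, Finset.sum_congr rfl fun j _ => hT j,
    Finset.sum_add_distrib, sum_telescope, hL, rightAct_difference hσ hc p rfl rfl,
    LinearMap.add_comp, hR, smul_add (sgn k (m + 1)), sgn_succ (m : ℤ), neg_smul, neg_smul]
  congr 1
  abel

end Lifts

end Algebra

section Complexes

variable (k : Type u) [Field k] (A : Type v) [Ring A] [Algebra k A]

/-- The underlying module `⨁_m C^{m-p}(A, Ω^p)` of the Hochschild cochain complex `C^*(A, Ω^p)`. -/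
def Level (p : ℕ) : Type (max u v) := ⨁ m : ℕ, Cochain k A m p

instance (p : ℕ) : AddCommGroup (Level k A p) := by unfold Level; infer_instance
instance (p : ℕ) : Module k (Level k A p) :=
  (inferInstance : Module k (⨁ m : ℕ, Cochain k A m p))

variable {k A}

/-- The inclusion of a homogeneous component of `C^*(A, Ω^p)`. -/
def ofLevel (m p : ℕ) : Cochain k A m p →ₗ[k] Level k A p :=
  DirectSum.lof k ℕ (fun m => Cochain k A m p) m

/-- A linear map out of `C^*(A, Ω^p)` from linear maps on its homogeneous components. -/
def Level.lift {M : Type*} [AddCommGroup M] [Module k M] {p : ℕ}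
    (F : ∀ m, Cochain k A m p →ₗ[k] M) : Level k A p →ₗ[k] M :=
  DirectSum.toModule k ℕ M F

theorem Level.lift_of {M : Type*} [AddCommGroup M] [Module k M] {m p : ℕ}
    (F : ∀ m, Cochain k A m p →ₗ[k] M) (f : Cochain k A m p) :
    Level.lift F (ofLevel m p f) = F m f :=
  DirectSum.toModule_lof (φ := F) k m f

theorem Level.hom_ext {M : Type*} [AddCommGroup M] [Module k M] {p : ℕ}
    {F G : Level k A p →ₗ[k] M} (h : ∀ m f, F (ofLevel m p f) = G (ofLevel m p f)) : F = G :=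
  DirectSum.linearMap_ext k fun m => LinearMap.ext (h m)

/-- The embedding `θ_p : C^*(A, Ω^p) → C^*(A, Ω^{p+1})`. -/
def thetaLevel (p : ℕ) : Level k A p →ₗ[k] Level k A (p + 1) :=
  Level.lift fun m => ofLevel (m + 1) (p + 1) ∘ₗ theta

variable (k A) in
/-- The composition `θ_{j-1} ∘ ⋯ ∘ θ_i : C^*(A, Ω^i) → C^*(A, Ω^j)`. -/
def thetaLE (i j : ℕ) (h : i ≤ j) : Level k A i →ₗ[k] Level k A j :=
  Nat.leRecOn (C := fun j => Level k A i →ₗ[k] Level k A j) h (fun F => thetaLevel _ ∘ₗ F)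
    LinearMap.id

variable (k A) in
/-- The singular Hochschild cochain complex `C_sg^*(A, A) = colim_p C^*(A, Ω^p)`. -/
def Csg : Type (max u v) := Module.DirectLimit (Level k A) (thetaLE k A)

instance : AddCommGroup (Csg k A) := by unfold Csg; infer_instance
instance : Module k (Csg k A) :=
  (inferInstance : Module k (Module.DirectLimit (Level k A) (thetaLE k A)))

/-- The canonical map `C^*(A, Ω^p) → C_sg^*(A, A)`. -/
def toCsg (p : ℕ) : Level k A p →ₗ[k] Csg k A :=
  Module.DirectLimit.of k ℕ (Level k A) (thetaLE k A) p

theorem toCsg_theta (p : ℕ) (x : Level k A p) : toCsg (p + 1) (thetaLevel p x) = toCsg p x := by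
  have h : thetaLE k A p (p + 1) (Nat.le_succ p) x = thetaLevel p x := by
    rw [thetaLE, Nat.leRecOn_succ le_rfl, Nat.leRecOn_self]
    rfl
  rw [← h]
  exact Module.DirectLimit.of_f

/-- The class in `C_sg^*(A, A)` of a cochain `f ∈ C^{m-p}(A, Ω^p)`. -/
def cls (m p : ℕ) : Cochain k A m p →ₗ[k] Csg k A := toCsg p ∘ₗ ofLevel m p

theorem cls_theta {m p : ℕ} (f : Cochain k A m p) : cls (m + 1) (p + 1) (theta f) = cls m p f := by
  have := toCsg_theta p (ofLevel m p f)
  rwa [thetaLevel, Level.lift_of] at this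

theorem cls_extend {m p M P : ℕ} (hM : m + 1 = M) (hP : p + 1 = P) (f : Cochain k A m p) :
    cls M P (extend 1 hM hP f) = cls m p f := by
  subst hM hP
  exact cls_theta f

theorem Csg.hom_ext {M : Type*} [AddCommGroup M] [Module k M] {F G : Csg k A →ₗ[k] M}
    (h : ∀ m p f, F (cls m p f) = G (cls m p f)) : F = G :=
  Module.DirectLimit.hom_ext fun p => Level.hom_ext fun m f => h m p f

/-- A linear map out of `C_sg^*(A, A)` from compatible linear maps on cochains. -/
def Csg.lift {M : Type*} [AddCommGroup M] [Module k M] (F : ∀ m p, Cochain k A m p →ₗ[k] M)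
    (hF : ∀ m p f, F (m + 1) (p + 1) (theta f) = F m p f) : Csg k A →ₗ[k] M :=
  Module.DirectLimit.lift k ℕ (Level k A) (thetaLE k A) (fun p => Level.lift fun m => F m p)
    (fun i j h x => by
      induction j, h using Nat.le_induction with
      | base => rw [thetaLE, Nat.leRecOn_self]; rfl
      | succ j h ih =>
        rw [thetaLE, Nat.leRecOn_succ h]
        change Level.lift _ (thetaLevel j (thetaLE k A i j h x)) = _
        rw [← ih, ← LinearMap.comp_apply]
        refine LinearMap.congr_fun (Level.hom_ext fun m f => ?_) _
        rw [LinearMap.comp_apply, thetaLevel, Level.lift_of, LinearMap.comp_apply, Level.lift_of,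
          Level.lift_of, hF])

theorem Csg.lift_cls {M : Type*} [AddCommGroup M] [Module k M]
    (F : ∀ m p, Cochain k A m p →ₗ[k] M) (hF : ∀ m p f, F (m + 1) (p + 1) (theta f) = F m p f)
    (m p : ℕ) (f : Cochain k A m p) : Csg.lift F hF (cls m p f) = F m p f :=
  (Module.DirectLimit.lift_of _ _ _).trans (Level.lift_of _ f)

/-- A bilinear map on `C_sg^*(A, A)` from compatible bilinear maps on cochains. -/
def Csg.lift₂ {M : Type*} [AddCommGroup M] [Module k M]
    (F : ∀ m p n q, Cochain k A m p →ₗ[k] Cochain k A n q →ₗ[k] M)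
    (hF : ∀ m p n q f g, F (m + 1) (p + 1) n q (theta f) g = F m p n q f g)
    (hF' : ∀ m p n q f g, F m p (n + 1) (q + 1) f (theta g) = F m p n q f g) :
    Csg k A →ₗ[k] Csg k A →ₗ[k] M :=
  Csg.lift
    (fun m p => (Csg.lift (fun n q => (F m p n q).flip)
      fun n q g => LinearMap.ext fun f => hF' m p n q f g).flip)
    fun m p f => Csg.hom_ext fun n q g => by
      rw [LinearMap.flip_apply, LinearMap.flip_apply, Csg.lift_cls, Csg.lift_cls,
        LinearMap.flip_apply, LinearMap.flip_apply, hF]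

theorem Csg.lift₂_cls {M : Type*} [AddCommGroup M] [Module k M]
    (F : ∀ m p n q, Cochain k A m p →ₗ[k] Cochain k A n q →ₗ[k] M)
    (hF : ∀ m p n q f g, F (m + 1) (p + 1) n q (theta f) g = F m p n q f g)
    (hF' : ∀ m p n q f g, F m p (n + 1) (q + 1) f (theta g) = F m p n q f g)
    (m p n q : ℕ) (f : Cochain k A m p) (g : Cochain k A n q) :
    Csg.lift₂ F hF hF' (cls m p f) (cls n q g) = F m p n q f g := by
  rw [Csg.lift₂, Csg.lift_cls, LinearMap.flip_apply, Csg.lift_cls, LinearMap.flip_apply]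

/-! ### The structure of the singular Hochschild cochain complex -/

variable (k A) in
/-- A choice of lifts of the elements of `Ā` to `A`. -/
def lifts : Bar k A →ₗ[k] A := Classical.choose (exists_section k A)

theorem proj_comp_lifts : proj k A ∘ₗ lifts k A = LinearMap.id :=
  Classical.choose_spec (exists_section k A)

/-- The differential of `C_sg^*(A, A)`, induced by the Hochschild differentials. -/
def Csg.d : Csg k A →ₗ[k] Csg k A :=
  Csg.lift (fun m p => cls (m + 1) p ∘ₗ hochschild (lifts k A)) fun m p f => by
    rw [LinearMap.comp_apply, LinearMap.comp_apply, hochschild_theta, cls_theta]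

/-- The differential can be computed with arbitrary lifts. -/
theorem Csg.d_cls {σ : Bar k A →ₗ[k] A} (hσ : proj k A ∘ₗ σ = LinearMap.id) {m p : ℕ}
    (f : Cochain k A m p) : Csg.d (cls m p f) = cls (m + 1) p (hochschild σ f) := by
  rw [Csg.d, Csg.lift_cls, LinearMap.comp_apply, hochschild_eq_of_lifts hσ proj_comp_lifts]

/-- The cup product of `C_sg^*(A, A)`. -/
def Csg.cup : Csg k A →ₗ[k] Csg k A →ₗ[k] Csg k A :=
  Csg.lift₂ (fun m p n q => (TateHochschild.cup rfl rfl).compr₂ (cls (n + m) (p + q)))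
    (fun m p n q f g => by
      rw [LinearMap.compr₂_apply, LinearMap.compr₂_apply,
        cup_theta_left rfl rfl f g rfl rfl (add_assoc n m 1) (by omega), cls_extend])
    (fun m p n q f g => by
      rw [LinearMap.compr₂_apply, LinearMap.compr₂_apply,
        cup_theta_right rfl rfl f g rfl rfl (by omega) (add_assoc p q 1), cls_extend])

theorem Csg.cup_cls {m p n q : ℕ} (f : Cochain k A m p) (g : Cochain k A n q) :
    Csg.cup (cls m p f) (cls n q g) = cls (n + m) (p + q) (TateHochschild.cup rfl rfl f g) :=
  Csg.lift₂_cls _ _ _ m p n q f g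

/-- The class in `C_sg^*(A, A)` of the circle product of `f ∈ C^{m-p}(A, Ω^p)` and
`g ∈ C^{n-q}(A, Ω^q)`, formed with the representative `θ g` of the class of `g`, which has at
least one input. -/
def circClass (m p n q : ℕ) : Cochain k A m p →ₗ[k] Cochain k A n q →ₗ[k] Csg k A :=
  ((circ rfl rfl).compr₂ (cls (m + n) (p + (q + 1)))).compl₂ theta

theorem circClass_apply {m p n q : ℕ} (f : Cochain k A m p) (g : Cochain k A n q) :
    circClass m p n q f g = cls (m + n) (p + (q + 1)) (circ rfl rfl f (theta g)) := rfl

/-- If `g` itself has an input, then there is no need to replace it by `θ g`. -/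
theorem circClass_succ {m p n q : ℕ} (f : Cochain k A m p) (g : Cochain k A (n + 1) q) :
    circClass m p (n + 1) q f g = cls (m + n) (p + q) (circ rfl rfl f g) := by
  rw [circClass_apply, circ_theta_right rfl rfl f g rfl rfl (add_assoc m n 1) (add_assoc p q 1),
    cls_extend]

theorem circClass_theta_left {m p n q : ℕ} (f : Cochain k A m p) (g : Cochain k A n q) :
    circClass (m + 1) (p + 1) n q (theta f) g = circClass m p n q f g := by
  rw [circClass_apply, circClass_apply,
    circ_theta_left rfl rfl f (theta g) rfl rfl (by omega) (by omega), cls_extend]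

theorem circClass_theta_right {m p n q : ℕ} (f : Cochain k A m p) (g : Cochain k A n q) :
    circClass m p (n + 1) (q + 1) f (theta g) = circClass m p n q f g := by
  rw [circClass_succ, circClass_apply]

/-- The degree `-1` bracket of `C_sg^*(A, A)`: for `f ∈ C^{m-p}(A, Ω^p)` and
`g ∈ C^{n-q}(A, Ω^q)`, `[f, g] = f ∘ g - (-1)^{(m-p-1)(n-q-1)} g ∘ f`. -/
def Csg.bracket : Csg k A →ₗ[k] Csg k A →ₗ[k] Csg k A :=
  Csg.lift₂ (fun m p n q => circClass m p n q -
      sgn k ((m - p - 1) * (n - q - 1)) • (circClass n q m p).flip)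
    (fun m p n q f g => by
      simp only [LinearMap.sub_apply, LinearMap.smul_apply, LinearMap.flip_apply,
        circClass_theta_left, circClass_theta_right]
      push_cast
      rw [add_sub_add_right_eq_sub])
    (fun m p n q f g => by
      simp only [LinearMap.sub_apply, LinearMap.smul_apply, LinearMap.flip_apply,
        circClass_theta_left, circClass_theta_right]
      push_cast
      rw [add_sub_add_right_eq_sub])

/-- The unit `1 ∈ A = C^0(A, A)`. -/
def unitCochain : Cochain k A 0 0 := (forms 0).toLinearMap ∘ₗ TensorProduct.mk k A _ 1

/-- The bracket of two classes, on representatives with at least one input each. -/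
theorem Csg.bracket_cls {m p n q : ℕ} (f : Cochain k A (m + 1) p) (g : Cochain k A (n + 1) q) :
    Csg.bracket (cls (m + 1) p f) (cls (n + 1) q g) =
      cls (m + 1 + n) (p + q) (circ rfl rfl f g) -
        sgn k ((m - p) * (n - q)) • cls (n + 1 + m) (q + p) (circ rfl rfl g f) := by
  rw [Csg.bracket, Csg.lift₂_cls]
  simp only [LinearMap.sub_apply, LinearMap.smul_apply, LinearMap.flip_apply, circClass_succ]
  push_cast
  rw [show (m + 1 - p - 1 : ℤ) = m - p by ring, show (n + 1 - q - 1 : ℤ) = n - q by ring]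

/-- The homogeneous component of degree `i` of `C_sg^*(A, A)`. -/
def Csg.degree (i : ℤ) : Submodule k (Csg k A) :=
  ⨆ (m : ℕ) (p : ℕ) (_ : (m : ℤ) - p = i), LinearMap.range (cls m p)

/-! ### The structure of the Hochschild cochain complex -/

variable (k A) in
/-- The normalized Hochschild cochain complex `C^*(A, A) = C^*(A, Ω^0)`. -/
abbrev Hoch : Type (max u v) := Level k A 0

/-- The Hochschild differential of `C^*(A, A)`. -/
def Hoch.d : Hoch k A →ₗ[k] Hoch k A :=
  Level.lift fun m => ofLevel (m + 1) 0 ∘ₗ hochschild (lifts k A)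

/-- The cup product of `C^*(A, A)`. -/
def Hoch.cup : Hoch k A →ₗ[k] Hoch k A →ₗ[k] Hoch k A :=
  Level.lift fun m => (Level.lift fun n =>
    ((TateHochschild.cup rfl rfl).compr₂ (ofLevel (n + m) 0)).flip).flip

/-- Gerstenhaber's circle product `f ∘ g = ∑_{i=1}^m (-1)^{(n-1)(i-1)} f ∘_i g` of
`f ∈ C^m(A, A)` and `g ∈ C^n(A, A)`. -/
def Hoch.circ (m n : ℕ) : Cochain k A m 0 →ₗ[k] Cochain k A n 0 →ₗ[k] Cochain k A (m + n - 1) 0 :=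
  ∑ i : Fin m, sgn k ((n - 1) * i) • circIn rfl rfl i

/-- The Gerstenhaber bracket `[f, g] = f ∘ g - (-1)^{(m-1)(n-1)} g ∘ f` of `C^*(A, A)`. -/
def Hoch.bracket : Hoch k A →ₗ[k] Hoch k A →ₗ[k] Hoch k A :=
  Level.lift fun m => (Level.lift fun n =>
    ((Hoch.circ m n).compr₂ (ofLevel (m + n - 1) 0)).flip -
      sgn k ((m - 1) * (n - 1)) • (Hoch.circ n m).compr₂ (ofLevel (n + m - 1) 0)).flip

/-- The homogeneous component of degree `i` of `C^*(A, A)`. -/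
def Hoch.degree (i : ℤ) : Submodule k (Hoch k A) :=
  ⨆ (m : ℕ) (_ : (m : ℤ) = i), LinearMap.range (ofLevel m 0)

theorem d_toCsg (x : Hoch k A) : Csg.d (toCsg 0 x) = toCsg 0 (Hoch.d x) := by
  have : Csg.d ∘ₗ toCsg 0 = toCsg 0 ∘ₗ Hoch.d (k := k) (A := A) := by
    refine Level.hom_ext fun m f => ?_
    rw [LinearMap.comp_apply, LinearMap.comp_apply, Hoch.d, Level.lift_of, Csg.d]
    exact Csg.lift_cls _ _ m 0 f
  exact LinearMap.congr_fun this x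

end Complexes

section Cohomology

variable {k : Type*} [CommRing k] {M : Type*} [AddCommGroup M] [Module k M]

/-- The cohomology `ker d / im d` of a differential `d`. -/
def Coh (d : M →ₗ[k] M) : Type _ :=
  LinearMap.ker d ⧸ (LinearMap.range d).submoduleOf (LinearMap.ker d)

instance (d : M →ₗ[k] M) : AddCommGroup (Coh d) := by unfold Coh; infer_instance
instance (d : M →ₗ[k] M) : Module k (Coh d) :=
  (inferInstance : Module k (LinearMap.ker d ⧸ (LinearMap.range d).submoduleOf (LinearMap.ker d)))

/-- The cohomology class of a cocycle. -/
def Coh.mk (d : M →ₗ[k] M) : LinearMap.ker d →ₗ[k] Coh d :=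
  ((LinearMap.range d).submoduleOf (LinearMap.ker d)).mkQ

/-- The component of the cohomology consisting of the classes of the cocycles in `C`. -/
def Coh.component (d : M →ₗ[k] M) (C : Submodule k M) : Submodule k (Coh d) :=
  (C.comap (LinearMap.ker d).subtype).map (Coh.mk d)

/-- The element `x` is a cocycle, and its cohomology class is `ξ`. -/
def IsClassOf (d : M →ₗ[k] M) (x : M) (ξ : Coh d) : Prop :=
  ∃ h : x ∈ LinearMap.ker d, Coh.mk d ⟨x, h⟩ = ξ

/-- The operation `op` on cochains takes cocycles to cocycles, and induces the operation `opH` on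
cohomology classes. -/
def Induces (d : M →ₗ[k] M) (op : M →ₗ[k] M →ₗ[k] M) (opH : Coh d →ₗ[k] Coh d →ₗ[k] Coh d) :
    Prop :=
  ∀ x y ξ η, IsClassOf d x ξ → IsClassOf d y η → IsClassOf d (op x y) (opH ξ η)

/-- The map induced on cohomology by a morphism of complexes. -/
def Coh.map {N : Type*} [AddCommGroup N] [Module k N] {d : M →ₗ[k] M} {d' : N →ₗ[k] N}
    (φ : M →ₗ[k] N) (hφ : ∀ x, d' (φ x) = φ (d x)) : Coh d →ₗ[k] Coh d' :=
  Submodule.mapQ _ _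
    (φ.restrict (p := LinearMap.ker d) (q := LinearMap.ker d') fun x hx => by
      rw [LinearMap.mem_ker] at hx ⊢
      rw [hφ, hx, map_zero])
    (by
      rintro ⟨_, hx⟩ ⟨y, rfl⟩
      exact ⟨φ y, hφ y⟩)

theorem Coh.map_mk {N : Type*} [AddCommGroup N] [Module k N] {d : M →ₗ[k] M} {d' : N →ₗ[k] N}
    (φ : M →ₗ[k] N) (hφ : ∀ x, d' (φ x) = φ (d x)) {x : M} {ξ : Coh d} (h : IsClassOf d x ξ) :
    IsClassOf d' (φ x) (Coh.map φ hφ ξ) := by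
  obtain ⟨hx, rfl⟩ := h
  exact ⟨_, rfl⟩

end Cohomology

section Gerstenhaber

variable {k : Type*} [Field k] {G : Type*} [AddCommGroup G] [Module k G]
variable {H : Type*} [AddCommGroup H] [Module k H]

/-- A Gerstenhaber algebra structure on the `k`-module `G`: a `ℤ`-grading `𝒢`, a unital graded
commutative product, and a bracket of degree `-1` that is a graded Lie bracket on the shifted
module `G^{*+1}` and a graded derivation of the product in its second argument. -/
structure IsGerstenhaberAlgebra (𝒢 : ℤ → Submodule k G) (cup br : G →ₗ[k] G →ₗ[k] G) (one : G) :
    Prop where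
  isInternal : DirectSum.IsInternal 𝒢
  one_mem : one ∈ 𝒢 0
  cup_mem : ∀ {i j a b}, a ∈ 𝒢 i → b ∈ 𝒢 j → cup a b ∈ 𝒢 (i + j)
  br_mem : ∀ {i j a b}, a ∈ 𝒢 i → b ∈ 𝒢 j → br a b ∈ 𝒢 (i + j - 1)
  one_cup : ∀ a, cup one a = a
  cup_one : ∀ a, cup a one = a
  cup_assoc : ∀ a b c, cup (cup a b) c = cup a (cup b c)
  cup_comm : ∀ {i j a b}, a ∈ 𝒢 i → b ∈ 𝒢 j → cup a b = sgn k (i * j) • cup b a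
  br_skew : ∀ {i j a b}, a ∈ 𝒢 i → b ∈ 𝒢 j → br a b = -(sgn k ((i - 1) * (j - 1)) • br b a)
  jacobi : ∀ {i j l a b c}, a ∈ 𝒢 i → b ∈ 𝒢 j → c ∈ 𝒢 l →
    sgn k ((i - 1) * (l - 1)) • br a (br b c) + sgn k ((i - 1) * (j - 1)) • br b (br c a) +
      sgn k ((j - 1) * (l - 1)) • br c (br a b) = 0
  leibniz : ∀ {i j a b} (c), a ∈ 𝒢 i → b ∈ 𝒢 j →
    br a (cup b c) = cup (br a b) c + sgn k ((i - 1) * j) • cup b (br a c)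

/-- A morphism of Gerstenhaber algebras: a linear map that preserves the degrees, the products,
the units and the brackets. -/
structure IsGerstenhaberHom (𝒢 : ℤ → Submodule k G) (cup br : G →ₗ[k] G →ₗ[k] G) (one : G)
    (ℋ : ℤ → Submodule k H) (cup' br' : H →ₗ[k] H →ₗ[k] H) (one' : H) (φ : G →ₗ[k] H) : Prop where
  map_mem : ∀ {i a}, a ∈ 𝒢 i → φ a ∈ ℋ i
  map_one : φ one = one'
  map_cup : ∀ a b, φ (cup a b) = cup' (φ a) (φ b)
  map_br : ∀ a b, φ (br a b) = br' (φ a) (φ b)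

end Gerstenhaber

section Main

variable (k : Type u) [Field k] (A : Type v) [Ring A] [Algebra k A]

/-- The Hochschild cohomology `HH^*(A, A)`. -/
abbrev HH : Type (max u v) := Coh (Hoch.d (k := k) (A := A))

/-- The singular Hochschild cohomology `HH_sg^*(A, A)`. -/
abbrev HHsg : Type (max u v) := Coh (Csg.d (k := k) (A := A))

/-- The component `HH^i(A, A)`. -/
def HH.degree (i : ℤ) : Submodule k (HH k A) := Coh.component Hoch.d (Hoch.degree i)

/-- The component `HH_sg^i(A, A)`. -/
def HHsg.degree (i : ℤ) : Submodule k (HHsg k A) := Coh.component Csg.d (Csg.degree i)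

/-- The natural map `ρ : HH^*(A, A) → HH_sg^*(A, A)`, induced by the canonical map from
`C^*(A, A) = C^*(A, Ω^0)` to the colimit. -/
def rho : HH k A →ₗ[k] HHsg k A := Coh.map (toCsg 0) d_toCsg

end Main

end TateHochschild

end

open TateHochschild

/-! Cochains are turned into operators. A cochain `f : Ā^{⊗m} → A ⊗ Ā^{⊗p}` gives the left
`A`-linear operator `op f = f ⊗ id` on `A ⊗ T(Ā)`, and `θ` does not change this operator in large
tensor degrees. A homogeneous singular cochain is therefore a germ: an operator that lowers degrees
by a bounded amount, modulo operators that vanish in large degrees. Nothing is lost in fixed degree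
(`Csg.eq_of_toGerm_eq`), so identities of singular cochains can be checked in the associative
algebra `Germ`.

There all the structure consists of products and graded commutators. The cup product is composition
(`germ_opB_cup`). The circle product `f ∘ g` is the graded commutator of `f` with the infinite sum
`ins g = ∑ i, id_A ⊗ id^{⊗i} ⊗ ḡ ⊗ id` (`germ_opB_circ`): insertions beyond the inputs or outputs of
`f` slide past `f` and cancel, which leaves the two finite sums of the definition. The differential
is the graded commutator with one odd operator `b = bdry` (`germ_opB_hochschild`). Associativity,
the Leibniz rule for the differential and the derivation property of `- ∘ z` are then formal.

Two identities of `ins` carry the rest. First, `ins Z * ins Y = ins (Z * ins Y ± ins Z * Y)`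
(`ins_mul_ins`), obtained by sorting pairs of places. It makes the circle product a graded pre-Lie
product, whence the Jacobi identity, already for cochains. Secondly, `[b, ins Z] + ins [b, Z] = Z -
R` (`bdry_mul_ins`): `ins` is a contracting homotopy up to an error `R` of the form `∑ i, id^{⊗i} ⊗
X` with `X` zero in large degrees. Such tails graded-commute with all germs of cochains
(`IsTail.comm`), so the differential of `x ∘ y` produces the graded commutator of the cup product,
and the cup product is commutative on cohomology.

For the Leibniz rule of the bracket only `x ∘ (y ∪ z)` needs work. For cocycles, `z = [b, ins z]` up
to a tail, so `y z` is, up to sign and tails, `[b, y * ins z]`, and the homotopy identity evaluates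
`ins (y z)`. The correction is the coboundary of `w = (x ∘ y) * ins z - [x, ins (y * ins z)]`. The
infinite sums in `w` cancel and leave a finite sum of double insertions, so `w` is a cochain
(`Csg.homotopyGerm_eq`, `Csg.exists_circ_cup`).

A subtlety throughout: `ins` is not defined on germs. Lifts of one germ with the same parity have
images under `ins` that differ by a tail, which is harmless inside commutators with cochains.

For `C^*(A, A)` the same identities hold because it embeds in the singular complex when `Ā ≠ 0`; all
the homotopies involved stay in `C^*(A, A)`. When `Ā = 0` the singular complex carries no
information, but `C^*(A, A)` is spanned by the unit and everything is immediate. The passage from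
these cochain identities to cohomology is formal (`IsHomotopyGerstenhaber`). -/

open scoped TensorProduct DirectSum

noncomputable section

namespace TateHochschild

/-! ### Operators on `A ⊗ T(Ā)` and the insertion operator -/

section TensorAlgebraModel

variable (k : Type u) [Field k] (A : Type v) [Ring A] [Algebra k A]

/-- The tensor algebra of `Ā`. -/
abbrev TT : Type (max u v) := TensorAlgebra k (Bar k A)

/-- The left `A`-module `A ⊗ T(Ā)`, the sum of all the modules of differential forms. -/
abbrev MM : Type (max u v) := A ⊗[k] TT k A

/-- The linear operators on `T(Ā)`. -/
def TEnd : Type (max u v) := Module.End k (TT k A)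

/-- The ring structure of `TEnd k A`. -/
def TEnd.ring : Ring (TEnd k A) := (Module.End.instRing : Ring (Module.End k (TT k A)))

instance : Ring (TEnd k A) := TEnd.ring k A
instance : Algebra k (TEnd k A) := (Module.End.instAlgebra k k _ : Algebra k (Module.End k (TT k A)))
instance : FunLike (TEnd k A) (TT k A) (TT k A) :=
  (inferInstance : FunLike (TT k A →ₗ[k] TT k A) (TT k A) (TT k A))
instance : LinearMapClass (TEnd k A) k (TT k A) (TT k A) :=
  (inferInstance : LinearMapClass (TT k A →ₗ[k] TT k A) k (TT k A) (TT k A))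

/-- The left `A`-linear operators on `A ⊗ T(Ā)`. -/
def MEnd : Type (max u v) := Module.End A (MM k A)

/-- The ring structure of `MEnd k A`. -/
def MEnd.ring : Ring (MEnd k A) := (Module.End.instRing : Ring (Module.End A (MM k A)))

instance : Ring (MEnd k A) := MEnd.ring k A
instance : Algebra k (MEnd k A) := (Module.End.instAlgebra k A _ : Algebra k (Module.End A (MM k A)))
instance : FunLike (MEnd k A) (MM k A) (MM k A) :=
  (inferInstance : FunLike (MM k A →ₗ[A] MM k A) (MM k A) (MM k A))
instance : LinearMapClass (MEnd k A) A (MM k A) (MM k A) :=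
  (inferInstance : LinearMapClass (MM k A →ₗ[A] MM k A) A (MM k A) (MM k A))

variable {k A}

/-- An operator as a linear map. -/
def TEnd.toLin : TEnd k A ≃ₗ[k] (TT k A →ₗ[k] TT k A) := LinearEquiv.refl k (TT k A →ₗ[k] TT k A)

/-- An operator as a linear map. -/
def MEnd.toLin : MEnd k A →ₗ[k] (MM k A →ₗ[k] MM k A) where
  toFun Z := LinearMap.restrictScalars k (Z : MM k A →ₗ[A] MM k A)
  map_add' _ _ := rfl
  map_smul' _ _ := rfl

namespace TEnd

@[simp] theorem toLin_apply (X : TEnd k A) (t : TT k A) : toLin X t = X t := rfl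
@[simp] theorem toLin_symm_apply (X : TT k A →ₗ[k] TT k A) (t : TT k A) :
    toLin.symm X t = X t := rfl
@[simp] theorem add_apply (X Y : TEnd k A) (t : TT k A) : (X + Y) t = X t + Y t := rfl
@[simp] theorem sub_apply (X Y : TEnd k A) (t : TT k A) : (X - Y) t = X t - Y t := rfl
@[simp] theorem neg_apply (X : TEnd k A) (t : TT k A) : (-X) t = -X t := rfl
@[simp] theorem zero_apply (t : TT k A) : (0 : TEnd k A) t = 0 := rfl
@[simp] theorem mul_apply (X Y : TEnd k A) (t : TT k A) : (X * Y) t = X (Y t) := rfl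
@[simp] theorem one_apply (t : TT k A) : (1 : TEnd k A) t = t := rfl
@[simp] theorem smul_apply (c : k) (X : TEnd k A) (t : TT k A) : (c • X) t = c • X t := rfl

@[ext] theorem ext {X Y : TEnd k A} (h : ∀ t, X t = Y t) : X = Y := DFunLike.ext _ _ h

end TEnd

namespace MEnd

@[simp] theorem toLin_apply (Z : MEnd k A) (m : MM k A) : toLin Z m = Z m := rfl
@[simp] theorem add_apply (Z W : MEnd k A) (m : MM k A) : (Z + W) m = Z m + W m := rfl
@[simp] theorem sub_apply (Z W : MEnd k A) (m : MM k A) : (Z - W) m = Z m - W m := rfl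
@[simp] theorem neg_apply (Z : MEnd k A) (m : MM k A) : (-Z) m = -Z m := rfl
@[simp] theorem zero_apply (m : MM k A) : (0 : MEnd k A) m = 0 := rfl
@[simp] theorem mul_apply (Z W : MEnd k A) (m : MM k A) : (Z * W) m = Z (W m) := rfl
@[simp] theorem one_apply (m : MM k A) : (1 : MEnd k A) m = m := rfl
@[simp] theorem smul_apply (c : k) (Z : MEnd k A) (m : MM k A) : (c • Z) m = c • Z m := rfl

@[simp] theorem map_smul_of_field (Z : MEnd k A) (c : k) (m : MM k A) : Z (c • m) = c • Z m :=
  (toLin Z).map_smul c m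

end MEnd

/-- The inclusion `Ā^{⊗n} → T(Ā)`. -/
def inc (n : ℕ) : Tens k (Bar k A) n →ₗ[k] TT k A :=
  (TensorPower.toTensorAlgebra : ⨂[k]^n (Bar k A) →ₗ[k] TT k A)

theorem inc_concat {a b c : ℕ} (h : a + b = c) (x : Tens k (Bar k A) a)
    (y : Tens k (Bar k A) b) : inc c (concat h (x ⊗ₜ y)) = inc a x * inc b y := by
  subst h
  have h1 : ∀ (x : ⨂[k]^a (Bar k A)) (y : ⨂[k]^b (Bar k A)),
      TensorPower.cast k (Bar k A) rfl (TensorPower.mulEquiv (x ⊗ₜ[k] y)) =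
      (GradedMonoid.GMul.mul (A := fun n => ⨂[k]^n (Bar k A)) x y :) := by
    intro x y
    rw [TensorPower.gMul_def, TensorPower.cast_refl]
    rfl
  exact (congrArg TensorPower.toTensorAlgebra (h1 x y)).trans
    (TensorPower.toTensorAlgebra_gMul _ _)

theorem inc_unitTens : inc 0 (unitTens : Tens k (Bar k A) 0) = 1 :=
  TensorPower.toTensorAlgebra_gOne

theorem inc_tensOne (x : Bar k A) : inc 1 (tensOne x) = TensorAlgebra.ι k x := by
  have h : (tensOne x : Tens k (Bar k A) 1) = PiTensorProduct.tprod k (fun _ : Fin 1 => x) := by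
    change (PiTensorProduct.subsingletonEquiv (R := k) (s := fun _ : Fin 1 => Bar k A) 0).symm x = _
    rw [PiTensorProduct.subsingletonEquiv_symm_apply]
    congr 1
    funext i
    fin_cases i
    rfl
  rw [h]
  refine (TensorPower.toTensorAlgebra_tprod _).trans ?_
  simp [TensorAlgebra.tprod_apply]

/-- A linear map out of `T(Ā)` from linear maps on its homogeneous components. -/
def TT.lift {M : Type*} [AddCommMonoid M] [Module k M]
    (F : ∀ n, Tens k (Bar k A) n →ₗ[k] M) : TT k A →ₗ[k] M :=
  (DirectSum.toModule k ℕ M F : (⨁ n, ⨂[k]^n (Bar k A)) →ₗ[k] M) ∘ₗ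
    (TensorAlgebra.equivDirectSum (R := k) (M := Bar k A)).toLinearMap

theorem equivDirectSum_inc (n : ℕ) (t : Tens k (Bar k A) n) :
    TensorAlgebra.equivDirectSum (inc n t) =
      DirectSum.lof k ℕ (fun n => ⨂[k]^n (Bar k A)) n t := by
  have : inc n t = (TensorAlgebra.equivDirectSum (R := k) (M := Bar k A)).symm
      (DirectSum.lof k ℕ (fun n => ⨂[k]^n (Bar k A)) n t) := by
    refine Eq.symm ((DirectSum.toAddMonoid_of (β := fun n => ⨂[k]^n (Bar k A))
      (fun n => LinearMap.toAddMonoidHom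
        (TensorPower.toTensorAlgebra : ⨂[k]^n (Bar k A) →ₗ[k] TT k A)) n t).trans ?_)
    rfl
  rw [this, AlgEquiv.apply_symm_apply]

theorem TT.lift_inc {M : Type*} [AddCommMonoid M] [Module k M]
    (F : ∀ n, Tens k (Bar k A) n →ₗ[k] M) (n : ℕ) (t : Tens k (Bar k A) n) :
    TT.lift F (inc n t) = F n t := by
  rw [TT.lift, LinearMap.comp_apply]
  change DirectSum.toModule k ℕ M _ (TensorAlgebra.equivDirectSum (inc n t)) = _
  rw [equivDirectSum_inc]
  exact DirectSum.toModule_lof (M := fun n => ⨂[k]^n (Bar k A)) (φ := F) k n t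

theorem TT.hom_ext {M : Type*} [AddCommMonoid M] [Module k M] {F G : TT k A →ₗ[k] M}
    (h : ∀ n t, F (inc n t) = G (inc n t)) : F = G := by
  have : F ∘ₗ (TensorAlgebra.equivDirectSum (R := k) (M := Bar k A)).symm.toLinearMap =
      G ∘ₗ (TensorAlgebra.equivDirectSum (R := k) (M := Bar k A)).symm.toLinearMap := by
    refine DirectSum.linearMap_ext k fun n => LinearMap.ext fun t => ?_
    have e := equivDirectSum_inc n t
    have e' := congrArg (TensorAlgebra.equivDirectSum (R := k) (M := Bar k A)).symm e
    rw [AlgEquiv.symm_apply_apply] at e'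
    have := h n t
    rw [e'] at this
    exact this
  refine LinearMap.ext fun x => ?_
  simpa using LinearMap.congr_fun this (TensorAlgebra.equivDirectSum x)

theorem tens_zero_induction {C : Tens k (Bar k A) 0 → Prop} (x : Tens k (Bar k A) 0)
    (h : ∀ c : k, C (c • unitTens)) : C x := by
  have : x = (PiTensorProduct.isEmptyEquiv (R := k) (s := fun _ : Fin 0 => Bar k A) (Fin 0)
      (x : ⨂[k]^0 (Bar k A))) • unitTens := by
    have h1 := (PiTensorProduct.isEmptyEquiv (R := k) (s := fun _ : Fin 0 => Bar k A)
      (Fin 0)).symm_apply_apply (x : ⨂[k]^0 (Bar k A))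
    refine h1.symm.trans ?_
    rw [PiTensorProduct.isEmptyEquiv_symm_apply]
    rfl
  rw [this]
  exact h _

theorem TT.induction {C : TT k A → Prop} (t : TT k A) (hadd : ∀ x y, C x → C y → C (x + y))
    (hone : ∀ c : k, C (c • 1)) (hcons : ∀ v t, C t → C (TensorAlgebra.ι k v * t)) : C t := by
  have h0 : C 0 := by simpa using hone 0
  have key : ∀ n (t : Tens k (Bar k A) n), C (inc n t) := by
    intro n
    induction n with
    | zero =>
      intro t
      induction t using tens_zero_induction with | h c => ?_
      rw [map_smul, inc_unitTens]
      exact hone c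
    | succ n ih =>
      intro t
      induction t using concat_induction (add_comm 1 n) with
      | h0 => simpa using h0
      | hadd x y hx hy => rw [map_add]; exact hadd _ _ hx hy
      | H s t =>
        rw [inc_concat]
        obtain ⟨v, rfl⟩ := tensOne.surjective s
        rw [inc_tensOne]
        exact hcons _ _ (ih t)
  have : t = (TensorAlgebra.equivDirectSum (R := k) (M := Bar k A)).symm
      (TensorAlgebra.equivDirectSum t) := by simp
  rw [this]
  induction TensorAlgebra.equivDirectSum t using DirectSum.induction_on with
  | zero => simpa using h0
  | add x y hx hy => rw [map_add]; exact hadd _ _ hx hy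
  | of n t =>
    have e := congrArg (TensorAlgebra.equivDirectSum (R := k) (M := Bar k A)).symm
      (equivDirectSum_inc n t)
    rw [AlgEquiv.symm_apply_apply] at e
    rw [← DirectSum.lof_eq_of k, ← e]
    exact key n t

/-- This is the decomposition `T(Ā) = k ⊕ Ā · T(Ā)`, on whose summands `tau`, `uncons` and `scal`
are defined. -/
theorem TEnd.ext_cons {X Y : TEnd k A}
    (h1 : X 1 = Y 1) (h : ∀ v t, X (TensorAlgebra.ι k v * t) = Y (TensorAlgebra.ι k v * t)) :
    X = Y := by
  refine TEnd.ext fun t => ?_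
  induction t using TT.induction with
  | hadd x y hx hy => rw [map_add, map_add, hx, hy]
  | hone c => rw [map_smul, map_smul, h1]
  | hcons v t _ => exact h v t

/-- The parity involution of `T(Ā)`. -/
def eps : TT k A →ₐ[k] TT k A := TensorAlgebra.lift k (-TensorAlgebra.ι k)

@[simp] theorem eps_ι (x : Bar k A) : eps (TensorAlgebra.ι k x) = -TensorAlgebra.ι k x := by
  simp [eps]

@[simp] theorem eps_eps (t : TT k A) : eps (eps t) = t := by
  have : (eps.comp eps : TT k A →ₐ[k] TT k A) = AlgHom.id k _ := by
    refine TensorAlgebra.hom_ext (LinearMap.ext fun x => ?_)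
    simp
  exact DFunLike.congr_fun this t

theorem eps_inc (n : ℕ) (t : Tens k (Bar k A) n) : eps (inc n t) = sgn k n • inc n t := by
  induction n with
  | zero =>
    induction t using tens_zero_induction with | h c => ?_
    simp [inc_unitTens, sgn]
  | succ n ih =>
    induction t using concat_induction (add_comm 1 n) with
    | h0 => simp
    | hadd x y hx hy => rw [map_add, map_add, hx, hy, smul_add]
    | H s t =>
      rw [inc_concat]
      obtain ⟨v, rfl⟩ := tensOne.surjective s
      rw [inc_tensOne, map_mul, eps_ι, ih, Nat.cast_succ, sgn_succ]
      simp

/-- The multiplication `Ā ⊗ T(Ā) → T(Ā)`. -/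
def cons : Bar k A ⊗[k] TT k A →ₗ[k] TT k A :=
  TensorProduct.lift ((LinearMap.mul k (TT k A)).comp (TensorAlgebra.ι k))

@[simp] theorem cons_tmul (v : Bar k A) (t : TT k A) :
    cons (v ⊗ₜ t) = TensorAlgebra.ι k v * t := by simp [cons]

/-- The inverse of `cons` in positive degrees. -/
def uncons : TT k A →ₗ[k] Bar k A ⊗[k] TT k A :=
  TT.lift fun n => match n with
    | 0 => 0
    | n + 1 => TensorProduct.map tensOne.symm.toLinearMap (inc n) ∘ₗ
        (concat (add_comm 1 n)).symm.toLinearMap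

@[simp] theorem uncons_one : uncons (1 : TT k A) = 0 := by
  rw [← inc_unitTens, uncons, TT.lift_inc]
  rfl

@[simp] theorem uncons_ι_mul (v : Bar k A) (t : TT k A) :
    uncons (TensorAlgebra.ι k v * t) = v ⊗ₜ t := by
  have : uncons ∘ₗ LinearMap.mulLeft k (TensorAlgebra.ι k v) =
      TensorProduct.mk k (Bar k A) (TT k A) v := by
    refine TT.hom_ext fun n t => ?_
    simp only [LinearMap.comp_apply, LinearMap.mulLeft_apply, TensorProduct.mk_apply]
    rw [← inc_tensOne, ← inc_concat (add_comm 1 n), uncons, TT.lift_inc]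
    simp
  exact LinearMap.congr_fun this t

/-- The parity involution as an operator. -/
def epsE : TEnd k A := TEnd.toLin.symm eps.toLinearMap

@[simp] theorem epsE_apply (t : TT k A) : epsE t = eps t := rfl

/-- The conjugate of an operator with the parity involution. -/
def conj : TEnd k A →ₗ[k] TEnd k A where
  toFun X := TEnd.toLin.symm (eps.toLinearMap ∘ₗ TEnd.toLin X ∘ₗ eps.toLinearMap)
  map_add' X Y := by simp [LinearMap.add_comp, LinearMap.comp_add]
  map_smul' c X := by simp [LinearMap.smul_comp, LinearMap.comp_smul]

theorem conj_apply (X : TEnd k A) (t : TT k A) : conj X t = eps (X (eps t)) := rfl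

@[simp] theorem conj_conj (X : TEnd k A) : conj (conj X) = X := by
  ext t; simp [conj_apply]

theorem conj_mul (X Y : TEnd k A) : conj (X * Y) = conj X * conj Y := by
  ext t; simp [conj_apply]

/-- The operator `id ⊗ X`, with the Koszul sign. -/
def tau : TEnd k A →ₗ[k] TEnd k A where
  toFun X := TEnd.toLin.symm (cons ∘ₗ (TEnd.toLin (conj X)).lTensor _ ∘ₗ uncons)
  map_add' X Y := by simp [LinearMap.lTensor_add, LinearMap.add_comp, LinearMap.comp_add]
  map_smul' c X := by simp [LinearMap.lTensor_smul, LinearMap.smul_comp, LinearMap.comp_smul]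

@[simp] theorem tau_one (X : TEnd k A) : tau X 1 = 0 := by simp [tau]

@[simp] theorem tau_ι_mul (X : TEnd k A) (v : Bar k A) (t : TT k A) :
    tau X (TensorAlgebra.ι k v * t) = TensorAlgebra.ι k v * conj X t := by simp [tau]

theorem tau_mul (X Y : TEnd k A) : tau (X * Y) = tau X * tau Y := by
  refine TEnd.ext_cons ?_ fun v t => ?_
  · simp
  · simp [conj_mul]

theorem tau_conj (X : TEnd k A) : tau (conj X) = conj (tau X) := by
  refine TEnd.ext_cons ?_ fun v t => ?_
  · simp [conj_apply]
  · simp [conj_apply]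

/-- The sum `∑ i, tau^i X`. -/
def frAux (X : TEnd k A) : TEnd k A :=
  TEnd.toLin.symm
    (TT.lift fun n => ∑ i ∈ Finset.range (n + 1), TEnd.toLin ((tau ^ i : Module.End k _) X) ∘ₗ inc n)

theorem frAux_inc (X : TEnd k A) (n : ℕ) (t : Tens k (Bar k A) n) : frAux X (inc n t) =
    ∑ i ∈ Finset.range (n + 1), (tau ^ i : Module.End k _) X (inc n t) := by
  rw [frAux, TEnd.toLin_symm_apply, TT.lift_inc]
  simp

/-- The term `i = 0` is `X`. The other terms carry a factor `tau`, which passes the first tensor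
factor, so the truncation at `n + 1` in degree `n + 1` becomes the truncation at `n` on the
remaining factors. -/
theorem frAux_eq (X : TEnd k A) : frAux X = X + tau (frAux X) := by
  refine TEnd.toLin.injective (TT.hom_ext fun n t => ?_)
  rw [TEnd.toLin_apply, TEnd.toLin_apply, frAux_inc]
  cases n with
  | zero =>
    induction t using tens_zero_induction with | h c => ?_
    simp [inc_unitTens]
  | succ n =>
    induction t using concat_induction (add_comm 1 n) with
    | h0 => simp
    | hadd x y hx hy =>
      simp only [map_add] at hx hy ⊢
      rw [← hx, ← hy, Finset.sum_add_distrib]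
    | H s t =>
      obtain ⟨v, rfl⟩ := tensOne.surjective s
      rw [Finset.sum_range_succ', TEnd.add_apply, add_comm]
      congr 1
      simp only [inc_concat, inc_tensOne, pow_succ', Module.End.mul_apply, tau_ι_mul]
      rw [← Finset.mul_sum]
      congr 1
      rw [conj_apply, eps_inc, map_smul, frAux_inc]
      simp only [conj_apply, eps_inc, map_sum, map_smul, Finset.smul_sum]

/-- `tau X` kills scalars, and its value on `v t` is determined by that of `X` on `t`, so a fixed
point vanishes by induction on the degree. The resulting uniqueness is how every identity of `fr`
below is proved: both sides satisfy the same recursion. -/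
theorem eq_zero_of_eq_tau {X : TEnd k A} (h : X = tau X) : X = 0 := by
  -- The claim for `eps t` is carried along because `tau` involves the conjugate of `X`.
  have : ∀ t, X t = 0 ∧ X (eps t) = 0 := by
    intro t
    induction t using TT.induction with
    | hadd x y hx hy => simp [hx, hy]
    | hone c => rw [h]; simp
    | hcons v t ih =>
      rw [h]
      simp [conj_apply, ih]
  ext t
  exact (this t).1

theorem eq_frAux {X Y : TEnd k A} (h : Y = X + tau Y) : Y = frAux X := by
  rw [← sub_eq_zero]
  apply eq_zero_of_eq_tau
  conv_lhs => rw [h, frAux_eq X]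
  rw [map_sub]
  abel

/-- The sum `∑ i, tau^i X`, the only solution of `Y = X + tau Y`. -/
def fr : TEnd k A →ₗ[k] TEnd k A where
  toFun := frAux
  map_add' X Y := by
    symm; apply eq_frAux
    conv_lhs => rw [frAux_eq X, frAux_eq Y]
    rw [map_add]; abel
  map_smul' c X := by
    symm; apply eq_frAux
    conv_lhs => rw [RingHom.id_apply, frAux_eq X]
    rw [RingHom.id_apply, map_smul, smul_add]

theorem fr_eq (X : TEnd k A) : fr X = X + tau (fr X) := frAux_eq X

theorem eq_fr {X Y : TEnd k A} (h : Y = X + tau Y) : Y = fr X := eq_frAux h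

theorem fr_conj (X : TEnd k A) : fr (conj X) = conj (fr X) := by
  symm; apply eq_fr
  conv_lhs => rw [fr_eq X]
  rw [map_add, tau_conj]

theorem fr_tau (X : TEnd k A) : fr X - fr (tau X) = X := by
  have : fr X = X + fr (tau X) := by
    symm; apply eq_fr
    rw [map_add, ← fr_eq (tau X)]
  rw [this]; abel

/-- Separates the insertions at the first `n` places, which can meet the inputs or outputs of a
cochain, from those further to the right. -/
theorem fr_eq_sum (X : TEnd k A) (n : ℕ) :
    fr X = ∑ i ∈ Finset.range n, (tau ^ i : Module.End k _) X + (tau ^ n : Module.End k _) (fr X) := by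
  induction n with
  | zero => simp
  | succ n ih =>
    rw [Finset.sum_range_succ, add_assoc, pow_succ tau n, Module.End.mul_apply, ← map_add,
      ← fr_eq, ← ih]

/-! ### Left linear operators on `A ⊗ T(Ā)` -/

/-- The operator `id_A ⊗ X`. -/
def bc : TEnd k A →ₐ[k] MEnd k A :=
  (Module.End.baseChangeHom k A (TT k A) : Module.End k (TT k A) →ₐ[k] Module.End A (MM k A))

@[simp] theorem bc_tmul (X : TEnd k A) (a : A) (t : TT k A) : bc X (a ⊗ₜ t) = a ⊗ₜ X t := rfl

theorem MEnd.ext {Z W : MEnd k A} (h : ∀ t, Z (1 ⊗ₜ t) = W (1 ⊗ₜ t)) : Z = W := by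
  refine DFunLike.ext _ _ fun x => ?_
  induction x using TensorProduct.induction_on with
  | zero => simp
  | add x y hx hy => rw [map_add, map_add, hx, hy]
  | tmul a t =>
    have : a ⊗ₜ[k] t = a • ((1 : A) ⊗ₜ[k] t) := by simp [TensorProduct.smul_tmul']
    rw [this, map_smul, map_smul, h]

/-- The restriction of an operator to `T(Ā)`. -/
def res : MEnd k A →ₗ[k] (TT k A →ₗ[k] MM k A) where
  toFun Z := MEnd.toLin Z ∘ₗ TensorProduct.mk k A (TT k A) 1
  map_add' _ _ := rfl
  map_smul' _ _ := rfl

@[simp] theorem res_apply (Z : MEnd k A) (t : TT k A) : res Z t = Z (1 ⊗ₜ t) := rfl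

/-- The left linear extension of a linear map `T(Ā) → A ⊗ T(Ā)`. -/
def lin : (TT k A →ₗ[k] MM k A) →ₗ[k] MEnd k A where
  toFun F := (TensorProduct.AlgebraTensorModule.lift (LinearMap.toSpanSingleton A _ F) :
    MM k A →ₗ[A] MM k A)
  map_add' F G := MEnd.ext fun t =>
    show (1 : A) • (F t + G t) = (1 : A) • F t + (1 : A) • G t from smul_add _ _ _
  map_smul' c F := MEnd.ext fun t =>
    show (1 : A) • (c • F t) = c • ((1 : A) • F t) from smul_comm _ _ _

@[simp] theorem lin_tmul (F : TT k A →ₗ[k] MM k A) (a : A) (t : TT k A) :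
    lin F (a ⊗ₜ t) = a • F t := rfl

/-- The map `A ⊗ T(Ā) → T(Ā)`, `a ⊗ t ↦ π(a) t`. -/
def projM : MM k A →ₗ[k] TT k A := cons ∘ₗ (proj k A).rTensor _

@[simp] theorem projM_tmul (a : A) (t : TT k A) :
    projM (a ⊗ₜ t) = TensorAlgebra.ι k (proj k A a) * t := by simp [projM]

/-- The operator on `T(Ā)` obtained from an operator `Z` on `A ⊗ T(Ā)` with `π`. -/
def shade : MEnd k A →ₗ[k] TEnd k A :=
  TEnd.toLin.symm.toLinearMap ∘ₗ (LinearMap.compRight k projM) ∘ₗ res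

theorem shade_apply (Z : MEnd k A) (t : TT k A) : shade Z t = projM (Z (1 ⊗ₜ t)) := rfl

/-- The conjugate of an operator with the parity involution. -/
def conjM : MEnd k A →ₗ[k] MEnd k A where
  toFun Z := bc epsE * Z * bc epsE
  map_add' X Y := by rw [mul_add, add_mul]
  map_smul' c X := by simp

theorem conjM_apply (Z : MEnd k A) (t : TT k A) :
    conjM Z (1 ⊗ₜ t) = bc epsE (Z (1 ⊗ₜ eps t)) := rfl

theorem bc_eps_mul : bc (k := k) (A := A) epsE * bc epsE = 1 := by
  refine MEnd.ext fun t => ?_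
  simp

theorem conjM_mul (Z W : MEnd k A) : conjM (Z * W) = conjM Z * conjM W := by
  have : ∀ e z w : MEnd k A, e * e = 1 → e * (z * w) * e = e * z * e * (e * w * e) := by
    intro e z w h
    rw [show e * z * e * (e * w * e) = e * z * (e * e) * w * e by noncomm_ring, h]
    noncomm_ring
  exact this _ _ _ bc_eps_mul

@[simp] theorem conjM_conjM (Z : MEnd k A) : conjM (conjM Z) = Z := by
  have : ∀ e z : MEnd k A, e * e = 1 → e * (e * z * e) * e = z := by
    intro e z h
    rw [show e * (e * z * e) * e = (e * e) * z * (e * e) by noncomm_ring, h]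
    simp
  exact this _ _ bc_eps_mul

theorem conjM_bc (X : TEnd k A) : conjM (bc X) = bc (conj X) := by
  refine MEnd.ext fun t => ?_
  simp [conjM_apply, conj_apply]

theorem shade_mul_bc (Z : MEnd k A) (X : TEnd k A) : shade (Z * bc X) = shade Z * X := by
  ext t; simp [shade_apply]

/-- `π` turns the factor `A` into a first tensor factor, which `X` then has to pass; `conj` removes
the Koszul sign built into `tau`. -/
theorem projM_bc (X : TEnd k A) (m : MM k A) : projM (bc X m) = tau (conj X) (projM m) := by
  induction m using TensorProduct.induction_on with
  | zero => simp
  | add x y hx hy => simp only [map_add, hx, hy]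
  | tmul a t => simp

theorem shade_bc_mul (X : TEnd k A) (Z : MEnd k A) :
    shade (bc X * Z) = tau (conj X) * shade Z := by
  ext t; simp [shade_apply, projM_bc]

theorem projM_eps (m : MM k A) : projM (bc epsE m) = -eps (projM m) := by
  induction m using TensorProduct.induction_on with
  | zero => simp
  | add x y hx hy => simp only [map_add, hx, hy, neg_add]
  | tmul a t => simp

/-- The sign appears because `π` adds one tensor factor. Hence `ins` is an odd map, in agreement
with the degree `-1` of the circle product. -/
theorem shade_conjM (Z : MEnd k A) : shade (conjM Z) = -conj (shade Z) := by
  ext t; simp [shade_apply, conjM_apply, projM_eps, conj_apply]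

/-- The contracting homotopy `Z ↦ ∑ i, id_A ⊗ tau^i (π Z)`. -/
def ins : MEnd k A →ₗ[k] MEnd k A := bc.toLinearMap ∘ₗ fr ∘ₗ shade

theorem ins_apply (Z : MEnd k A) : ins Z = bc (fr (shade Z)) := rfl

theorem conjM_ins (Z : MEnd k A) : conjM (ins Z) = -ins (conjM Z) := by
  rw [ins_apply, ins_apply, conjM_bc, shade_conjM, map_neg, map_neg, fr_conj, neg_neg]

/-- A pair of insertions is sorted by which place comes first. With `P = shade Z` and `Q = shade Y`,
the recursion gives `fr P * fr Q = P * fr Q + tau (fr P) * Q + tau (fr P * fr Q)`, and uniqueness of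
solutions identifies the product. -/
theorem fr_shade_mul (Z Y : MEnd k A) :
    fr (shade Z) * fr (shade Y) = fr (shade (Z * ins Y + conjM (ins Z) * Y)) := by
  apply eq_fr
  rw [map_add, ins_apply, shade_mul_bc, ins_apply, conjM_bc, shade_bc_mul, conj_conj, tau_mul]
  conv_lhs => rw [fr_eq (shade Z), add_mul]
  conv_lhs => enter [2]; rw [fr_eq (shade Y)]
  rw [mul_add]
  abel

theorem ins_mul_ins (Z Y : MEnd k A) : ins Z * ins Y = ins (Z * ins Y + conjM (ins Z) * Y) := by
  rw [ins_apply (_ + _), ← fr_shade_mul, map_mul]; rfl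

/-- The difference `a - σ(π a)` lies in the line spanned by `1`, and a linear section of `k → k · 1`
reads off its coefficient; this also covers `A = 0`. -/
theorem exists_counit : ∃ c : A →ₗ[k] k, ∀ a, lifts k A (proj k A a) + c a • 1 = a := by
  obtain ⟨s, hs⟩ := (LinearMap.toSpanSingleton k A 1).rangeRestrict.exists_rightInverse_of_surjective
    (LinearMap.range_rangeRestrict _)
  have h : ∀ a, (LinearMap.id - lifts k A ∘ₗ proj k A : A →ₗ[k] A) a ∈
      LinearMap.range (LinearMap.toSpanSingleton k A 1) := by
    intro a
    have h1 : proj k A (a - lifts k A (proj k A a)) = 0 := by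
      rw [map_sub, ← LinearMap.comp_apply, proj_comp_lifts, LinearMap.id_apply, sub_self]
    rw [LinearMap.range_toSpanSingleton]
    exact (Submodule.Quotient.mk_eq_zero _).1 h1
  refine ⟨s ∘ₗ LinearMap.codRestrict _ _ h, fun a => ?_⟩
  have := congrArg Subtype.val (LinearMap.congr_fun hs ⟨_, h a⟩)
  rw [add_comm, ← eq_sub_iff_add_eq]
  exact this

variable (k A) in
/-- A linear form `c` on `A` with `a = σ(π a) + c(a) 1`, where `σ` are the chosen lifts. -/
def counit : A →ₗ[k] k := Classical.choose (exists_counit (k := k) (A := A))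

theorem lifts_proj_add_counit (a : A) : lifts k A (proj k A a) + counit k A a • 1 = a :=
  Classical.choose_spec (exists_counit (k := k) (A := A)) a

/-- The operator `a ⊗ v t ↦ a σ(v) ⊗ t`. -/
def liftOp : MEnd k A := lin ((lifts k A).rTensor _ ∘ₗ uncons)

@[simp] theorem liftOp_one (a : A) : (liftOp : MEnd k A) (a ⊗ₜ 1) = 0 := by simp [liftOp]

@[simp] theorem liftOp_ι_mul (a : A) (v : Bar k A) (t : TT k A) :
    (liftOp : MEnd k A) (a ⊗ₜ (TensorAlgebra.ι k v * t)) = (a * lifts k A v) ⊗ₜ t := by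
  simp [liftOp, TensorProduct.smul_tmul']

theorem conjM_liftOp : conjM (liftOp : MEnd k A) = -liftOp := by
  refine MEnd.ext fun t => ?_
  induction t using TT.induction with
  | hadd x y hx hy => rw [TensorProduct.tmul_add, map_add, map_add, hx, hy]
  | hone c => simp [conjM_apply]
  | hcons v t _ =>
    rw [conjM_apply]
    simp [TensorProduct.tmul_neg]

/-- The component of an operator at the unit of `A`. -/
def kap : MEnd k A →ₗ[k] TEnd k A :=
  TEnd.toLin.symm.toLinearMap ∘ₗ
  (LinearMap.compRight k ((TensorProduct.lid k _).toLinearMap ∘ₗ (counit k A).rTensor _)) ∘ₗ res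

theorem kap_apply (Z : MEnd k A) (t : TT k A) :
    kap Z t = TensorProduct.lid k _ ((counit k A).rTensor _ (Z (1 ⊗ₜ t))) := rfl

/-- The decomposition `a = σ(π a) + c(a) 1` applied to the factor `A` of the output of `Z`: `liftOp`
reabsorbs the factor that `π` has moved into `T(Ā)`. -/
theorem liftOp_mul_bc_shade (Z : MEnd k A) : liftOp * bc (shade Z) + bc (kap Z) = Z := by
  have : ∀ m : MM k A, liftOp (1 ⊗ₜ projM m) +
      1 ⊗ₜ[k] TensorProduct.lid k _ ((counit k A).rTensor _ m) = m := by
    intro m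
    induction m using TensorProduct.induction_on with
    | zero => simp
    | add x y hx hy =>
      simp only [map_add, TensorProduct.tmul_add]
      rw [add_add_add_comm, hx, hy]
    | tmul a t =>
      simp only [projM_tmul, liftOp_ι_mul, one_mul, LinearMap.rTensor_tmul, TensorProduct.lid_tmul]
      rw [← TensorProduct.smul_tmul, ← TensorProduct.add_tmul, lifts_proj_add_counit]
  exact MEnd.ext fun t => this _

/-- `liftOp` consumes exactly the tensor factor that `tau X` leaves untouched. -/
theorem liftOp_mul_bc_tau (X : TEnd k A) : liftOp * bc (tau X) = bc (conj X) * liftOp := by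
  refine MEnd.ext fun t => ?_
  induction t using TT.induction with
  | hadd x y hx hy => rw [TensorProduct.tmul_add, map_add, map_add, hx, hy]
  | hone c => simp
  | hcons v t _ => simp

/-- The projection of `T(Ā)` to its component of degree `0`. -/
def scal : TEnd k A :=
  TEnd.toLin.symm (Algebra.linearMap k _ ∘ₗ TensorAlgebra.algebraMapInv.toLinearMap)

@[simp] theorem scal_one : scal (1 : TT k A) = 1 := by simp [scal]

@[simp] theorem scal_ι_mul (v : Bar k A) (t : TT k A) :
    scal (TensorAlgebra.ι k v * t) = 0 := by simp [scal, TensorAlgebra.algebraMapInv]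

theorem projM_liftOp (t : TT k A) : projM (liftOp (1 ⊗ₜ t)) = t - scal t := by
  induction t using TT.induction with
  | hadd x y hx hy =>
    rw [TensorProduct.tmul_add, map_add, map_add, map_add, hx, hy]; abel
  | hone c => simp
  | hcons v t _ =>
    have := LinearMap.congr_fun (proj_comp_lifts (k := k) (A := A)) v
    rw [LinearMap.comp_apply] at this
    simp [this]

/-- Since `π σ = id`, projecting after `liftOp` restores the consumed factor; only the part of
degree `0` is lost. -/
theorem shade_liftOp_mul_bc (X : TEnd k A) : shade (liftOp * bc X) = X - scal * X := by
  ext t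
  simp [shade_apply, projM_liftOp]

theorem scal_mul_tau (X : TEnd k A) : scal * tau X = 0 := by
  refine TEnd.ext_cons ?_ fun v t => ?_ <;> simp

theorem kap_conjM (Z : MEnd k A) : kap (conjM Z) = conj (kap Z) := by
  have : ∀ m : MM k A, TensorProduct.lid k _ ((counit k A).rTensor _ (bc epsE m)) =
      eps (TensorProduct.lid k _ ((counit k A).rTensor _ m)) := by
    intro m
    induction m using TensorProduct.induction_on with
    | zero => simp
    | add x y hx hy => simp only [map_add, hx, hy]
    | tmul a t => simp
  ext t
  exact this _

variable (k A) in
/-- The operator whose graded commutator is the Hochschild differential. -/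
def bdry : MEnd k A := liftOp - ins (liftOp * liftOp)

/-- In `fr = id + tau ∘ fr`, the first insertion is reabsorbed by `liftOp` and returns `Z` without
its unit component, while `liftOp` commutes with all later insertions up to sign. -/
theorem liftOp_mul_ins (Z : MEnd k A) :
    liftOp * ins Z = Z - bc (kap Z) - ins (conjM Z) * liftOp := by
  rw [ins_apply, fr_eq, map_add, mul_add, liftOp_mul_bc_tau, ← conjM_bc, ← ins_apply, conjM_ins]
  have := liftOp_mul_bc_shade Z
  rw [neg_mul, ← sub_eq_add_neg]
  congr 1
  rw [eq_sub_iff_add_eq]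
  exact this

/-- The map `ins` is a contracting homotopy for the graded commutator with `bdry`, up to operators
that act only on the last tensor factors. -/
theorem bdry_mul_ins (Z : MEnd k A) :
    bdry k A * ins Z + ins (conjM Z) * bdry k A + ins (bdry k A * Z - conjM Z * bdry k A) =
      Z - bc (fr (scal * kap Z)) := by
  -- The unit components telescope: with `X = kap Z`, the operator under `fr` is `X - tau X - scal *
  -- X`, and `fr X - fr (tau X) = X`. The leftover with `scal` is the only obstruction to an exact
  -- homotopy.
  have hu : ins (liftOp * bc (kap Z) - bc (kap (conjM Z)) * liftOp) =
      bc (kap Z) - bc (fr (scal * kap Z)) := by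
    rw [ins_apply, map_sub, kap_conjM, ← liftOp_mul_bc_tau, shade_liftOp_mul_bc,
      shade_liftOp_mul_bc, scal_mul_tau, sub_zero, map_sub, map_sub, ← map_sub (bc (k := k) (A := A))]
    have := fr_tau (kap Z)
    rw [map_sub fr, sub_sub, add_comm (fr (scal * kap Z)), ← sub_sub, this, map_sub bc]
  have h1 : conjM (liftOp * liftOp : MEnd k A) = liftOp * liftOp := by
    rw [conjM_mul, conjM_liftOp]; noncomm_ring
  -- `liftOp` is moved past `ins` twice. The last term cancels against its counterpart in `h4`.
  have h2 : liftOp * liftOp * ins Z = liftOp * Z - liftOp * bc (kap Z) - conjM Z * liftOp +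
      bc (kap (conjM Z)) * liftOp + ins Z * liftOp * liftOp := by
    rw [mul_assoc, liftOp_mul_ins, mul_sub, mul_sub, ← mul_assoc liftOp (ins _),
      liftOp_mul_ins, conjM_conjM]
    noncomm_ring
  have h3 := ins_mul_ins (liftOp * liftOp) Z
  rw [conjM_ins, h1, h2] at h3
  have h4 := ins_mul_ins (conjM Z) (liftOp * liftOp)
  rw [conjM_ins, conjM_conjM] at h4
  rw [bdry, sub_mul, mul_sub, h3, h4, liftOp_mul_ins]
  simp only [map_sub, map_add, sub_mul, mul_sub, neg_mul, map_neg, ← mul_assoc] at hu ⊢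
  rw [← sub_eq_zero] at hu ⊢
  rw [← hu]
  abel

end TensorAlgebraModel

/-! ### The operator of a cochain, and operators vanishing in large degrees -/

section Germs

variable {k : Type u} [Field k] {A : Type v} [Ring A] [Algebra k A]

theorem sgn_add (a b : ℤ) : sgn k (a + b) = sgn k a * sgn k b := by
  unfold sgn
  rw [Int.negOnePow_add]
  push_cast
  rfl

@[simp] theorem sgn_zero : sgn k 0 = 1 := by simp [sgn]

/-! ### Operators defined by a map on `Ā^{⊗n}` -/

/-- The linear map `x y ↦ H x y` for `x ∈ Ā^{⊗n}` and `y ∈ T(Ā)`, zero in degrees less than `n`. -/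
def extT {M : Type*} [AddCommMonoid M] [Module k M] (n : ℕ)
    (H : Tens k (Bar k A) n →ₗ[k] TT k A →ₗ[k] M) : TT k A →ₗ[k] M :=
  TT.lift fun N => if h : n ≤ N then
    TensorProduct.lift H ∘ₗ (inc (N - n)).lTensor _ ∘ₗ
      (concat (Nat.add_sub_cancel' h)).symm.toLinearMap else 0

theorem extT_mul {M : Type*} [AddCommMonoid M] [Module k M] (n : ℕ)
    (H : Tens k (Bar k A) n →ₗ[k] TT k A →ₗ[k] M) (x : Tens k (Bar k A) n) (y : TT k A) :
    extT n H (inc n x * y) = H x y := by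
  have : extT n H ∘ₗ LinearMap.mulLeft k (inc n x) = H x := by
    refine TT.hom_ext fun r y => ?_
    rw [LinearMap.comp_apply, LinearMap.mulLeft_apply]
    have key : ∀ (N s : ℕ) (h : n + s = N) (y : Tens k (Bar k A) s),
        extT n H (inc N (concat h (x ⊗ₜ y))) = H x (inc s y) := by
      intro N s h y
      obtain rfl : s = N - n := by omega
      rw [extT, TT.lift_inc, dif_pos (by omega)]
      simp
    rw [← inc_concat rfl, key]
  exact LinearMap.congr_fun this y

theorem extT_of_lt {M : Type*} [AddCommMonoid M] [Module k M] {n N : ℕ} (h : N < n)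
    (H : Tens k (Bar k A) n →ₗ[k] TT k A →ₗ[k] M) (x : Tens k (Bar k A) N) :
    extT n H (inc N x) = 0 := by
  rw [extT, TT.lift_inc, dif_neg (by omega)]
  rfl

theorem TT.hom_ext_mul {M : Type*} [AddCommMonoid M] [Module k M] {F G : TT k A →ₗ[k] M} (n : ℕ)
    (h1 : ∀ N, N < n → ∀ z, F (inc N z) = G (inc N z))
    (h2 : ∀ x y, F (inc n x * y) = G (inc n x * y)) : F = G := by
  refine TT.hom_ext fun N z => ?_
  by_cases h : N < n
  · exact h1 N h z
  · induction z using concat_induction (show n + (N - n) = N by omega) with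
    | h0 => simp
    | hadd x y hx hy => simp only [map_add, hx, hy]
    | H x y => rw [inc_concat, h2]

theorem TEnd.ext_mul {X Y : TEnd k A} (n : ℕ) (h1 : ∀ N, N < n → ∀ z, X (inc N z) = Y (inc N z))
    (h2 : ∀ x y, X (inc n x * y) = Y (inc n x * y)) : X = Y :=
  TEnd.toLin.injective (TT.hom_ext_mul n h1 h2)

theorem res_injective : Function.Injective (res : MEnd k A →ₗ[k] _) :=
  fun _ _ h => MEnd.ext fun t => LinearMap.congr_fun h t

theorem MEnd.ext_mul {Z W : MEnd k A} (n : ℕ)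
    (h1 : ∀ N, N < n → ∀ z, Z (1 ⊗ₜ inc N z) = W (1 ⊗ₜ inc N z))
    (h2 : ∀ x y, Z (1 ⊗ₜ (inc n x * y)) = W (1 ⊗ₜ (inc n x * y))) : Z = W :=
  res_injective (TT.hom_ext_mul n h1 h2)

/-- The operator `h ⊗ id` for a linear map `h : Ā^{⊗n} → Ā^{⊗q}`. -/
def opT {n q : ℕ} (h : Tens k (Bar k A) n →ₗ[k] Tens k (Bar k A) q) : TEnd k A :=
  TEnd.toLin.symm (extT n ((LinearMap.mul k (TT k A)) ∘ₗ inc q ∘ₗ h))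

theorem opT_mul {n q : ℕ} (h : Tens k (Bar k A) n →ₗ[k] Tens k (Bar k A) q)
    (x : Tens k (Bar k A) n) (y : TT k A) : opT h (inc n x * y) = inc q (h x) * y :=
  extT_mul n _ x y

theorem opT_of_lt {n q N : ℕ} (h : Tens k (Bar k A) n →ₗ[k] Tens k (Bar k A) q) (hN : N < n)
    (z : Tens k (Bar k A) N) : opT h (inc N z) = 0 := extT_of_lt hN _ z

/-- The right action of `T(Ā)` on `A ⊗ T(Ā)`. -/
def rmul : TT k A →ₗ[k] MEnd k A :=
  bc.toLinearMap ∘ₗ TEnd.toLin.symm.toLinearMap ∘ₗ (LinearMap.mul k (TT k A)).flip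

@[simp] theorem rmul_tmul (y : TT k A) (a : A) (t : TT k A) :
    rmul y (a ⊗ₜ t) = a ⊗ₜ (t * y) := rfl

theorem rmul_rmul (y z : TT k A) (m : MM k A) : rmul z (rmul y m) = rmul (y * z) m := by
  induction m using TensorProduct.induction_on with
  | zero => simp
  | add x y hx hy => simp only [map_add, hx, hy]
  | tmul a t => simp [mul_assoc]

/-- The inclusion of the differential forms of degree `p` in `A ⊗ T(Ā)`. -/
def inM (p : ℕ) : Omega k A p →ₗ[k] MM k A := (inc p).lTensor A ∘ₗ (forms p).symm.toLinearMap

@[simp] theorem inM_forms (p : ℕ) (a : A) (t : Tens k (Bar k A) p) :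
    inM p (forms p (a ⊗ₜ t)) = a ⊗ₜ inc p t := by simp [inM]

theorem inM_append {p r P : ℕ} (h : p + r = P) (x : Omega k A p) (y : Tens k (Bar k A) r) :
    inM P (append h (x ⊗ₜ y)) = rmul (inc r y) (inM p x) := by
  induction x using forms_induction with
  | h0 => simp
  | hadd x y hx hy => simp only [TensorProduct.add_tmul, map_add, hx, hy]
  | h b w => rw [append_forms, inM_forms, inM_forms, rmul_tmul, inc_concat]

/-- The left linear operator `f ⊗ id` for a cochain `f`. -/
def op {m p : ℕ} : Cochain k A m p →ₗ[k] MEnd k A where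
  toFun f := lin (extT m ((MEnd.toLin ∘ₗ rmul).flip ∘ₗ inM p ∘ₗ f))
  map_add' f g := MEnd.ext_mul m
    (fun N hN z => by simp [extT_of_lt hN])
    (fun x y => by simp [extT_mul])
  map_smul' c f := MEnd.ext_mul m
    (fun N hN z => by simp [extT_of_lt hN])
    (fun x y => by simp [extT_mul])

theorem op_mul {m p : ℕ} (f : Cochain k A m p) (a : A) (x : Tens k (Bar k A) m) (y : TT k A) :
    op f (a ⊗ₜ (inc m x * y)) = a • rmul y (inM p (f x)) := by
  change a • extT m ((MEnd.toLin ∘ₗ rmul).flip ∘ₗ inM p ∘ₗ f) (inc m x * y) = _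
  rw [extT_mul]
  rfl

theorem op_of_lt {m p N : ℕ} (f : Cochain k A m p) (hN : N < m) (a : A)
    (z : Tens k (Bar k A) N) : op f (a ⊗ₜ inc N z) = 0 := by
  change a • extT m ((MEnd.toLin ∘ₗ rmul).flip ∘ₗ inM p ∘ₗ f) (inc N z) = _
  rw [extT_of_lt hN, smul_zero]

/-- Identifies `shade` with the passage from `f` to `f̄` in the definition of the circle product. -/
theorem shade_op {m p : ℕ} (f : Cochain k A m p) : shade (op f) = opT (projOmega p ∘ₗ f) := by
  refine TEnd.ext_mul m (fun N hN z => ?_) fun x y => ?_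
  · rw [shade_apply, op_of_lt f hN, opT_of_lt _ hN, map_zero]
  · rw [shade_apply, op_mul, opT_mul, one_smul, LinearMap.comp_apply]
    induction f x using forms_induction with
    | h0 => simp
    | hadd x y hx hy => simp only [map_add, hx, hy, add_mul]
    | h a w =>
      rw [inM_forms, rmul_tmul, projM_tmul]
      simp [projOmega, inc_concat, inc_tensOne, mul_assoc]

theorem conj_opT {n q : ℕ} (h : Tens k (Bar k A) n →ₗ[k] Tens k (Bar k A) q) :
    conj (opT h) = sgn k (n - q) • opT h := by
  refine TEnd.ext_mul n (fun N hN z => ?_) fun x y => ?_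
  · simp [conj_apply, eps_inc, opT_of_lt h hN]
  · rw [conj_apply, map_mul, eps_inc, smul_mul_assoc, map_smul, opT_mul, map_smul, map_mul, eps_inc,
      eps_eps, TEnd.smul_apply, opT_mul, smul_mul_assoc, smul_smul, sgn_sub_eq]

theorem conjM_op {m p : ℕ} (f : Cochain k A m p) : conjM (op f) = sgn k (m - p) • op f := by
  refine MEnd.ext_mul m (fun N hN z => ?_) fun x y => ?_
  · simp [conjM_apply, eps_inc, op_of_lt f hN]
  · rw [conjM_apply, map_mul, eps_inc, smul_mul_assoc, TensorProduct.tmul_smul,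
      MEnd.map_smul_of_field, op_mul, MEnd.map_smul_of_field, MEnd.smul_apply, op_mul, one_smul,
      one_smul, sgn_sub_eq, mul_smul]
    congr 1
    induction f x using forms_induction with
    | h0 => simp
    | hadd x y hx hy => simp only [map_add, hx, hy, smul_add]
    | h a w => simp [eps_inc, TensorProduct.tmul_smul]

/-! ### Iterates of `tau` -/

/-- The `i`-th iterate of `tau`, the operator `id^{⊗i} ⊗ X` with the Koszul sign. -/
def tauI (i : ℕ) : TEnd k A →ₗ[k] TEnd k A := (tau ^ i : Module.End k (TEnd k A))

@[simp] theorem tauI_zero (X : TEnd k A) : tauI 0 X = X := rfl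

theorem tauI_succ (i : ℕ) (X : TEnd k A) : tauI (i + 1) X = tau (tauI i X) := by
  rw [tauI, pow_succ']; rfl

theorem tauI_mul (i : ℕ) (X Y : TEnd k A) : tauI i (X * Y) = tauI i X * tauI i Y := by
  induction i with
  | zero => rfl
  | succ i ih => rw [tauI_succ, tauI_succ, tauI_succ, ih, tau_mul]

theorem tauI_conj (i : ℕ) (X : TEnd k A) : tauI i (conj X) = conj (tauI i X) := by
  induction i with
  | zero => rfl
  | succ i ih => rw [tauI_succ, tauI_succ, ih, tau_conj]

theorem fr_eq_sum_tauI (X : TEnd k A) (n : ℕ) :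
    fr X = ∑ i ∈ Finset.range n, tauI i X + tauI n (fr X) := fr_eq_sum X n

theorem tauI_mul_apply {X : TEnd k A} {d : ℤ} (hX : conj X = sgn k d • X) (i : ℕ)
    (x : Tens k (Bar k A) i) (y : TT k A) :
    tauI i X (inc i x * y) = sgn k (i * d) • (inc i x * X y) := by
  induction i with
  | zero =>
    induction x using tens_zero_induction with | h c => ?_
    simp [inc_unitTens]
  | succ i ih =>
    induction x using concat_induction (add_comm 1 i) with
    | h0 => simp
    | hadd x y hx hy => simp only [map_add, add_mul, smul_add, hx, hy]
    | H s x =>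
      obtain ⟨v, rfl⟩ := tensOne.surjective s
      rw [tauI_succ, inc_concat, inc_tensOne, mul_assoc, tau_ι_mul, ← tauI_conj, hX, map_smul,
        TEnd.smul_apply, ih, smul_smul, ← sgn_add, mul_smul_comm, mul_assoc]
      congr 2
      push_cast; ring

theorem tauI_of_lt (X : TEnd k A) {i N : ℕ} (h : N < i) (z : Tens k (Bar k A) N) :
    tauI i X (inc N z) = 0 := by
  induction i generalizing N X with
  | zero => omega
  | succ i ih =>
    cases N with
    | zero =>
      induction z using tens_zero_induction with | h c => ?_
      simp [inc_unitTens, tauI_succ]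
    | succ N =>
      induction z using concat_induction (add_comm 1 N) with
      | h0 => simp
      | hadd x y hx hy => simp only [map_add, hx, hy, add_zero]
      | H s x =>
        obtain ⟨v, rfl⟩ := tensOne.surjective s
        rw [tauI_succ, inc_concat, inc_tensOne, tau_ι_mul, ← tauI_conj, ih _ (by omega), mul_zero]

theorem bc_tauI_rmul_inM {X : TEnd k A} {d : ℤ} (hX : conj X = sgn k d • X) (p : ℕ)
    (w : Omega k A p) (y : TT k A) :
    bc (tauI p X) (rmul y (inM p w)) = sgn k (p * d) • rmul (X y) (inM p w) := by
  induction w using forms_induction with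
  | h0 => simp
  | hadd x y hx hy => simp only [map_add, smul_add, hx, hy]
  | h a t => simp [tauI_mul_apply hX, TensorProduct.tmul_smul]

/-- An operator placed to the right of the `m` inputs of `f` slides past `f` and ends up to the
right of its `p` outputs, with the Koszul sign of the exchange. -/
theorem op_mul_bc_tauI {m p : ℕ} (f : Cochain k A m p) {X : TEnd k A} {d : ℤ}
    (hX : conj X = sgn k d • X) :
    op f * bc (tauI m X) = sgn k ((m - p) * d) • (bc (tauI p X) * op f) := by
  refine MEnd.ext_mul m (fun N hN z => ?_) fun x y => ?_
  · simp [tauI_of_lt X hN, op_of_lt f hN]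
  · rw [MEnd.mul_apply, bc_tmul, tauI_mul_apply hX, TensorProduct.tmul_smul,
      MEnd.map_smul_of_field, op_mul, MEnd.smul_apply, MEnd.mul_apply, op_mul, one_smul, one_smul,
      bc_tauI_rmul_inM hX, smul_smul, ← sgn_add]
    congr 2
    ring

theorem conj_fr {X : TEnd k A} {d : ℤ} (hX : conj X = sgn k d • X) :
    conj (fr X) = sgn k d • fr X := by
  rw [← fr_conj, hX, map_smul]

/-- The graded commutator of an operator `f ⊗ id` and `∑ i, id^{⊗i} ⊗ X` is a finite sum. -/
theorem op_comm_fr {m p : ℕ} (f : Cochain k A m p) {X : TEnd k A} {d : ℤ}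
    (hX : conj X = sgn k d • X) :
    op f * bc (fr X) - sgn k ((m - p) * d) • (bc (fr X) * op f) =
      ∑ i ∈ Finset.range m, op f * bc (tauI i X) -
        sgn k ((m - p) * d) • ∑ i ∈ Finset.range p, bc (tauI i X) * op f := by
  -- The sum is cut at `m` before `f` and at `p` after `f`; the two remainders are matched by
  -- `op_mul_bc_tauI` and cancel.
  conv_lhs => enter [1]; rw [fr_eq_sum_tauI X m]
  conv_lhs => enter [2]; rw [fr_eq_sum_tauI X p]
  rw [map_add, map_add, mul_add, add_mul, op_mul_bc_tauI f (conj_fr hX), smul_add, map_sum, map_sum,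
    show op f * ∑ i ∈ Finset.range m, bc (tauI i X) = _ from Finset.mul_sum _ _ _,
    show (∑ i ∈ Finset.range p, bc (tauI i X)) * op f = _ from Finset.sum_mul _ _ _]
  abel

/-! ### Operators that vanish in large degrees -/

variable (k A) in
/-- The elements of degree at least `N` in `T(Ā)`. -/
def TT.filt (N : ℕ) : Submodule k (TT k A) :=
  ⨆ (n : ℕ) (_ : N ≤ n), LinearMap.range (inc (k := k) (A := A) n)

theorem inc_mem_filt {N n : ℕ} (h : N ≤ n) (z : Tens k (Bar k A) n) : inc n z ∈ TT.filt k A N :=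
  Submodule.mem_iSup_of_mem n (Submodule.mem_iSup_of_mem h ⟨z, rfl⟩)

theorem TT.filt_le {N : ℕ} {S : Submodule k (TT k A)}
    (h : ∀ n, N ≤ n → ∀ z : Tens k (Bar k A) n, inc n z ∈ S) : TT.filt k A N ≤ S := by
  refine iSup_le fun n => iSup_le fun hn => ?_
  rintro _ ⟨z, rfl⟩
  exact h n hn z

theorem TT.filt_anti {M N : ℕ} (h : M ≤ N) : TT.filt k A N ≤ TT.filt k A M :=
  TT.filt_le fun _ hn z => inc_mem_filt (h.trans hn) z

theorem TT.filt_zero : TT.filt k A 0 = ⊤ := by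
  rw [← Submodule.ker_mkQ (TT.filt k A 0), LinearMap.ker_eq_top]
  refine TT.hom_ext fun n z => ?_
  rw [Submodule.mkQ_apply, LinearMap.zero_apply, Submodule.Quotient.mk_eq_zero]
  exact inc_mem_filt (Nat.zero_le n) z

variable (k A) in
/-- The elements of degree at least `N` in `A ⊗ T(Ā)`. -/
def MM.filt (N : ℕ) : Submodule k (MM k A) :=
  ⨆ (n : ℕ) (_ : N ≤ n), LinearMap.range (inM (k := k) (A := A) n)

theorem inM_mem_filt {N n : ℕ} (h : N ≤ n) (z : Omega k A n) : inM n z ∈ MM.filt k A N :=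
  Submodule.mem_iSup_of_mem n (Submodule.mem_iSup_of_mem h ⟨z, rfl⟩)

theorem tmul_inc_mem_filt {N n : ℕ} (h : N ≤ n) (a : A) (z : Tens k (Bar k A) n) :
    a ⊗ₜ inc n z ∈ MM.filt k A N := by
  rw [← inM_forms]
  exact inM_mem_filt h _

theorem MM.filt_le {N : ℕ} {S : Submodule k (MM k A)}
    (h : ∀ n, N ≤ n → ∀ (a : A) (z : Tens k (Bar k A) n), a ⊗ₜ inc n z ∈ S) :
    MM.filt k A N ≤ S := by
  refine iSup_le fun n => iSup_le fun hn => ?_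
  rintro _ ⟨z, rfl⟩
  induction z using forms_induction with
  | h0 => simp
  | hadd x y hx hy => rw [map_add]; exact add_mem hx hy
  | h b t => rw [inM_forms]; exact h n hn b t

theorem MM.filt_anti {M N : ℕ} (h : M ≤ N) : MM.filt k A N ≤ MM.filt k A M :=
  MM.filt_le fun _ hn a z => tmul_inc_mem_filt (h.trans hn) a z

theorem tmul_mem_filt {N : ℕ} {t : TT k A} (ht : t ∈ TT.filt k A N) (a : A) :
    a ⊗ₜ t ∈ MM.filt k A N :=
  TT.filt_le (S := (MM.filt k A N).comap (TensorProduct.mk k A _ a))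
    (fun _ hn z => tmul_inc_mem_filt hn a z) ht

theorem smul_mem_filt {N : ℕ} {m : MM k A} (hm : m ∈ MM.filt k A N) (a : A) :
    a • m ∈ MM.filt k A N :=
  MM.filt_le (S := (MM.filt k A N).comap (Algebra.lsmul k k (MM k A) a))
    (fun n hn b z => by
      simp only [Submodule.mem_comap, Algebra.lsmul_coe, TensorProduct.smul_tmul']
      exact tmul_inc_mem_filt hn _ z) hm

theorem projM_mem_filt {N : ℕ} {m : MM k A} (hm : m ∈ MM.filt k A N) :
    projM m ∈ TT.filt k A (N + 1) :=
  MM.filt_le (S := (TT.filt k A (N + 1)).comap projM)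
    (fun n hn a z => by
      simp only [Submodule.mem_comap, projM_tmul]
      rw [← inc_tensOne, ← inc_concat (add_comm 1 n)]
      exact inc_mem_filt (by omega) _) hm

theorem eps_mem_filt {N : ℕ} {t : TT k A} (ht : t ∈ TT.filt k A N) : eps t ∈ TT.filt k A N :=
  TT.filt_le (S := (TT.filt k A N).comap eps.toLinearMap)
    (fun n hn z => by
      simp only [Submodule.mem_comap, AlgHom.toLinearMap_apply, eps_inc]
      exact Submodule.smul_mem _ _ (inc_mem_filt hn z)) ht

theorem ι_mul_mem_filt {N : ℕ} {t : TT k A} (ht : t ∈ TT.filt k A N) (v : Bar k A) :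
    TensorAlgebra.ι k v * t ∈ TT.filt k A (N + 1) :=
  TT.filt_le (S := (TT.filt k A (N + 1)).comap (LinearMap.mulLeft k (TensorAlgebra.ι k v)))
    (fun n hn z => by
      simp only [Submodule.mem_comap, LinearMap.mulLeft_apply]
      rw [← inc_tensOne, ← inc_concat (add_comm 1 n)]
      exact inc_mem_filt (by omega) _) ht

variable (k A) in
/-- The operators on `T(Ā)` that vanish in large degrees. -/
def TEv : Submodule k (TEnd k A) where
  carrier := {X | ∃ N, ∀ t ∈ TT.filt k A N, X t = 0}
  add_mem' := by
    rintro X Y ⟨M, hM⟩ ⟨N, hN⟩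
    refine ⟨max M N, fun t ht => ?_⟩
    rw [TEnd.add_apply, hM t (TT.filt_anti (le_max_left M N) ht),
      hN t (TT.filt_anti (le_max_right M N) ht), add_zero]
  zero_mem' := ⟨0, fun _ _ => rfl⟩
  smul_mem' := by
    rintro c X ⟨M, hM⟩
    exact ⟨M, fun t ht => by rw [TEnd.smul_apply, hM t ht, smul_zero]⟩

variable (k A) in
/-- The operators on `A ⊗ T(Ā)` that vanish in large degrees. -/
def Ev : Submodule k (MEnd k A) where
  carrier := {Z | ∃ N, ∀ m ∈ MM.filt k A N, Z m = 0}
  add_mem' := by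
    rintro X Y ⟨M, hM⟩ ⟨N, hN⟩
    refine ⟨max M N, fun t ht => ?_⟩
    rw [MEnd.add_apply, hM t (MM.filt_anti (le_max_left M N) ht),
      hN t (MM.filt_anti (le_max_right M N) ht), add_zero]
  zero_mem' := ⟨0, fun _ _ => rfl⟩
  smul_mem' := by
    rintro c X ⟨M, hM⟩
    exact ⟨M, fun t ht => by rw [MEnd.smul_apply, hM t ht, smul_zero]⟩

theorem mem_TEv {X : TEnd k A} (N : ℕ) (h : ∀ n, N ≤ n → ∀ z, X (inc n z) = 0) : X ∈ TEv k A :=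
  ⟨N, fun _ ht => TT.filt_le (S := LinearMap.ker (TEnd.toLin X)) (fun n hn z => h n hn z) ht⟩

theorem mem_Ev {Z : MEnd k A} (N : ℕ) (h : ∀ n, N ≤ n → ∀ z, Z (1 ⊗ₜ inc n z) = 0) :
    Z ∈ Ev k A :=
  ⟨N, fun _ hm => MM.filt_le (S := LinearMap.ker (MEnd.toLin Z)) (fun n hn a z => by
    have : a ⊗ₜ[k] inc n z = a • ((1 : A) ⊗ₜ[k] inc n z) := by simp [TensorProduct.smul_tmul']
    rw [LinearMap.mem_ker, MEnd.toLin_apply, this, map_smul, h n hn, smul_zero]) hm⟩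

theorem mem_Ev_of_mul {Z : MEnd k A} (N : ℕ) (h : ∀ x y, Z (1 ⊗ₜ (inc N x * y)) = 0) :
    Z ∈ Ev k A := by
  refine mem_Ev N fun n hn z => ?_
  induction z using concat_induction (show N + (n - N) = n by omega) with
  | h0 => simp
  | hadd x y hx hy => simp only [map_add, TensorProduct.tmul_add, hx, hy, add_zero]
  | H x y => rw [inc_concat, h]

theorem mul_mem_Ev (Y : MEnd k A) {Z : MEnd k A} (hZ : Z ∈ Ev k A) : Y * Z ∈ Ev k A := by
  obtain ⟨N, h⟩ := hZ
  exact ⟨N, fun m hm => by rw [MEnd.mul_apply, h m hm, map_zero]⟩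

theorem mul_mem_TEv (Y : TEnd k A) {X : TEnd k A} (hX : X ∈ TEv k A) : Y * X ∈ TEv k A := by
  obtain ⟨N, h⟩ := hX
  exact ⟨N, fun m hm => by rw [TEnd.mul_apply, h m hm, map_zero]⟩

theorem bc_mem_Ev {X : TEnd k A} (hX : X ∈ TEv k A) : bc X ∈ Ev k A := by
  obtain ⟨N, h⟩ := hX
  refine mem_Ev N fun n hn z => ?_
  rw [bc_tmul, h _ (inc_mem_filt hn z), TensorProduct.tmul_zero]

theorem shade_mem_TEv {Z : MEnd k A} (hZ : Z ∈ Ev k A) : shade Z ∈ TEv k A := by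
  obtain ⟨N, h⟩ := hZ
  refine mem_TEv N fun n hn z => ?_
  rw [shade_apply, h _ (tmul_inc_mem_filt hn _ z), map_zero]

theorem tau_mem_TEv {X : TEnd k A} (hX : X ∈ TEv k A) : tau X ∈ TEv k A := by
  obtain ⟨N, h⟩ := hX
  refine mem_TEv (N + 1) fun n hn z => ?_
  obtain ⟨n, rfl⟩ : ∃ n', n = n' + 1 := ⟨n - 1, by omega⟩
  induction z using concat_induction (add_comm 1 n) with
  | h0 => simp
  | hadd x y hx hy => simp only [map_add, hx, hy, add_zero]
  | H s x =>
    obtain ⟨v, rfl⟩ := tensOne.surjective s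
    rw [inc_concat, inc_tensOne, tau_ι_mul, conj_apply, h _ (eps_mem_filt (inc_mem_filt _ x)),
      map_zero, mul_zero]
    omega

theorem tauI_mem_TEv (i : ℕ) {X : TEnd k A} (hX : X ∈ TEv k A) : tauI i X ∈ TEv k A := by
  induction i with
  | zero => exact hX
  | succ i ih => rw [tauI_succ]; exact tau_mem_TEv ih

variable (k A) in
/-- The operators on `A ⊗ T(Ā)` that lower the degree by a bounded amount. -/
def Bdd : Subalgebra k (MEnd k A) where
  carrier := {Z | ∃ d, ∀ N, ∀ m ∈ MM.filt k A (N + d), Z m ∈ MM.filt k A N}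
  mul_mem' := by
    rintro X Y ⟨d, hd⟩ ⟨e, he⟩
    exact ⟨d + e, fun N m hm => hd N _ (he (N + d) m (by rwa [add_assoc]))⟩
  add_mem' := by
    rintro X Y ⟨d, hd⟩ ⟨e, he⟩
    exact ⟨max d e, fun N m hm => add_mem
      (hd N m (MM.filt_anti (by omega) hm)) (he N m (MM.filt_anti (by omega) hm))⟩
  algebraMap_mem' c := ⟨0, fun N m hm => by
    rw [Algebra.algebraMap_eq_smul_one]
    exact Submodule.smul_mem _ c hm⟩

theorem mem_Bdd {Z : MEnd k A} (d : ℕ)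
    (h : ∀ N, ∀ z : Tens k (Bar k A) (N + d), Z (1 ⊗ₜ inc (N + d) z) ∈ MM.filt k A N) :
    Z ∈ Bdd k A :=
  ⟨d, fun N _ hm => MM.filt_le (S := (MM.filt k A N).comap (MEnd.toLin Z)) (fun n hn a z => by
    obtain ⟨n, rfl⟩ : ∃ n', n = n' + d := ⟨n - d, by omega⟩
    have : a ⊗ₜ[k] inc (n + d) z = a • ((1 : A) ⊗ₜ[k] inc (n + d) z) := by
      simp [TensorProduct.smul_tmul']
    rw [Submodule.mem_comap, MEnd.toLin_apply, this, map_smul]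
    exact smul_mem_filt (MM.filt_anti (by omega) (h n z)) a) hm⟩

/-- Boundedness enters here: `Y` keeps large degrees large, so that `Z` still kills the result. This
makes the ideal of the germ algebra two-sided. -/
theorem mem_Ev_mul {Z Y : MEnd k A} (hZ : Z ∈ Ev k A) (hY : Y ∈ Bdd k A) : Z * Y ∈ Ev k A := by
  obtain ⟨N, h⟩ := hZ
  obtain ⟨d, hd⟩ := hY
  exact ⟨N + d, fun m hm => by rw [MEnd.mul_apply, h _ (hd N m hm)]⟩

theorem op_mem_Bdd {m p : ℕ} (f : Cochain k A m p) : op f ∈ Bdd k A := by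
  refine mem_Bdd m fun N z => ?_
  induction z using concat_induction (add_comm m N) with
  | h0 => simp
  | hadd x y hx hy => simp only [map_add, TensorProduct.tmul_add]; exact add_mem hx hy
  | H x y =>
    rw [inc_concat, op_mul, one_smul, ← inM_append rfl]
    exact inM_mem_filt (by omega) _

theorem tau_apply_mem_filt {X : TEnd k A} {N n : ℕ}
    (h : ∀ t ∈ TT.filt k A n, X t ∈ TT.filt k A N) :
    ∀ t ∈ TT.filt k A (n + 1), tau X t ∈ TT.filt k A (N + 1) := fun _ ht =>
  TT.filt_le (S := (TT.filt k A (N + 1)).comap (TEnd.toLin (tau X))) (fun r hr z => by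
    obtain ⟨r, rfl⟩ : ∃ r', r = r' + 1 := ⟨r - 1, by omega⟩
    rw [Submodule.mem_comap, TEnd.toLin_apply]
    induction z using concat_induction (add_comm 1 r) with
    | h0 => simp
    | hadd x y hx hy => simp only [map_add]; exact add_mem hx hy
    | H s x =>
      obtain ⟨v, rfl⟩ := tensOne.surjective s
      rw [inc_concat, inc_tensOne, tau_ι_mul, conj_apply]
      exact ι_mul_mem_filt (eps_mem_filt (h _ (eps_mem_filt (inc_mem_filt (by omega) x)))) v) ht

theorem tauI_apply_mem_filt {X : TEnd k A} {d : ℕ}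
    (h : ∀ N, ∀ t ∈ TT.filt k A (N + d), X t ∈ TT.filt k A N) (i : ℕ) :
    ∀ N, ∀ t ∈ TT.filt k A (N + d), tauI i X t ∈ TT.filt k A N := by
  induction i with
  | zero => exact h
  | succ i ih =>
    rintro (_ | N) t ht
    · rw [TT.filt_zero]; trivial
    · rw [tauI_succ]
      exact tau_apply_mem_filt (ih N) t (by rwa [add_right_comm] at ht)

/-- Insertion further to the right lowers the degree by the same amount, so the bound `d` survives
the infinite sum. The recursion for `fr` reduces `N + 1` to `N`. -/
theorem fr_apply_mem_filt {X : TEnd k A} {d : ℕ}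
    (h : ∀ N, ∀ t ∈ TT.filt k A (N + d), X t ∈ TT.filt k A N) :
    ∀ N, ∀ t ∈ TT.filt k A (N + d), fr X t ∈ TT.filt k A N := by
  intro N
  induction N with
  | zero => intro t _; rw [TT.filt_zero]; trivial
  | succ N ih =>
    intro t ht
    rw [fr_eq, TEnd.add_apply]
    exact add_mem (h (N + 1) t ht) (tau_apply_mem_filt ih t (by rwa [add_right_comm] at ht))

theorem bc_mem_Bdd {X : TEnd k A} {d : ℕ}
    (h : ∀ N, ∀ t ∈ TT.filt k A (N + d), X t ∈ TT.filt k A N) : bc X ∈ Bdd k A :=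
  mem_Bdd d fun N z => tmul_mem_filt (h N _ (inc_mem_filt le_rfl z)) 1

theorem shade_apply_mem_filt {Z : MEnd k A} {d : ℕ}
    (h : ∀ N, ∀ m ∈ MM.filt k A (N + d), Z m ∈ MM.filt k A N) :
    ∀ N, ∀ t ∈ TT.filt k A (N + d), shade Z t ∈ TT.filt k A N := fun N t ht =>
  TT.filt_anti (Nat.le_succ N) (projM_mem_filt (h N _ (tmul_mem_filt ht 1)))

theorem ins_mem_Bdd {Z : MEnd k A} (hZ : Z ∈ Bdd k A) : ins Z ∈ Bdd k A := by
  obtain ⟨d, h⟩ := hZ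
  exact bc_mem_Bdd (fr_apply_mem_filt (shade_apply_mem_filt h))

theorem bc_fr_mem_Bdd {X : TEnd k A} (hX : X ∈ TEv k A) : bc (fr X) ∈ Bdd k A := by
  obtain ⟨d, h⟩ := hX
  exact bc_mem_Bdd (fr_apply_mem_filt (d := d) fun N t ht => by
    rw [h t (TT.filt_anti (by omega) ht)]; exact zero_mem _)

theorem bc_tauI_shade_mem_Bdd (i : ℕ) {Z : MEnd k A} (hZ : Z ∈ Bdd k A) :
    bc (tauI i (shade Z)) ∈ Bdd k A := by
  obtain ⟨d, h⟩ := hZ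
  exact bc_mem_Bdd (tauI_apply_mem_filt (shade_apply_mem_filt h) i)

/-- If `Z` lowers degrees by at most `d`, then in degrees at least `1 + d` its output has positive
tensor degree and is killed by `scal`. Hence the error in `bdry_mul_ins` is a tail. -/
theorem scal_kap_mem_TEv {Z : MEnd k A} (hZ : Z ∈ Bdd k A) : scal * kap Z ∈ TEv k A := by
  obtain ⟨d, h⟩ := hZ
  have key : ∀ m ∈ MM.filt k A 1, scal (TensorProduct.lid k _ ((counit k A).rTensor _ m)) = 0 :=
    fun m hm => MM.filt_le (S := LinearMap.ker (TEnd.toLin scal ∘ₗ (TensorProduct.lid k _).toLinearMap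
      ∘ₗ (counit k A).rTensor _)) (fun n hn a z => by
        obtain ⟨n, rfl⟩ : ∃ n', n = n' + 1 := ⟨n - 1, by omega⟩
        simp only [LinearMap.mem_ker, LinearMap.comp_apply, LinearMap.rTensor_tmul,
          LinearEquiv.coe_coe, TensorProduct.lid_tmul, TEnd.toLin_apply, map_smul]
        induction z using concat_induction (add_comm 1 n) with
        | h0 => simp
        | hadd x y hx hy => simp only [map_add, smul_add, hx, hy, add_zero]
        | H s x =>
          obtain ⟨v, rfl⟩ := tensOne.surjective s
          rw [inc_concat, inc_tensOne, scal_ι_mul, smul_zero]) hm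
  refine mem_TEv (1 + d) fun n hn z => ?_
  rw [TEnd.mul_apply, kap_apply]
  exact key _ (h 1 _ (tmul_inc_mem_filt hn _ z))

end Germs

/-! ### The algebra of germs; products and differential as commutators -/

section GermRing

variable (k : Type u) [Field k] (A : Type v) [Ring A] [Algebra k A]

/-- The bounded operators that vanish in large degrees. -/
def evIdeal : Ideal (Bdd k A) where
  carrier := {Z | (Z : MEnd k A) ∈ Ev k A}
  add_mem' hZ hW := add_mem (S := Submodule k (MEnd k A)) (s := Ev k A) hZ hW
  zero_mem' := zero_mem (Ev k A)
  smul_mem' Y _ hZ := mul_mem_Ev (Y : MEnd k A) hZ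

instance : (evIdeal k A).IsTwoSided := ⟨fun {_} Y hZ => mem_Ev_mul hZ Y.2⟩

/-- The algebra of germs of bounded operators on `A ⊗ T(Ā)`, in large degrees. -/
def Germ : Type (max u v) := Bdd k A ⧸ evIdeal k A

/-- The ring structure of `Germ k A`. -/
def Germ.ring : Ring (Germ k A) := (inferInstance : Ring (Bdd k A ⧸ evIdeal k A))

instance : Ring (Germ k A) := Germ.ring k A
instance : Algebra k (Germ k A) := (inferInstance : Algebra k (Bdd k A ⧸ evIdeal k A))

variable {k A}

/-- The germ of a bounded operator. -/
def germ : Bdd k A →ₐ[k] Germ k A := Ideal.Quotient.mkₐ k (evIdeal k A)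

theorem germ_eq_iff {Z W : Bdd k A} : germ Z = germ W ↔ (Z - W : MEnd k A) ∈ Ev k A :=
  Ideal.Quotient.mk_eq_mk_iff_sub_mem Z W

theorem germ_eq_zero_iff {Z : Bdd k A} : germ Z = 0 ↔ (Z : MEnd k A) ∈ Ev k A :=
  Ideal.Quotient.eq_zero_iff_mem

/-- The operator `f ⊗ id` as a bounded operator. -/
def opB {m p : ℕ} : Cochain k A m p →ₗ[k] Bdd k A :=
  op.codRestrict (Subalgebra.toSubmodule (Bdd k A)) op_mem_Bdd

theorem shade_opB {m p : ℕ} (f : Cochain k A m p) :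
    shade (opB f : MEnd k A) = opT (projOmega p ∘ₗ f) := shade_op f

@[simp] theorem coe_opB {m p : ℕ} (f : Cochain k A m p) : (opB f : MEnd k A) = op f := rfl

/-- The operator `∑ i, id^{⊗i} ⊗ Z̄` as a bounded operator. -/
def insB : Bdd k A →ₗ[k] Bdd k A where
  toFun Z := ⟨ins Z, ins_mem_Bdd Z.2⟩
  map_add' _ _ := Subtype.ext (map_add ins _ _)
  map_smul' _ _ := Subtype.ext (map_smul ins _ _)

@[simp] theorem coe_insB (Z : Bdd k A) : (insB Z : MEnd k A) = ins Z := rfl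

/-- The operator `id^{⊗i} ⊗ Z̄` as a bounded operator. -/
def insAt (i : ℕ) : Bdd k A →ₗ[k] Bdd k A where
  toFun Z := ⟨bc (tauI i (shade Z)), bc_tauI_shade_mem_Bdd i Z.2⟩
  map_add' Z W := Subtype.ext (by simp)
  map_smul' c Z := Subtype.ext (by simp)

@[simp] theorem coe_insAt (i : ℕ) (Z : Bdd k A) :
    (insAt i Z : MEnd k A) = bc (tauI i (shade Z)) := rfl

/-- An insertion at one fixed place depends only on the germ. This fails for the sum over all
places, since insertions arbitrarily far to the right still see the low degrees of `Z`. -/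
theorem germ_insAt_congr (i : ℕ) {Z W : Bdd k A} (h : germ Z = germ W) :
    germ (insAt i Z) = germ (insAt i W) := by
  rw [germ_eq_iff] at h ⊢
  rw [coe_insAt, coe_insAt, ← map_sub, ← map_sub, ← map_sub]
  exact bc_mem_Ev (tauI_mem_TEv i (shade_mem_TEv h))

theorem germ_opB_eq {m p n q N : ℕ} {f : Cochain k A m p} {g : Cochain k A n q}
    (h : ∀ (x : Tens k (Bar k A) N) y,
      op f (1 ⊗ₜ (inc N x * y)) = op g (1 ⊗ₜ (inc N x * y))) : germ (opB f) = germ (opB g) :=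
  germ_eq_iff.2 (mem_Ev_of_mul N fun x y => by simp [h])

/-- The extra strands act as the identity, so the two operators differ only on degrees below `m +
r`. Thus germs are constant along the colimit. -/
theorem germ_opB_extend {m p M P r : ℕ} (hM : m + r = M) (hP : p + r = P)
    (f : Cochain k A m p) : germ (opB (extend r hM hP f)) = germ (opB f) := by
  refine germ_opB_eq (N := M) fun x y => ?_
  rw [op_mul]
  induction x using concat_induction hM with
  | h0 => simp
  | hadd x y hx hy => simp only [map_add, add_mul, smul_add, TensorProduct.tmul_add, hx, hy]
  | H s t => rw [inc_concat, mul_assoc, op_mul, extend_concat, inM_append, rmul_rmul]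

theorem germ_opB_theta {m p : ℕ} (f : Cochain k A m p) : germ (opB (theta f)) = germ (opB f) :=
  germ_opB_extend rfl rfl f

theorem tauI_opT_mul {a b n q N N' : ℕ} (hN : a + n + b = N) (hN' : a + q + b = N')
    (h : Tens k (Bar k A) n →ₗ[k] Tens k (Bar k A) q) (z : Tens k (Bar k A) N) (w : TT k A) :
    tauI a (opT h) (inc N z * w) =
      sgn k (a * (n - q)) • (inc N' (whisker a b hN hN' h z) * w) := by
  induction z using concat_induction hN with
  | h0 => simp
  | hadd x y hx hy => simp only [map_add, add_mul, smul_add, hx, hy]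
  | H s z =>
    induction s using concat_induction (rfl : a + n = _) with
    | h0 => simp
    | hadd x y hx hy =>
      simp only [map_add, add_mul, smul_add, TensorProduct.add_tmul, hx, hy]
    | H x y =>
      rw [whisker_concat a b hN hN' h rfl hN rfl hN', inc_concat, inc_concat, inc_concat,
        inc_concat, mul_assoc, mul_assoc, tauI_mul_apply (conj_opT h), opT_mul, mul_assoc,
        mul_assoc]

/-- `whisker` is formed without signs, while `tauI` carries the Koszul sign of passing `a` factors;
this accounts for the coefficient. -/
theorem germ_opB_comp_whisker {a b n q N N' P : ℕ} (hN : a + n + b = N) (hN' : a + q + b = N')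
    (h : Tens k (Bar k A) n →ₗ[k] Tens k (Bar k A) q) (F : Cochain k A N' P) {Z : Bdd k A}
    (hZ : shade (Z : MEnd k A) = opT h) : germ (opB (F ∘ₗ whisker a b hN hN' h)) =
      sgn k (a * (n - q)) • (germ (opB F) * germ (insAt a Z)) := by
  rw [← map_mul, ← map_smul]
  refine germ_eq_iff.2 (mem_Ev_of_mul N fun x y => ?_)
  simp only [coe_opB, SetLike.val_smul, MulMemClass.coe_mul, coe_insAt, hZ, MEnd.sub_apply,
    MEnd.smul_apply, MEnd.mul_apply, bc_tmul]
  rw [tauI_opT_mul hN hN' h, TensorProduct.tmul_smul, MEnd.map_smul_of_field, smul_smul,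
    sgn_mul_self, one_smul, op_mul, op_mul, LinearMap.comp_apply, sub_self]

theorem bc_tauI_opT_rmul {a b n q N N' : ℕ} (hN : a + n + b = N) (hN' : a + q + b = N')
    (h : Tens k (Bar k A) n →ₗ[k] Tens k (Bar k A) q) (w : Omega k A N) (y : TT k A) :
    bc (tauI a (opT h)) (rmul y (inM N w)) =
      sgn k (a * (n - q)) • rmul y (inM N' (idTensor (whisker a b hN hN' h) w)) := by
  induction w using forms_induction with
  | h0 => simp
  | hadd x y hx hy => simp only [map_add, smul_add, hx, hy]
  | h c t =>
    rw [inM_forms, rmul_tmul, bc_tmul, tauI_opT_mul hN hN' h, idTensor_forms, inM_forms,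
      rmul_tmul, TensorProduct.tmul_smul]

theorem germ_opB_idTensor_whisker_comp {a b n q N N' M : ℕ} (hN : a + n + b = N)
    (hN' : a + q + b = N') (h : Tens k (Bar k A) n →ₗ[k] Tens k (Bar k A) q)
    (F : Cochain k A M N) {Z : Bdd k A} (hZ : shade (Z : MEnd k A) = opT h) :
    germ (opB (idTensor (whisker a b hN hN' h) ∘ₗ F)) =
      sgn k (a * (n - q)) • (germ (insAt a Z) * germ (opB F)) := by
  rw [← map_mul, ← map_smul]
  refine germ_eq_iff.2 (mem_Ev_of_mul M fun x y => ?_)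
  simp only [coe_opB, SetLike.val_smul, MulMemClass.coe_mul, coe_insAt, hZ, MEnd.sub_apply,
    MEnd.smul_apply, MEnd.mul_apply, op_mul, one_smul, LinearMap.comp_apply]
  rw [bc_tauI_opT_rmul hN hN' h, smul_smul, sgn_mul_self, one_smul, sub_self]

/-! ### The cup and circle products -/

theorem inM_leftMul {p : ℕ} (a : A) (w : Omega k A p) :
    inM p (leftMul p (a ⊗ₜ w)) = a • inM p w := by
  induction w using forms_induction with
  | h0 => simp
  | hadd x y hx hy => simp only [TensorProduct.tmul_add, map_add, smul_add, hx, hy]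
  | h c t => rw [leftMul_forms, inM_forms, inM_forms, TensorProduct.smul_tmul', smul_eq_mul]

theorem op_rmul_inM {m p q P : ℕ} (hP : p + q = P) (f : Cochain k A m p) (w : Omega k A (m + q))
    (y : TT k A) : op f (rmul y (inM (m + q) w)) =
      rmul y (inM P (leftMul P ((extend q rfl hP f).lTensor A ((forms (m + q)).symm w)))) := by
  induction w using forms_induction with
  | h0 => simp
  | hadd x y hx hy => simp only [map_add, hx, hy]
  | h a t =>
    rw [inM_forms, rmul_tmul, LinearEquiv.symm_apply_apply, LinearMap.lTensor_tmul, inM_leftMul,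
      map_smul]
    induction t using concat_induction (rfl : m + q = _) with
    | h0 => simp
    | hadd x y hx hy => simp only [map_add, add_mul, TensorProduct.tmul_add, smul_add, hx, hy]
    | H s t => rw [inc_concat, mul_assoc, op_mul, extend_concat, inM_append, rmul_rmul]

/-- The formula for `f ∪ g` lets `g` act on the first `n` factors, then `f` on the first `m` tensor
factors of the result, with the coefficient in `A` multiplied from the left. That is composition of
left linear operators. -/
theorem germ_opB_cup {m p n q M P : ℕ} (hM : n + m = M) (hP : p + q = P) (f : Cochain k A m p)
    (g : Cochain k A n q) :
    germ (opB (cup hM hP f g)) = germ (opB f) * germ (opB g) := by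
  rw [← map_mul]
  refine germ_eq_iff.2 (mem_Ev_of_mul M fun x y => ?_)
  simp only [coe_opB, MulMemClass.coe_mul, MEnd.sub_apply, MEnd.mul_apply]
  rw [op_mul, one_smul, sub_eq_zero]
  induction x using concat_induction hM with
  | h0 => simp
  | hadd x y hx hy => simp only [map_add, add_mul, TensorProduct.tmul_add, hx, hy]
  | H s t =>
    rw [inc_concat, mul_assoc, op_mul, one_smul, ← rmul_rmul, ← inM_append (add_comm q m),
      op_rmul_inM hP, cup_apply, LinearMap.comp_apply, LinearMap.comp_apply, LinearMap.comp_apply,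
      extend_concat]
    rfl

theorem germ_opB_circIn {m p n q M P : ℕ} (hM : m + n - 1 = M) (hP : p + q = P) (i : Fin m)
    (f : Cochain k A m p) (g : Cochain k A n q) :
    germ (opB (circIn hM hP i f g)) =
      sgn k (i * (n - (q + 1 : ℕ))) • (germ (opB f) * germ (insAt i (opB g))) := by
  rw [circIn_apply, germ_opB_comp_whisker _ _ _ _ (shade_opB g), germ_opB_extend]

theorem germ_opB_circOut {m p n q M P : ℕ} (hM : m + n = M) (hP : p + q = P) (i : Fin p)
    (f : Cochain k A m p) (g : Cochain k A (n + 1) q) :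
    germ (opB (circOut hM hP i f g)) =
      sgn k (i * ((n + 1 : ℕ) - (q + 1 : ℕ))) • (germ (insAt i (opB g)) * germ (opB f)) := by
  rw [circOut_apply, germ_opB_idTensor_whisker_comp _ _ _ _ (shade_opB g), germ_opB_extend]

/-- A bounded operator of parity `d`. -/
def HasParity (d : ℤ) (Z : Bdd k A) : Prop := conjM (Z : MEnd k A) = sgn k d • (Z : MEnd k A)

theorem HasParity.opB {m p : ℕ} (f : Cochain k A m p) : HasParity (m - p) (opB f) := conjM_op f

theorem HasParity.conj_shade {d : ℤ} {Z : Bdd k A} (h : HasParity d Z) :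
    conj (shade (Z : MEnd k A)) = sgn k (d - 1) • shade (Z : MEnd k A) := by
  have := shade_conjM (Z : MEnd k A)
  rw [h, map_smul, eq_neg_iff_add_eq_zero, add_comm, ← eq_neg_iff_add_eq_zero] at this
  rw [this, show sgn k (d - 1) = -sgn k d by rw [← sgn_succ]; exact sgn_congr ⟨-1, by ring⟩]
  exact (neg_smul _ _).symm

/-- The graded commutator of `f` and `∑ i, id^{⊗i} ⊗ Z̄`. -/
theorem opB_mul_insB_sub {m p : ℕ} (f : Cochain k A m p) {d : ℤ} {Z : Bdd k A}
    (h : HasParity d Z) :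
    opB f * insB Z - sgn k ((m - p) * (d - 1)) • (insB Z * opB f) =
      ∑ i ∈ Finset.range m, opB f * insAt i Z -
        sgn k ((m - p) * (d - 1)) • ∑ i ∈ Finset.range p, insAt i Z * opB f :=
  Subtype.ext (by
    have := op_comm_fr f h.conj_shade
    simpa [ins_apply] using this)

/-- The germ of `insB Z` depends on the lift `Z`, but its commutator with a cochain is a finite sum
of insertions at fixed places, and those depend only on the germ of `Z`. -/
theorem germ_commutator_insB_congr {m p : ℕ} (f : Cochain k A m p) {d : ℤ} {Z W : Bdd k A}
    (hZ : HasParity d Z) (hW : HasParity d W) (h : germ Z = germ W) :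
    germ (opB f) * germ (insB Z) - sgn k ((m - p) * (d - 1)) • (germ (insB Z) * germ (opB f)) =
    germ (opB f) * germ (insB W) - sgn k ((m - p) * (d - 1)) • (germ (insB W) * germ (opB f)) := by
  have h1 := congrArg germ (opB_mul_insB_sub f hZ)
  have h2 := congrArg germ (opB_mul_insB_sub f hW)
  simp only [map_sub, map_mul, map_smul, map_sum] at h1 h2
  rw [h1, h2]
  simp only [germ_insAt_congr _ h]

/-- In the finite form of the commutator, insertions before `f` are the `f ∘_i g` with `i > 0` and
insertions after `f` are the `f ∘_{-i} g`. This explains the two sums and their signs in the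
definition. -/
theorem germ_opB_circ {m p n q M P : ℕ} (hM : m + n = M) (hP : p + q = P)
    (f : Cochain k A m p) (g : Cochain k A (n + 1) q) :
    germ (opB (circ hM hP f g)) = germ (opB f) * germ (insB (opB g)) -
      sgn k ((m - p) * (n - q)) • (germ (insB (opB g)) * germ (opB f)) := by
  have h1 := congrArg germ (opB_mul_insB_sub f (HasParity.opB g))
  simp only [map_sub, map_mul, map_smul, map_sum] at h1
  rw [show ((n + 1 : ℕ) - q - 1 : ℤ) = n - q by push_cast; ring] at h1
  rw [h1, circ_apply, map_sub, map_sub, map_sum, map_sum, map_sum, map_sum, Finset.sum_range,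
    Finset.sum_range, Finset.smul_sum]
  congr 1
  · refine Finset.sum_congr rfl fun i _ => ?_
    rw [map_smul, map_smul, germ_opB_circIn, smul_smul, ← sgn_add]
    -- The sign in the definition of `circ` cancels the Koszul sign of the insertion.
    convert one_smul k _
    rw [← sgn_zero]
    exact sgn_congr ⟨(n - q) * i, by push_cast; ring⟩
  · refine Finset.sum_congr rfl fun i _ => ?_
    rw [map_smul, map_smul, germ_opB_circOut, smul_smul, ← sgn_add]
    congr 1
    exact sgn_congr ⟨(n - q) * (i - m), by push_cast; ring⟩

/-! ### The differential -/

theorem liftOp_mem_Bdd : liftOp ∈ Bdd k A := by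
  refine mem_Bdd 1 fun N z => ?_
  induction z using concat_induction (add_comm 1 N) with
  | h0 => simp
  | hadd x y hx hy => simp only [map_add, TensorProduct.tmul_add]; exact add_mem hx hy
  | H s t =>
    obtain ⟨v, rfl⟩ := tensOne.surjective s
    rw [inc_concat, inc_tensOne, liftOp_ι_mul]
    exact tmul_inc_mem_filt le_rfl _ _

variable (k A) in
/-- The operator `liftOp` as a bounded operator. -/
def liftB : Bdd k A := ⟨liftOp, liftOp_mem_Bdd⟩

variable (k A) in
/-- The operator `bdry` as a bounded operator. -/
def bdryB : Bdd k A := liftB k A - insB (liftB k A * liftB k A)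

theorem parity_liftB_mul : HasParity 2 (liftB k A * liftB k A) := by
  change conjM (liftOp * liftOp) = _ • (liftOp * liftOp)
  rw [conjM_mul, conjM_liftOp, show sgn k 2 = 1 by simp [sgn]]
  simp

/-- Applying `liftOp` twice multiplies two lifts into the coefficient, and `π` returns their product
to `Ā`. So `ins (liftOp * liftOp)` is the signed sum of the inner multiplications, and `bdry` also
contains the multiplication into `A`. -/
theorem shade_liftB_mul :
    shade ((liftB k A * liftB k A : Bdd k A) : MEnd k A) = opT (barMul (lifts k A)) := by
  change shade (liftOp * liftOp) = _
  refine TEnd.ext_mul 2 (fun N hN z => ?_) fun x y => ?_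
  · rw [opT_of_lt _ hN, shade_apply, MEnd.mul_apply]
    obtain rfl | rfl : N = 0 ∨ N = 1 := by omega
    · induction z using tens_zero_induction with | h c => ?_
      simp [inc_unitTens]
    · obtain ⟨v, rfl⟩ := tensOne.surjective z
      have := liftOp_ι_mul (k := k) (1 : A) v 1
      rw [mul_one] at this
      rw [inc_tensOne, this, liftOp_one, map_zero]
  · rw [opT_mul, shade_apply, MEnd.mul_apply]
    induction x using concat_induction (rfl : 1 + 1 = 2) with
    | h0 => simp
    | hadd x y hx hy => simp only [map_add, add_mul, TensorProduct.tmul_add, hx, hy]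
    | H s t =>
      obtain ⟨v, rfl⟩ := tensOne.surjective s
      obtain ⟨w, rfl⟩ := tensOne.surjective t
      rw [inc_concat, inc_tensOne, inc_tensOne, mul_assoc, liftOp_ι_mul, liftOp_ι_mul, barMul_concat,
        inc_tensOne, projM_tmul, one_mul, LinearEquiv.symm_apply_apply, LinearEquiv.symm_apply_apply]

theorem germ_opB_leftAct {m p : ℕ} (f : Cochain k A m p) :
    germ (opB (leftAct (lifts k A) f)) = germ (opB f) * germ (liftB k A) := by
  rw [← map_mul]
  refine germ_eq_iff.2 (mem_Ev_of_mul (m + 1) fun x y => ?_)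
  change op _ _ - op f (liftOp _) = 0
  rw [op_mul, one_smul, sub_eq_zero]
  induction x using concat_induction (add_comm 1 m) with
  | h0 => simp
  | hadd x y hx hy => simp only [map_add, add_mul, TensorProduct.tmul_add, hx, hy]
  | H s t =>
    obtain ⟨v, rfl⟩ := tensOne.surjective s
    rw [leftAct_concat, inM_leftMul, map_smul, LinearEquiv.symm_apply_apply, inc_concat,
      inc_tensOne, mul_assoc, liftOp_ι_mul, op_mul, one_mul]

theorem liftOp_rmul_inM {p : ℕ} (w : Omega k A (p + 1)) (y : TT k A) :
    liftOp (rmul y (inM (p + 1) w)) = rmul y (inM p (mulFirst (lifts k A) p w)) := by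
  induction w using forms_induction with
  | h0 => simp
  | hadd x y hx hy => simp only [map_add, hx, hy]
  | h a t =>
    induction t using concat_induction (add_comm 1 p) with
    | h0 => simp
    | hadd x y hx hy => simp only [map_add, TensorProduct.tmul_add, hx, hy]
    | H s t =>
      obtain ⟨v, rfl⟩ := tensOne.surjective s
      rw [inM_forms, rmul_tmul, inc_concat, inc_tensOne, mul_assoc, liftOp_ι_mul]
      simp [mulFirst, leftMul_forms]

theorem germ_opB_mulFirst {m p : ℕ} (f : Cochain k A m p) :
    germ (opB (mulFirst (lifts k A) p ∘ₗ theta f)) = germ (liftB k A) * germ (opB f) := by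
  -- `mulFirst` needs at least one tensor factor in the output, which `theta f` provides.
  rw [← germ_opB_theta f, ← map_mul]
  refine germ_eq_iff.2 (mem_Ev_of_mul (m + 1) fun x y => ?_)
  change op _ _ - liftOp (op (theta f) _) = 0
  rw [op_mul, op_mul, one_smul, one_smul, liftOp_rmul_inM, LinearMap.comp_apply, sub_self]

/-- The Hochschild differential is the graded commutator with `bdry`. -/
theorem germ_opB_hochschild {m p : ℕ} (f : Cochain k A m p) :
    germ (opB (hochschild (lifts k A) f)) = germ (bdryB k A) * germ (opB f) -
      sgn k (m - p) • (germ (opB f) * germ (bdryB k A)) := by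
  have h1 := congrArg germ (opB_mul_insB_sub f parity_liftB_mul)
  simp only [map_sub, map_mul, map_smul, map_sum] at h1
  rw [show ((m : ℤ) - p) * (2 - 1) = m - p by ring, sub_eq_iff_eq_add] at h1
  have e1 : ∀ j : Fin m, germ (opB (f ∘ₗ whisker (N := m + 1) (N' := m) j (m - 1 - j)
      (by omega) (by omega) (barMul (lifts k A)))) =
      sgn k j • (germ (opB f) * germ (insAt j (liftB k A * liftB k A))) := fun j => by
    rw [germ_opB_comp_whisker _ _ _ _ shade_liftB_mul]
    congr 2
    push_cast; ring
  have e2 : ∀ i : Fin p, germ (opB (idTensor (whisker (N := p + 1) (N' := p) i (p - 1 - i)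
      (by omega) (by omega) (barMul (lifts k A))) ∘ₗ theta f)) =
      sgn k i • (germ (insAt i (liftB k A * liftB k A)) * germ (opB f)) := fun j => by
    rw [germ_opB_idTensor_whisker_comp _ _ _ _ shade_liftB_mul, germ_opB_theta]
    congr 2
    push_cast; ring
  rw [hochschild_apply, rightAct]
  simp only [LinearMap.add_comp, LinearMap.smul_comp, sum_comp', map_add, map_sum, map_smul, e1, e2,
    germ_opB_leftAct, germ_opB_mulFirst, bdryB, map_sub, mul_sub, sub_mul, smul_add, smul_sub, h1,
    Finset.smul_sum, smul_smul, ← sgn_add, Finset.sum_range]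
  -- The signs of the Hochschild differential and of the right action, multiplied by the Koszul
  -- signs of the insertions, no longer depend on the position.
  have e3 : ∀ j : Fin m, sgn k ((m : ℤ) - p + 1 + (j + 1) + j) = sgn k (m - p) := fun j =>
    sgn_congr ⟨j + 1, by ring⟩
  have e4 : ∀ j : Fin p, sgn k ((m : ℤ) - p + 1 + (m + 1 + (p - (j + 1))) + j) = -1 := fun j => by
    rw [← sgn_zero (k := k), ← sgn_succ]
    exact sgn_congr ⟨m, by ring⟩
  have e5 : sgn k ((m : ℤ) - p + 1 + (m + 1 + p)) = 1 := by
    rw [← sgn_zero (k := k)]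
    exact sgn_congr ⟨m + 1, by ring⟩
  have e6 : sgn k ((m : ℤ) - p + (m - p)) = 1 := by
    rw [← sgn_zero (k := k)]
    exact sgn_congr ⟨m - p, by ring⟩
  simp only [e3, e4, e5, e6]
  simp only [sgn_succ, neg_smul, one_smul, Finset.sum_neg_distrib]
  abel

/-! ### Cochains with the same germ -/

theorem inM_injective (p : ℕ) : Function.Injective (inM (k := k) (A := A) p) := by
  let c : TT k A →ₗ[k] Tens k (Bar k A) p :=
    (DirectSum.component k ℕ (fun n => ⨂[k]^n (Bar k A)) p : _ →ₗ[k] ⨂[k]^p (Bar k A)) ∘ₗ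
      (TensorAlgebra.equivDirectSum (R := k) (M := Bar k A)).toLinearMap
  have hc : ∀ t, c (inc p t) = t := fun t => by
    change DirectSum.component k ℕ _ p (TensorAlgebra.equivDirectSum (inc p t)) = t
    rw [equivDirectSum_inc]
    exact DirectSum.component.lof_self k p t
  refine Function.LeftInverse.injective (g := (forms p).toLinearMap ∘ₗ c.lTensor A) fun w => ?_
  induction w using forms_induction with
  | h0 => simp
  | hadd x y hx hy => rw [map_add, map_add, hx, hy]
  | h a t => simp [hc]

/-- If `op f` vanishes from degree `N` on, then `N` additional strands already force `f ⊗ id` to be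
zero. Thus germs detect elements of the colimit. -/
theorem extend_eq_zero_of_op_mem_Ev {m p : ℕ} {f : Cochain k A m p} (h : op f ∈ Ev k A) :
    ∃ r, extend (k := k) (M := m + r) (P := p + r) r rfl rfl f = 0 := by
  obtain ⟨N, h⟩ := h
  refine ⟨N, LinearMap.ext fun x => ?_⟩
  induction x using concat_induction (rfl : m + N = _) with
  | h0 => simp
  | hadd x y hx hy => rw [map_add, hx, hy, map_add]
  | H s t =>
    refine inM_injective _ ?_
    rw [extend_concat, inM_append, LinearMap.zero_apply, map_zero]
    have := op_mul f 1 s (inc N t)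
    rw [one_smul] at this
    rw [← this, ← inc_concat rfl]
    exact h _ (tmul_inc_mem_filt (by omega) _ _)

end GermRing

/-! ### Parity of operators, tails, and the homotopy identity -/

section Parity

variable {k : Type u} [Field k] {A : Type v} [Ring A] [Algebra k A]

/-- Allows the longer sign identities below to be decided by cases on the parities of the degrees.
-/
theorem sgn_eq_ite (n : ℤ) : sgn k n = if Even n then 1 else -1 := by
  split_ifs with h
  · rw [← sgn_zero (k := k)]
    exact sgn_congr (by simpa using h)
  · rw [← sgn_zero (k := k), ← sgn_succ]
    exact sgn_congr (by
      rw [Int.not_even_iff_odd] at h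
      obtain ⟨a, rfl⟩ := h
      exact ⟨a, by ring⟩)

namespace HasParity

theorem congr {d e : ℤ} {Z : Bdd k A} (h : HasParity d Z) (hd : Even (d - e)) : HasParity e Z := by
  unfold HasParity at h ⊢
  rw [h, sgn_congr hd]

theorem mul {d e : ℤ} {Z W : Bdd k A} (hZ : HasParity d Z) (hW : HasParity e W) :
    HasParity (d + e) (Z * W) := by
  change conjM ((Z : MEnd k A) * (W : MEnd k A)) = _ • ((Z : MEnd k A) * (W : MEnd k A))
  rw [conjM_mul, hZ, hW, smul_mul_smul_comm, sgn_add]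

theorem add {d : ℤ} {Z W : Bdd k A} (hZ : HasParity d Z) (hW : HasParity d W) :
    HasParity d (Z + W) := by
  change conjM ((Z : MEnd k A) + (W : MEnd k A)) = _ • ((Z : MEnd k A) + (W : MEnd k A))
  rw [map_add, hZ, hW, smul_add]

theorem smul {d : ℤ} (c : k) {Z : Bdd k A} (hZ : HasParity d Z) : HasParity d (c • Z) := by
  change conjM (c • (Z : MEnd k A)) = _ • (c • (Z : MEnd k A))
  rw [map_smul, hZ, smul_comm]

theorem neg {d : ℤ} {Z : Bdd k A} (hZ : HasParity d Z) : HasParity d (-Z) := by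
  have := hZ.smul (-1)
  rwa [neg_one_smul] at this

theorem sub {d : ℤ} {Z W : Bdd k A} (hZ : HasParity d Z) (hW : HasParity d W) :
    HasParity d (Z - W) := by
  rw [sub_eq_add_neg]
  exact hZ.add hW.neg

theorem insB {d : ℤ} {Z : Bdd k A} (hZ : HasParity d Z) : HasParity (d - 1) (insB Z) := by
  change conjM (ins (Z : MEnd k A)) = _ • ins (Z : MEnd k A)
  rw [conjM_ins, hZ, map_smul, ← neg_smul, ← sgn_succ]
  congr 1
  exact sgn_congr ⟨1, by ring⟩

theorem bdryB : HasParity 1 (bdryB k A) := by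
  have h : HasParity (k := k) (A := A) 1 (liftB k A) := by
    change conjM liftOp = _ • liftOp
    rw [conjM_liftOp, show sgn k 1 = -1 by simp [sgn], neg_one_smul]
  exact h.sub ((h.mul h).insB.congr (by decide))

end HasParity

/-! ### Operators that act on the last tensor factors only -/

/-- The operator `R` is of the form `∑ i, id^{⊗i} ⊗ X`, where `X` vanishes in large degrees. -/
def IsTail (d : ℤ) (R : Bdd k A) : Prop :=
  ∃ X ∈ TEv k A, conj X = sgn k d • X ∧ (R : MEnd k A) = bc (fr X)

theorem IsTail.add {d : ℤ} {R S : Bdd k A} (hR : IsTail d R) (hS : IsTail d S) :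
    IsTail d (R + S) := by
  obtain ⟨X, h1, h2, h3⟩ := hR
  obtain ⟨Y, h4, h5, h6⟩ := hS
  exact ⟨X + Y, add_mem h1 h4, by rw [map_add, h2, h5, smul_add], by
    rw [map_add, map_add, ← h3, ← h6]; rfl⟩

theorem IsTail.smul {d : ℤ} (c : k) {R : Bdd k A} (hR : IsTail d R) : IsTail d (c • R) := by
  obtain ⟨X, h1, h2, h3⟩ := hR
  exact ⟨c • X, Submodule.smul_mem _ c h1, by rw [map_smul, h2, smul_comm], by
    rw [map_smul, map_smul, ← h3]; rfl⟩

theorem IsTail.congr {d e : ℤ} {R : Bdd k A} (h : IsTail d R) (hd : Even (d - e)) :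
    IsTail e R := by
  unfold IsTail at h ⊢
  rwa [← sgn_congr hd]

/-- By `op_comm_fr` the commutator is a finite sum of products with `id^{⊗i} ⊗ X`, each of which
vanishes in large degrees although `R` itself need not. -/
theorem IsTail.comm {d : ℤ} {R : Bdd k A} (h : IsTail d R) {m p : ℕ} (f : Cochain k A m p) :
    germ (opB f) * germ R = sgn k ((m - p) * d) • (germ R * germ (opB f)) := by
  obtain ⟨X, h1, h2, h3⟩ := h
  rw [← map_mul, ← map_mul, ← map_smul]
  refine germ_eq_iff.2 ?_
  change op f * R - _ • ((R : MEnd k A) * op f) ∈ _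
  rw [h3, op_comm_fr f h2]
  refine sub_mem (sum_mem fun i _ => mul_mem_Ev _ (bc_mem_Ev (tauI_mem_TEv i h1)))
    (Submodule.smul_mem _ _ (sum_mem fun i _ => ?_))
  exact mem_Ev_mul (bc_mem_Ev (tauI_mem_TEv i h1)) (op_mem_Bdd f)

/-- Measures the failure of `insB` to descend to germs: a change of lift changes `insB` by a tail.
-/
theorem isTail_insB {d : ℤ} {E : Bdd k A} (hE : germ E = 0) (h : HasParity d E) :
    IsTail (d - 1) (insB E) :=
  ⟨shade (E : MEnd k A), shade_mem_TEv (germ_eq_zero_iff.1 hE), h.conj_shade, rfl⟩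

/-- Inserting a composite whose first factor is a tail. -/
theorem insB_mul_tail (Z : Bdd k A) {d e : ℤ} {R : Bdd k A} (hZ : HasParity d Z)
    (hR : IsTail e R) : ∃ S, IsTail (d + e - 1) S ∧ insB (Z * R) = insB Z * R - S := by
  obtain ⟨X, h1, h2, h3⟩ := hR
  have h4 : tau (fr (shade (Z : MEnd k A))) * X ∈ TEv k A := mul_mem_TEv _ h1
  -- The same sorting of two places as in `fr_shade_mul`. The pairs in which `X` acts first in
  -- position give the tail `S`, since `tau (fr (shade Z)) * X` vanishes wherever `X` does.
  have key : fr (shade (Z : MEnd k A)) * fr X = fr (shade (Z : MEnd k A) * fr X) +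
      fr (tau (fr (shade (Z : MEnd k A))) * X) := by
    rw [← map_add]
    apply eq_fr
    rw [tau_mul]
    conv_lhs => rw [fr_eq (shade (Z : MEnd k A)), add_mul]
    conv_lhs => enter [2]; rw [fr_eq X]
    rw [mul_add]
    abel
  refine ⟨⟨_, bc_fr_mem_Bdd h4⟩, ⟨_, h4, ?_, rfl⟩, Subtype.ext ?_⟩
  · rw [conj_mul, h2, ← tau_conj, conj_fr hZ.conj_shade, map_smul, smul_mul_smul_comm, ← sgn_add]
    congr 2
    ring
  · change ins ((Z : MEnd k A) * (R : MEnd k A)) = ins (Z : MEnd k A) * (R : MEnd k A) - bc _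
    rw [h3, ins_apply, shade_mul_bc, ins_apply, ← map_mul, key, map_add, add_sub_cancel_right]

theorem conj_scal : conj (scal : TEnd k A) = scal := by
  refine TEnd.ext_cons ?_ fun v t => ?_
  · simp [conj_apply]
  · simp [conj_apply]

/-- The contracting homotopy `insB` for the graded commutator with `bdryB`. -/
theorem bdryB_homotopy {d : ℤ} {Z : Bdd k A} (hZ : HasParity d Z) :
    ∃ R, IsTail d R ∧ bdryB k A * insB Z + sgn k d • (insB Z * bdryB k A) +
      insB (bdryB k A * Z - sgn k d • (Z * bdryB k A)) = Z - R := by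
  have h1 := scal_kap_mem_TEv Z.2
  refine ⟨⟨_, bc_fr_mem_Bdd h1⟩, ⟨_, h1, ?_, rfl⟩, Subtype.ext ?_⟩
  · rw [conj_mul, conj_scal, ← kap_conjM, hZ, map_smul, mul_smul_comm]
  · have := bdry_mul_ins (Z : MEnd k A)
    rw [hZ, map_smul, smul_mul_assoc, smul_mul_assoc] at this
    exact this

theorem insB_mul_insB {d : ℤ} {Z : Bdd k A} (hZ : HasParity d Z) (Y : Bdd k A) :
    insB Z * insB Y = insB (Z * insB Y) - sgn k d • insB (insB Z * Y) := by
  rw [← map_smul, ← map_sub]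
  refine Subtype.ext ?_
  have := ins_mul_ins (Z : MEnd k A) Y
  rw [conjM_ins, hZ, map_smul, neg_mul, ← sub_eq_add_neg, smul_mul_assoc] at this
  exact this

theorem map_sum_insAt (Y : Bdd k A) (i : ℕ) :
    bc (∑ c ∈ Finset.range i, tauI c (shade (Y : MEnd k A))) =
      ∑ c ∈ Finset.range i, (insAt c Y : MEnd k A) := by
  rw [map_sum]
  rfl

/-- Inside a factor inserted at place `i`, the sum `insB Y` only runs over places from `i` on; the
first `i` places have to be subtracted. -/
theorem insAt_mul_insB (i : ℕ) (Z Y : Bdd k A) : insAt i (Z * insB Y) =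
    insAt i Z * (insB Y - ∑ c ∈ Finset.range i, insAt c Y) := by
  have h : (insB Y : MEnd k A) - ((∑ c ∈ Finset.range i, insAt c Y : Bdd k A) : MEnd k A) =
      bc (tauI i (fr (shade (Y : MEnd k A)))) := by
    rw [sub_eq_iff_eq_add', AddSubmonoidClass.coe_finsetSum, ← map_sum_insAt, ← map_add,
      ← fr_eq_sum_tauI]
    rfl
  refine Subtype.ext ?_
  rw [coe_insAt, MulMemClass.coe_mul, MulMemClass.coe_mul, AddSubgroupClass.coe_sub, h, coe_insB,
    ins_apply, shade_mul_bc, tauI_mul, map_mul, coe_insAt]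

end Parity

/-! ### Singular cochains as germs, and their exact identities -/

section SingularCochains

variable {k : Type u} [Field k] {A : Type v} [Ring A] [Algebra k A]

theorem cls_extend_of_eq (r : ℕ) {m p M P : ℕ} (hM : m + r = M) (hP : p + r = P)
    (f : Cochain k A m p) : cls M P (extend r hM hP f) = cls m p f := by
  induction r generalizing M P with
  -- `extend 0` is the identity only up to identifications of tensor powers; comparing after one
  -- `theta` avoids unfolding it.
  | zero =>
    have h : ∀ {M P : ℕ} (hM : m = M) (hP : p = P),
        cls M P (extend 0 (by omega) (by omega) f) = cls m p f := by
      rintro _ _ rfl rfl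
      rw [← cls_theta, theta, extend_extend 0 1 _ _ rfl rfl f (zero_add 1) rfl rfl]
      exact cls_theta f
    exact h (by omega) (by omega)
  | succ r ih =>
    have := ih rfl rfl
    rw [← this, ← cls_extend (show m + r + 1 = M by omega) (show p + r + 1 = P by omega),
      extend_extend]
    rfl

namespace Csg

theorem cls_mem_degree {m p : ℕ} {i : ℤ} (h : (m : ℤ) - p = i) (f : Cochain k A m p) :
    cls m p f ∈ Csg.degree (k := k) (A := A) i :=
  Submodule.mem_iSup_of_mem m (Submodule.mem_iSup_of_mem p (Submodule.mem_iSup_of_mem h ⟨f, rfl⟩))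

/-- Two representatives of one degree have `m - p = n - q`. Adding `q` strands to the first and `p`
to the second places both in `C^i(A, Ω^{p+q})`, where they can be added. -/
theorem exists_cls {i : ℤ} {x : Csg k A} (hx : x ∈ Csg.degree i) :
    ∃ (m p : ℕ) (_ : (m : ℤ) - p = i) (f : Cochain k A m p), cls m p f = x := by
  let S : Submodule k (Csg k A) :=
    { carrier := {x | ∃ (m p : ℕ) (_ : (m : ℤ) - p = i) (f : Cochain k A m p), cls m p f = x}
      add_mem' := by
        rintro _ _ ⟨m, p, h, f, rfl⟩ ⟨n, q, h', g, rfl⟩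
        refine ⟨m + q, p + q, by push_cast; omega, extend q rfl rfl f +
          extend p (show n + p = m + q by omega) (add_comm q p) g, ?_⟩
        rw [map_add, cls_extend_of_eq, cls_extend_of_eq]
      -- Any indices with difference `i` serve for zero; the positive and negative parts of `i` are
      -- such a pair.
      zero_mem' := ⟨i.toNat, (-i).toNat, by omega, 0, map_zero _⟩
      smul_mem' := by
        rintro c _ ⟨m, p, h, f, rfl⟩
        exact ⟨m, p, h, c • f, map_smul _ _ _⟩ }
  have : Csg.degree i ≤ S := iSup_le fun m => iSup_le fun p => iSup_le fun h => by
    rintro _ ⟨f, rfl⟩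
    exact ⟨m, p, h, f, rfl⟩
  exact this hx

theorem mem_degree_iff {i : ℤ} {x : Csg k A} : x ∈ Csg.degree i ↔
    ∃ (m p : ℕ) (_ : (m : ℤ) - p = i) (f : Cochain k A m p), cls m p f = x := by
  refine ⟨fun h => exists_cls h, ?_⟩
  rintro ⟨m, p, h, f, rfl⟩
  exact cls_mem_degree h f

theorem iSup_degree : ⨆ i, Csg.degree (k := k) (A := A) i = ⊤ := by
  rw [← Submodule.ker_mkQ (⨆ i, Csg.degree (k := k) (A := A) i), LinearMap.ker_eq_top]
  refine Csg.hom_ext fun m p f => ?_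
  rw [Submodule.mkQ_apply, LinearMap.zero_apply, Submodule.Quotient.mk_eq_zero]
  exact Submodule.mem_iSup_of_mem _ (cls_mem_degree rfl f)

/-- The projection to the homogeneous component of degree `i`. -/
def component (i : ℤ) : Csg k A →ₗ[k] Csg k A :=
  Csg.lift (fun m p => if (m : ℤ) - p = i then cls m p else 0) fun m p f => by
    have : ((m + 1 : ℕ) : ℤ) - (p + 1 : ℕ) = m - p := by push_cast; ring
    rw [this]
    split_ifs
    · exact cls_theta f
    · rfl

theorem component_of_mem {i : ℤ} {x : Csg k A} (hx : x ∈ Csg.degree i) : component i x = x := by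
  obtain ⟨m, p, h, f, rfl⟩ := mem_degree_iff.1 hx
  rw [component, Csg.lift_cls, if_pos h]

theorem component_of_mem_ne {i j : ℤ} {x : Csg k A} (hx : x ∈ Csg.degree j) (hij : j ≠ i) :
    component i x = 0 := by
  obtain ⟨m, p, h, f, rfl⟩ := mem_degree_iff.1 hx
  rw [component, Csg.lift_cls, if_neg (by rwa [h])]
  rfl

/-! ### Germs of singular cochains -/

/-- The germ of the operator `f ⊗ id`, for a class of a cochain `f`. -/
def toGerm : Csg k A →ₗ[k] Germ k A :=
  Csg.lift (fun _ _ => germ.toLinearMap ∘ₗ opB) fun _ _ f => germ_opB_theta f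

theorem toGerm_cls {m p : ℕ} (f : Cochain k A m p) : toGerm (cls m p f) = germ (opB f) :=
  Csg.lift_cls _ _ m p f

theorem eq_zero_of_toGerm_eq_zero {i : ℤ} {x : Csg k A} (hx : x ∈ Csg.degree i)
    (h : toGerm x = 0) : x = 0 := by
  obtain ⟨m, p, _, f, rfl⟩ := mem_degree_iff.1 hx
  rw [toGerm_cls, germ_eq_zero_iff] at h
  obtain ⟨r, hr⟩ := extend_eq_zero_of_op_mem_Ev h
  rw [← cls_extend_of_eq r rfl rfl f, hr, map_zero]

/-- The transfer principle: each identity between homogeneous singular cochains below is an identity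
of products in the germ algebra. -/
theorem eq_of_toGerm_eq {i : ℤ} {x y : Csg k A} (hx : x ∈ Csg.degree i) (hy : y ∈ Csg.degree i)
    (h : toGerm x = toGerm y) : x = y :=
  sub_eq_zero.1 (eq_zero_of_toGerm_eq_zero (sub_mem hx hy) (by rw [map_sub, h, sub_self]))

/-- A bounded operator of parity `d` whose germ is that of `x`. -/
structure IsLift (x : Csg k A) (d : ℤ) (Z : Bdd k A) : Prop where
  germ_eq : germ Z = toGerm x
  hasParity : HasParity d Z

theorem exists_isLift {i : ℤ} {x : Csg k A} (hx : x ∈ Csg.degree i) :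
    ∃ Z : Bdd k A, IsLift x i Z := by
  obtain ⟨m, p, rfl, f, rfl⟩ := mem_degree_iff.1 hx
  exact ⟨opB f, (toGerm_cls f).symm, HasParity.opB f⟩

theorem toGerm_tail {i d : ℤ} {x : Csg k A} (hx : x ∈ Csg.degree i) {R : Bdd k A}
    (hR : IsTail d R) : toGerm x * germ R = sgn k (i * d) • (germ R * toGerm x) := by
  obtain ⟨m, p, rfl, f, rfl⟩ := mem_degree_iff.1 hx
  rw [toGerm_cls]
  exact hR.comm f

theorem toGerm_one : toGerm (cls 0 0 unitCochain) = (1 : Germ k A) := by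
  rw [toGerm_cls, ← map_one germ]
  refine germ_eq_iff.2 (mem_Ev_of_mul 0 fun x y => ?_)
  rw [coe_opB, OneMemClass.coe_one, MEnd.sub_apply, op_mul, one_smul, MEnd.one_apply]
  simp [unitCochain]

theorem toGerm_cup (x y : Csg k A) : toGerm (Csg.cup x y) = toGerm x * toGerm y := by
  have : (Csg.cup.compr₂ toGerm : Csg k A →ₗ[k] Csg k A →ₗ[k] Germ k A) =
      (LinearMap.mul k (Germ k A)).compl₁₂ toGerm toGerm :=
    Csg.hom_ext fun m p f => Csg.hom_ext fun n q g => by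
      rw [LinearMap.compr₂_apply, LinearMap.compl₁₂_apply, LinearMap.mul_apply', Csg.cup_cls,
        toGerm_cls, toGerm_cls, toGerm_cls, germ_opB_cup]
  exact LinearMap.congr_fun₂ this x y

theorem toGerm_d {i : ℤ} {x : Csg k A} (hx : x ∈ Csg.degree i) : toGerm (Csg.d x) =
    germ (bdryB k A) * toGerm x - sgn k i • (toGerm x * germ (bdryB k A)) := by
  obtain ⟨m, p, rfl, f, rfl⟩ := mem_degree_iff.1 hx
  rw [Csg.d_cls proj_comp_lifts, toGerm_cls, toGerm_cls, germ_opB_hochschild]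

/-- The circle product of `C_sg^*(A, A)`. -/
def circ : Csg k A →ₗ[k] Csg k A →ₗ[k] Csg k A :=
  Csg.lift₂ circClass (fun _ _ _ _ => circClass_theta_left) fun _ _ _ _ => circClass_theta_right

theorem circ_cls {m p n q : ℕ} (f : Cochain k A m p) (g : Cochain k A n q) :
    circ (cls m p f) (cls n q g) = circClass m p n q f g :=
  Csg.lift₂_cls _ _ _ m p n q f g

/-- Any lift of `y` may be used, by `germ_commutator_insB_congr`. This matters for iterated
products, whose natural lifts are not operators of cochains. -/
theorem toGerm_circ {i j : ℤ} {x y : Csg k A} (hx : x ∈ Csg.degree i) {Z : Bdd k A}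
    (hy : y ∈ Csg.degree j) (hZ : IsLift y j Z) : toGerm (circ x y) =
      toGerm x * germ (insB Z) - sgn k (i * (j - 1)) • (germ (insB Z) * toGerm x) := by
  obtain ⟨m, p, rfl, f, rfl⟩ := mem_degree_iff.1 hx
  obtain ⟨n, q, rfl, g, rfl⟩ := mem_degree_iff.1 hy
  obtain ⟨h1, h2⟩ := hZ
  rw [toGerm_cls, ← germ_opB_theta] at h1
  rw [circ_cls, circClass_apply, toGerm_cls, germ_opB_circ, toGerm_cls,
    germ_commutator_insB_congr f h2 ((HasParity.opB (theta g)).congr (by push_cast; ring_nf; simp))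
      h1]
  congr 4
  push_cast
  ring

theorem cup_mem {i j : ℤ} {x y : Csg k A} (hx : x ∈ Csg.degree i) (hy : y ∈ Csg.degree j) :
    Csg.cup x y ∈ Csg.degree (i + j) := by
  obtain ⟨m, p, rfl, f, rfl⟩ := mem_degree_iff.1 hx
  obtain ⟨n, q, rfl, g, rfl⟩ := mem_degree_iff.1 hy
  rw [Csg.cup_cls]
  exact cls_mem_degree (by push_cast; ring) _

theorem d_mem {i : ℤ} {x : Csg k A} (hx : x ∈ Csg.degree i) : Csg.d x ∈ Csg.degree (i + 1) := by
  obtain ⟨m, p, rfl, f, rfl⟩ := mem_degree_iff.1 hx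
  rw [Csg.d_cls proj_comp_lifts]
  exact cls_mem_degree (by push_cast; ring) _

theorem circ_mem {i j : ℤ} {x y : Csg k A} (hx : x ∈ Csg.degree i) (hy : y ∈ Csg.degree j) :
    circ x y ∈ Csg.degree (i + j - 1) := by
  obtain ⟨m, p, rfl, f, rfl⟩ := mem_degree_iff.1 hx
  obtain ⟨n, q, rfl, g, rfl⟩ := mem_degree_iff.1 hy
  rw [circ_cls, circClass_apply]
  exact cls_mem_degree (by push_cast; ring) _

theorem one_mem : cls 0 0 unitCochain ∈ Csg.degree (k := k) (A := A) 0 :=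
  cls_mem_degree (by simp) _

theorem bracket_eq {i j : ℤ} {x y : Csg k A} (hx : x ∈ Csg.degree i) (hy : y ∈ Csg.degree j) :
    Csg.bracket x y = circ x y - sgn k ((i - 1) * (j - 1)) • circ y x := by
  obtain ⟨m, p, rfl, f, rfl⟩ := mem_degree_iff.1 hx
  obtain ⟨n, q, rfl, g, rfl⟩ := mem_degree_iff.1 hy
  rw [Csg.bracket, Csg.lift₂_cls, circ_cls, circ_cls]
  rfl

/-! ### Identities between singular cochains -/

theorem cup_assoc_of_mem {i j l : ℤ} {x y z : Csg k A} (hx : x ∈ Csg.degree i)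
    (hy : y ∈ Csg.degree j) (hz : z ∈ Csg.degree l) :
    Csg.cup (Csg.cup x y) z = Csg.cup x (Csg.cup y z) :=
  eq_of_toGerm_eq (cup_mem (cup_mem hx hy) hz) (add_assoc i j l ▸ cup_mem hx (cup_mem hy hz))
    (by simp only [toGerm_cup, mul_assoc])

theorem one_cup_of_mem {i : ℤ} {x : Csg k A} (hx : x ∈ Csg.degree i) :
    Csg.cup (cls 0 0 unitCochain) x = x :=
  eq_of_toGerm_eq (cup_mem one_mem hx) (by rwa [zero_add]) (by rw [toGerm_cup, toGerm_one, one_mul])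

theorem cup_one_of_mem {i : ℤ} {x : Csg k A} (hx : x ∈ Csg.degree i) :
    Csg.cup x (cls 0 0 unitCochain) = x :=
  eq_of_toGerm_eq (cup_mem hx one_mem) (by rwa [add_zero]) (by rw [toGerm_cup, toGerm_one, mul_one])

theorem d_one : Csg.d (cls 0 0 unitCochain) = (0 : Csg k A) :=
  eq_zero_of_toGerm_eq_zero (d_mem one_mem) (by rw [toGerm_d one_mem, toGerm_one]; simp)

/-- A graded commutator with a fixed element is a graded derivation of the product; here the element
is `bdry`. -/
theorem d_cup {i j : ℤ} {x y : Csg k A} (hx : x ∈ Csg.degree i) (hy : y ∈ Csg.degree j) :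
    Csg.d (Csg.cup x y) = Csg.cup (Csg.d x) y + sgn k i • Csg.cup x (Csg.d y) := by
  refine eq_of_toGerm_eq (d_mem (cup_mem hx hy)) (add_mem ?_ (Submodule.smul_mem _ _ ?_)) ?_
  · rw [add_right_comm]
    exact cup_mem (d_mem hx) hy
  · rw [add_assoc]
    exact cup_mem hx (d_mem hy)
  · rw [toGerm_d (cup_mem hx hy), map_add, map_smul, toGerm_cup, toGerm_cup, toGerm_cup,
      toGerm_d hx, toGerm_d hy, sgn_add, mul_smul]
    simp only [mul_sub, sub_mul, smul_sub, smul_mul_assoc, mul_smul_comm, mul_assoc]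
    abel

/-- The same derivation property, for the commutator with `insB Z` where `Z` lifts `z`. It holds
exactly for cochains. -/
theorem cup_circ {i j l : ℤ} {x y z : Csg k A} (hx : x ∈ Csg.degree i) (hy : y ∈ Csg.degree j)
    (hz : z ∈ Csg.degree l) : circ (Csg.cup x y) z =
      Csg.cup x (circ y z) + sgn k (j * (l - 1)) • Csg.cup (circ x z) y := by
  refine eq_of_toGerm_eq (circ_mem (cup_mem hx hy) hz) (add_mem ?_ (Submodule.smul_mem _ _ ?_)) ?_
  · convert cup_mem hx (circ_mem hy hz) using 2
    ring
  · convert cup_mem (circ_mem hx hz) hy using 2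
    ring
  · obtain ⟨Z, hZ⟩ := exists_isLift hz
    rw [toGerm_circ (cup_mem hx hy) hz hZ, map_add, map_smul, toGerm_cup, toGerm_cup, toGerm_cup,
      toGerm_circ hx hz hZ, toGerm_circ hy hz hZ, add_mul, sgn_add,
      mul_comm (sgn k (i * (l - 1))), mul_smul]
    simp only [mul_sub, sub_mul, smul_sub, smul_mul_assoc, mul_smul_comm, mul_assoc]
    abel

theorem IsLift.circ {i j : ℤ} {x y : Csg k A} (hx : x ∈ Csg.degree i) (hy : y ∈ Csg.degree j)
    {Z Y : Bdd k A} (hZ : IsLift x i Z) (hY : IsLift y j Y) : IsLift (circ x y) (i + j - 1)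
      (Z * insB Y - sgn k (i * (j - 1)) • (insB Y * Z)) where
  germ_eq := by
    rw [toGerm_circ hx hy hY, ← hZ.germ_eq, map_sub, map_smul, map_mul, map_mul]
  hasParity := ((hZ.hasParity.mul hY.hasParity.insB).congr (by ring_nf; simp)).sub
    (((hY.hasParity.insB.mul hZ.hasParity).congr (by ring_nf; simp)).smul _)

theorem IsLift.d {i : ℤ} {x : Csg k A} (hx : x ∈ Csg.degree i) {Z : Bdd k A} (hZ : IsLift x i Z) :
    IsLift (Csg.d x) (i + 1) (bdryB k A * Z - sgn k i • (Z * bdryB k A)) where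
  germ_eq := by
    rw [toGerm_d hx, ← hZ.germ_eq, map_sub, map_smul, map_mul, map_mul]
  hasParity := ((HasParity.bdryB.mul hZ.hasParity).congr (by ring_nf; simp)).sub
    ((hZ.hasParity.mul HasParity.bdryB).smul _)

theorem IsLift.cup {i j : ℤ} {x y : Csg k A} {Z Y : Bdd k A} (hZ : IsLift x i Z)
    (hY : IsLift y j Y) : IsLift (Csg.cup x y) (i + j) (Z * Y) where
  germ_eq := by rw [toGerm_cup, ← hZ.germ_eq, ← hY.germ_eq, map_mul]
  hasParity := hZ.hasParity.mul hY.hasParity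

/-- The circle product is a graded right pre-Lie product. -/
theorem circ_circ {i j l : ℤ} {x y z : Csg k A} (hx : x ∈ Csg.degree i) (hy : y ∈ Csg.degree j)
    (hz : z ∈ Csg.degree l) : circ (circ x y) z - circ x (circ y z) =
      sgn k ((j - 1) * (l - 1)) • (circ (circ x z) y - circ x (circ z y)) := by
  refine eq_of_toGerm_eq (i := i + j + l - 2) (sub_mem ?_ ?_)
    (Submodule.smul_mem _ _ (sub_mem ?_ ?_)) ?_
  · convert circ_mem (circ_mem hx hy) hz using 2; ring
  · convert circ_mem hx (circ_mem hy hz) using 2; ring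
  · convert circ_mem (circ_mem hx hz) hy using 2; ring
  · convert circ_mem hx (circ_mem hz hy) using 2; ring
  obtain ⟨Z, hZ⟩ := exists_isLift hy
  obtain ⟨Y, hY⟩ := exists_isLift hz
  -- Solving both relations for `insB (Z * insB Y)` and `insB (Y * insB Z)` shows that `insB` of the
  -- graded commutator for the circle product is the graded commutator of the `insB`. The pre-Lie
  -- identity is then the Jacobi identity for commutators with `x`.
  have h1 := congrArg germ (insB_mul_insB hZ.hasParity Y)
  have h2 := congrArg germ (insB_mul_insB hY.hasParity Z)
  simp only [map_sub, map_mul, map_smul] at h1 h2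
  rw [eq_sub_iff_add_eq, ← eq_sub_iff_add_eq', eq_comm, sub_eq_iff_eq_add] at h1 h2
  rw [map_sub, map_smul, map_sub, toGerm_circ (circ_mem hx hy) hz hY,
    toGerm_circ (circ_mem hx hz) hy hZ, toGerm_circ hx (circ_mem hy hz) (hZ.circ hy hz hY),
    toGerm_circ hx (circ_mem hz hy) (hY.circ hz hy hZ), toGerm_circ hx hy hZ,
    toGerm_circ hx hz hY]
  simp only [map_sub, map_smul, h1, h2, sgn_eq_ite, parity_simps]
  by_cases hi : Even i <;> by_cases hj : Even j <;> by_cases hl : Even l <;>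
  simp [hi, hj, hl] <;> noncomm_ring

/-- The differential of a circle product. -/
theorem d_circ {i j : ℤ} {x y : Csg k A} (hx : x ∈ Csg.degree i) (hy : y ∈ Csg.degree j) :
    Csg.d (circ x y) = circ (Csg.d x) y + sgn k i • (Csg.cup x y - sgn k (i * j) • Csg.cup y x -
      circ x (Csg.d y)) := by
  refine eq_of_toGerm_eq (i := i + j) ?_ (add_mem ?_ (Submodule.smul_mem _ _ (sub_mem (sub_mem
    (cup_mem hx hy) (Submodule.smul_mem _ _ (add_comm i j ▸ cup_mem hy hx))) ?_))) ?_
  · convert d_mem (circ_mem hx hy) using 2; ring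
  · convert circ_mem (d_mem hx) hy using 2; ring
  · convert circ_mem hx (d_mem hy) using 2; ring
  obtain ⟨Z, hZ⟩ := exists_isLift hy
  obtain ⟨R, hR, h⟩ := bdryB_homotopy hZ.hasParity
  have hc := toGerm_tail hx hR
  replace h := congrArg germ h
  -- The homotopy identity evaluates `insB` on the lift of `d y`. Its term `Z` produces the
  -- commutator of the cup product, and its tail `R` drops out by `hc`.
  rw [map_add germ (bdryB k A * insB Z + _), ← eq_sub_iff_add_eq', map_sub germ Z R] at h
  rw [map_add, map_smul, map_sub, map_sub, map_smul, toGerm_d (circ_mem hx hy), toGerm_cup,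
    toGerm_cup, toGerm_circ hx hy hZ, toGerm_circ (d_mem hx) hy hZ,
    toGerm_circ hx (d_mem hy) (hZ.d hy), toGerm_d hx, h, ← hZ.germ_eq]
  simp only [map_add, map_smul, map_mul, mul_sub, sub_mul, hc]
  simp only [sgn_eq_ite, parity_simps]
  by_cases hi : Even i <;> by_cases hj : Even j <;>
  simp [hi, hj] <;> noncomm_ring

end Csg

end SingularCochains

/-! ### The circle product with a cup product, up to homotopy -/

section CupHomotopy

variable {k : Type u} [Field k] {A : Type v} [Ring A] [Algebra k A]

/-- The algebra behind the Leibniz rule. Here `F`, `G`, `C` stand for `x`, `y`, `x ∘ y`, while `E`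
is `ins z`, `T` is `ins (y * ins z)`, `Q` and `S` are tails and `P` is `ins y * Q`. The factor `b *
E ± E * b + Q` on the right stands for `z`, and the first bracket on the left for `ins (y z)`. -/
theorem cup_homotopy_identity {R : Type*} [Ring R] [Algebra k R] {F G b C E T P Q S : R}
    {i j l : ℤ} (hF : b * F = sgn k i • (F * b))
    (hC : b * C = sgn k (i + j - 1) • (C * b) + sgn k i • (F * G - sgn k (i * j) • (G * F)))
    (hQ : C * Q = F * P - sgn k (i * (j + l - 1)) • (P * F))
    (hS : F * S = sgn k (i * (j + l - 1)) • (S * F)) :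
    F * (sgn k j • (G * E - b * T - sgn k (j + l - 1) • (T * b)) + P + S) -
      sgn k (i * (j + l - 1)) •
        ((sgn k j • (G * E - b * T - sgn k (j + l - 1) • (T * b)) + P + S) * F) =
    C * (b * E + sgn k l • (E * b) + Q) +
      sgn k ((i - 1) * j) • (G * (F * E - sgn k (i * (l - 1)) • (E * F))) +
      sgn k (i + j) • (b * (C * E - (F * T - sgn k (i * (j + l)) • (T * F))) -
        sgn k (i + j + l) • ((C * E - (F * T - sgn k (i * (j + l)) • (T * F))) * b)) := by
  have hF' : ∀ X, b * (F * X) = sgn k i • (F * (b * X)) := fun X => by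
    rw [← mul_assoc, hF, smul_mul_assoc, mul_assoc]
  have hC' : ∀ X, b * (C * X) = sgn k (i + j - 1) • (C * (b * X)) +
      sgn k i • (F * (G * X) - sgn k (i * j) • (G * (F * X))) := fun X => by
    rw [← mul_assoc, hC]
    simp only [add_mul, sub_mul, smul_mul_assoc, mul_assoc]
  simp only [mul_add, mul_sub, add_mul, sub_mul, mul_assoc, smul_mul_assoc, mul_smul_comm, hF, hF',
    hC', hQ, hS, smul_add, smul_sub]
  simp only [sgn_eq_ite, parity_simps]
  by_cases hi : Even i <;> by_cases hj : Even j <;> by_cases hl : Even l <;>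
  simp [hi, hj, hl] <;> abel

namespace Csg

/-- The germ of the homotopy that makes `x ∘ -` a derivation of the cup product. -/
def homotopyGerm (i j l : ℤ) (x y : Csg k A) (Z Y : Bdd k A) : Germ k A :=
  toGerm (circ x y) * germ (insB Y) - (toGerm x * germ (insB (Z * insB Y)) -
    sgn k (i * (j + l)) • (germ (insB (Z * insB Y)) * toGerm x))

/-- Write `z` as `[b, ins z]` plus a tail. Since `y` is a cocycle, `y z` is up to sign `[b, y * ins
z]`, up to a term of zero germ and `y` times a tail, and the homotopy identity computes `ins` of it.
Any cochain with the germ of the homotopy then serves as `w`. -/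
theorem circ_cup_of_homotopy {i j l : ℤ} {x y z w : Csg k A} (hx : x ∈ Csg.degree i)
    (hy : y ∈ Csg.degree j) (hz : z ∈ Csg.degree l) (hdx : Csg.d x = 0) (hdy : Csg.d y = 0)
    (hdz : Csg.d z = 0) {Z Y : Bdd k A} (hZ : IsLift y j Z) (hY : IsLift z l Y)
    (hw : w ∈ Csg.degree (i + j + l - 2)) (h : toGerm w = homotopyGerm i j l x y Z Y) :
    circ x (Csg.cup y z) = Csg.cup (circ x y) z + sgn k ((i - 1) * j) • Csg.cup y (circ x z) +
      sgn k (i + j) • Csg.d w := by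
  refine eq_of_toGerm_eq (i := i + j + l - 1) ?_
    (add_mem (add_mem ?_ (Submodule.smul_mem _ _ ?_)) (Submodule.smul_mem _ _ ?_)) ?_
  · convert circ_mem hx (cup_mem hy hz) using 2; ring
  · convert cup_mem (circ_mem hx hy) hz using 2; ring
  · convert cup_mem hy (circ_mem hx hz) using 2; ring
  · convert d_mem hw using 2; ring
  have hd : ∀ {e : ℤ} {v : Csg k A} {V : Bdd k A}, v ∈ Csg.degree e → Csg.d v = 0 →
      IsLift v e V → germ (bdryB k A * V - sgn k e • (V * bdryB k A)) = 0 := fun hv h0 hV => by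
    rw [(hV.d hv).germ_eq, h0, map_zero]
  obtain ⟨Q₁, hQ₁, e1⟩ := bdryB_homotopy hY.hasParity
  have hQ₂ := isTail_insB (hd hz hdz hY) (hY.d hz).hasParity
  set Q₂ := insB (bdryB k A * Y - sgn k l • (Y * bdryB k A))
  have hQ : IsTail l (Q₁ + Q₂) := hQ₁.add (hQ₂.congr (by ring_nf; simp))
  -- An equality of operators, not only of germs, since `insB` will be applied to its product with
  -- `Z`. `Q₂` is there because the lift `Y` commutes with `bdryB` only up to operators of zero
  -- germ.
  have eY : Y = bdryB k A * insB Y + sgn k l • (insB Y * bdryB k A) + (Q₁ + Q₂) := by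
    rw [add_comm Q₁, ← add_assoc, e1, sub_add_cancel]
  set U := Z * insB Y with hU
  have pU : HasParity (j + l - 1) U :=
    (hZ.hasParity.mul hY.hasParity.insB).congr (by ring_nf; simp)
  obtain ⟨S₁, hS₁, e2⟩ := bdryB_homotopy pU
  set N := bdryB k A * Z - sgn k j • (Z * bdryB k A) with hN
  have hNY : germ (N * insB Y) = 0 := by rw [map_mul, hd hy hdy hZ, zero_mul]
  have hS₂ := isTail_insB hNY ((hZ.d hy).hasParity.mul hY.hasParity.insB)
  obtain ⟨S₃, hS₃, e3⟩ := insB_mul_tail Z hZ.hasParity hQ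
  have eZY : Z * Y = sgn k j • (bdryB k A * U - sgn k (j + l - 1) • (U * bdryB k A)) -
      sgn k j • (N * insB Y) + Z * (Q₁ + Q₂) := by
    conv_lhs => rw [eY]
    rw [hU, hN]
    simp only [mul_add, sub_mul, mul_assoc, smul_sub, smul_mul_assoc, mul_smul_comm, smul_smul,
      sgn_mul_self, one_smul, ← sgn_add]
    rw [show sgn k (j + (j + l - 1)) = -sgn k l by
      rw [← sgn_succ]; exact sgn_congr ⟨j - 1, by ring⟩]
    simp only [neg_smul]
    abel
  have hS : IsTail (j + l - 1) (-(sgn k j • S₁) - sgn k j • insB (N * insB Y) - S₃) := by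
    have := ((hS₁.smul (-sgn k j)).add ((hS₂.congr (e := j + l - 1) (by ring_nf; simp)).smul
      (-sgn k j))).add (hS₃.smul (-1))
    convert this using 1
    simp only [neg_smul, one_smul]
    abel
  -- `insB` of the three summands of `eZY`: the homotopy identity for `U`, a tail from the zero germ
  -- of `N * insB Y`, and `insB_mul_tail`.
  have e4 : insB (Z * Y) = sgn k j • (U - bdryB k A * insB U -
      sgn k (j + l - 1) • (insB U * bdryB k A)) + insB Z * (Q₁ + Q₂) +
        (-(sgn k j • S₁) - sgn k j • insB (N * insB Y) - S₃) := by
    rw [eZY, map_add, map_sub, map_smul, map_smul, e3, eq_sub_of_add_eq' e2]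
    simp only [smul_sub, smul_add]
    abel
  have hF := toGerm_d hx
  have hC := toGerm_d (circ_mem hx hy)
  have hG := d_circ hx hy
  rw [hdx, hdy, map_zero, map_zero, LinearMap.zero_apply, sub_zero, zero_add] at hG
  rw [hdx, map_zero, eq_comm, sub_eq_zero] at hF
  rw [hG, eq_comm, sub_eq_iff_eq_add', map_smul, map_sub, map_smul, toGerm_cup, toGerm_cup] at hC
  have key := cup_homotopy_identity (k := k) (E := germ (insB Y)) (T := germ (insB U))
    (P := germ (insB Z) * germ (Q₁ + Q₂)) (Q := germ (Q₁ + Q₂)) (l := l) hF hC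
    (by
      have := toGerm_tail hx hQ
      rw [toGerm_circ hx hy hZ, sub_mul, smul_mul_assoc, mul_assoc, mul_assoc, mul_assoc, this,
        mul_smul_comm, smul_smul, ← sgn_add]
      congr 3
      ring)
    (toGerm_tail hx hS)
  have gU₀ : germ U = toGerm y * germ (insB Y) := by rw [hU, map_mul, hZ.germ_eq]
  have gU : germ (U - bdryB k A * insB U - sgn k (j + l - 1) • (insB U * bdryB k A)) =
      toGerm y * germ (insB Y) - germ (bdryB k A) * germ (insB U) -
        sgn k (j + l - 1) • (germ (insB U) * germ (bdryB k A)) := by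
    rw [map_sub, map_sub, map_smul, map_mul germ (bdryB k A), map_mul germ (insB U), gU₀]
  have gY : toGerm z = germ (bdryB k A) * germ (insB Y) +
      sgn k l • (germ (insB Y) * germ (bdryB k A)) + germ (Q₁ + Q₂) := by
    rw [← hY.germ_eq]
    refine (congrArg germ eY).trans ?_
    rw [map_add germ (_ + _), map_add, map_smul, map_mul, map_mul]
  rw [toGerm_circ hx (cup_mem hy hz) (hZ.cup hY), e4, map_add germ, map_add germ, map_smul germ,
    map_mul germ (insB Z), gU, map_add toGerm, map_add toGerm, map_smul toGerm, map_smul toGerm,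
    toGerm_cup, toGerm_cup, toGerm_d hw, h, homotopyGerm, toGerm_circ hx hz hY, gY, ← hU,
    show sgn k (i + j + l - 2) = sgn k (i + j + l) from sgn_congr ⟨-1, by ring⟩]
  exact key

/-- The germs of the elements of degree `i`. -/
def germs (i : ℤ) : Submodule k (Germ k A) := (Csg.degree i).map toGerm

/-- After enough extra strands are added to a cochain representing `r`, place `a` is one of its
inputs, so the product is up to sign the germ of a single `f ∘_{a+1} g`. -/
theorem mul_insAt_mem {i j : ℤ} {r : Germ k A} (hr : r ∈ germs i) {y : Csg k A}
    (hy : y ∈ Csg.degree j) {Z : Bdd k A} (hZ : germ Z = toGerm y) (a : ℕ) :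
    r * germ (insAt a Z) ∈ germs (k := k) (A := A) (i + j - 1) := by
  obtain ⟨_, hx, rfl⟩ := hr
  obtain ⟨m, p, rfl, f, rfl⟩ := mem_degree_iff.1 hx
  obtain ⟨n, q, rfl, g, rfl⟩ := mem_degree_iff.1 hy
  rw [toGerm_cls] at hZ
  rw [toGerm_cls, germ_insAt_congr a hZ, ← germ_opB_extend (r := a + 1) rfl rfl f]
  have := germ_opB_circIn (M := m + (a + 1) + n - 1) rfl rfl
    (⟨a, by omega⟩ : Fin (m + (a + 1))) (extend (a + 1) rfl rfl f) g
  rw [← inv_smul_eq_iff₀ (by rw [sgn_eq_ite]; split_ifs <;> simp)] at this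
  rw [← this]
  refine Submodule.smul_mem _ _ ⟨cls _ _ _, cls_mem_degree ?_ _, toGerm_cls _⟩
  omega

theorem insAt_mul_mem {i j : ℤ} {r : Germ k A} (hr : r ∈ germs i) {y : Csg k A}
    (hy : y ∈ Csg.degree j) {Z : Bdd k A} (hZ : germ Z = toGerm y) (a : ℕ) :
    germ (insAt a Z) * r ∈ germs (k := k) (A := A) (i + j - 1) := by
  obtain ⟨_, hx, rfl⟩ := hr
  obtain ⟨m, p, rfl, f, rfl⟩ := mem_degree_iff.1 hx
  obtain ⟨n, q, rfl, g, rfl⟩ := mem_degree_iff.1 hy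
  -- `circOut` needs a second argument with at least one input, hence `theta g`.
  rw [toGerm_cls, ← germ_opB_theta] at hZ
  rw [toGerm_cls, germ_insAt_congr a hZ, ← germ_opB_extend (r := a + 1) rfl rfl f]
  have := germ_opB_circOut (M := m + (a + 1) + n) rfl rfl
    (⟨a, by omega⟩ : Fin (p + (a + 1))) (extend (a + 1) rfl rfl f) (theta g)
  rw [← inv_smul_eq_iff₀ (by rw [sgn_eq_ite]; split_ifs <;> simp)] at this
  rw [← this]
  refine Submodule.smul_mem _ _ ⟨cls _ _ _, cls_mem_degree ?_ _, toGerm_cls _⟩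
  omega

/-- The full sums `insB Y` cancel by `insAt_mul_insB`, leaving pairs of insertions at places `c < a`
and single insertions into the outputs of `x ∘ z`. For `p = 0` only double insertions into the
inputs of `f` remain: Gerstenhaber's classical homotopy. -/
theorem homotopyGerm_eq {m p : ℕ} (f : Cochain k A m p) {j l : ℤ} {y z : Csg k A}
    (hy : y ∈ Csg.degree j) (hz : z ∈ Csg.degree l) {Z Y : Bdd k A} (hZ : IsLift y j Z)
    (hY : IsLift z l Y) : homotopyGerm (m - p) j l (cls m p f) y Z Y =
      ∑ a ∈ Finset.range m, ∑ c ∈ Finset.range a,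
          germ (opB f) * germ (insAt a Z) * germ (insAt c Y) -
        sgn k ((m - p) * (j - 1)) • ∑ a ∈ Finset.range p,
          (germ (insAt a Z) * toGerm (circ (cls m p f) z) + sgn k ((m - p) * (l - 1)) •
            ∑ c ∈ Finset.range a, germ (insAt a Z) * (germ (insAt c Y) * germ (opB f))) := by
  have pU : HasParity (j + l - 1) (Z * insB Y) :=
    (hZ.hasParity.mul hY.hasParity.insB).congr (by ring_nf; simp)
  have hx := cls_mem_degree rfl f
  have h1 := congrArg germ (opB_mul_insB_sub f pU)
  have h2 := congrArg germ (opB_mul_insB_sub f hZ.hasParity)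
  simp only [map_sub, map_mul, map_smul, map_sum, insAt_mul_insB] at h1 h2
  rw [homotopyGerm, toGerm_circ hx hy hZ, toGerm_circ hx hz hY, toGerm_cls, h2,
    show sgn k ((m - p) * (j + l)) = sgn k ((m - p) * (j + l - 1 - 1)) from
      sgn_congr ⟨m - p, by ring⟩, h1,
    show ((m : ℤ) - p) * (j + l - 1 - 1) = (m - p) * (j - 1) + (m - p) * (l - 1) by ring, sgn_add]
  simp only [sub_mul, mul_sub, Finset.sum_mul, Finset.mul_sum, Finset.sum_sub_distrib, smul_sub,
    Finset.sum_add_distrib, smul_add, mul_assoc, smul_mul_assoc, mul_smul_comm, Finset.smul_sum,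
    mul_smul]
  abel

/-- Up to an explicit homotopy, `x ∘ -` is a derivation of the cup product on cocycles. -/
theorem exists_circ_cup {i j l : ℤ} {x y z : Csg k A} (hx : x ∈ Csg.degree i)
    (hy : y ∈ Csg.degree j) (hz : z ∈ Csg.degree l) (hdx : Csg.d x = 0) (hdy : Csg.d y = 0)
    (hdz : Csg.d z = 0) : ∃ w ∈ Csg.degree (i + j + l - 2), circ x (Csg.cup y z) =
      Csg.cup (circ x y) z + sgn k ((i - 1) * j) • Csg.cup y (circ x z) +
        sgn k (i + j) • Csg.d w := by
  obtain ⟨Z, hZ⟩ := exists_isLift hy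
  obtain ⟨Y, hY⟩ := exists_isLift hz
  suffices h : homotopyGerm i j l x y Z Y ∈ germs (k := k) (A := A) (i + j + l - 2) by
    obtain ⟨w, hw, h⟩ := h
    exact ⟨w, hw, circ_cup_of_homotopy hx hy hz hdx hdy hdz hZ hY hw h⟩
  have hxz := circ_mem hx hz
  obtain ⟨m, p, rfl, f, rfl⟩ := mem_degree_iff.1 hx
  rw [homotopyGerm_eq f hy hz hZ hY, ← toGerm_cls]
  have hf : toGerm (cls m p f) ∈ germs (k := k) (A := A) (m - p) := ⟨_, hx, rfl⟩
  have hfz : toGerm (circ (cls m p f) z) ∈ germs (k := k) (A := A) (m - p + l - 1) := ⟨_, hxz, rfl⟩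
  refine sub_mem (sum_mem fun a _ => sum_mem fun c _ => ?_) (Submodule.smul_mem _ _
    (sum_mem fun a _ => add_mem ?_ (Submodule.smul_mem _ _ (sum_mem fun c _ => ?_))))
  · convert mul_insAt_mem (mul_insAt_mem hf hy hZ.germ_eq a) hz hY.germ_eq c using 2; ring
  · convert insAt_mul_mem hfz hy hZ.germ_eq a using 2; ring
  · convert insAt_mul_mem (insAt_mul_mem hf hz hY.germ_eq c) hy hZ.germ_eq a using 2; ring

end Csg

end CupHomotopy

/-! ### From cochain identities to a Gerstenhaber algebra on cohomology -/

section Homotopy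

variable {k : Type*} [Field k] {C : Type*} [AddCommGroup C] [Module k C]

/-- A cochain complex with a cup product, a circle product and a bracket that satisfy the
identities of Gerstenhaber, up to homotopy, so that its cohomology is a Gerstenhaber algebra. -/
structure IsHomotopyGerstenhaber (𝒢 : ℤ → Submodule k C) (d : C →ₗ[k] C)
    (cup circ br : C →ₗ[k] C →ₗ[k] C) (one : C) : Prop where
  iSup_eq_top : ⨆ i, 𝒢 i = ⊤
  exists_component : ∀ i, ∃ π : C →ₗ[k] C, (∀ x ∈ 𝒢 i, π x = x) ∧ ∀ j ≠ i, ∀ x ∈ 𝒢 j, π x = 0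
  one_mem : one ∈ 𝒢 0
  d_mem : ∀ {i x}, x ∈ 𝒢 i → d x ∈ 𝒢 (i + 1)
  cup_mem : ∀ {i j x y}, x ∈ 𝒢 i → y ∈ 𝒢 j → cup x y ∈ 𝒢 (i + j)
  circ_mem : ∀ {i j x y}, x ∈ 𝒢 i → y ∈ 𝒢 j → circ x y ∈ 𝒢 (i + j - 1)
  br_eq : ∀ {i j x y}, x ∈ 𝒢 i → y ∈ 𝒢 j →
    br x y = circ x y - sgn k ((i - 1) * (j - 1)) • circ y x
  d_one : d one = 0
  one_cup : ∀ {i x}, x ∈ 𝒢 i → cup one x = x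
  cup_one : ∀ {i x}, x ∈ 𝒢 i → cup x one = x
  cup_assoc : ∀ {i j l x y z}, x ∈ 𝒢 i → y ∈ 𝒢 j → z ∈ 𝒢 l →
    cup (cup x y) z = cup x (cup y z)
  d_cup : ∀ {i j x y}, x ∈ 𝒢 i → y ∈ 𝒢 j → d (cup x y) = cup (d x) y + sgn k i • cup x (d y)
  d_circ : ∀ {i j x y}, x ∈ 𝒢 i → y ∈ 𝒢 j → d (circ x y) =
    circ (d x) y + sgn k i • (cup x y - sgn k (i * j) • cup y x - circ x (d y))
  cup_circ : ∀ {i j l x y z}, x ∈ 𝒢 i → y ∈ 𝒢 j → z ∈ 𝒢 l →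
    circ (cup x y) z = cup x (circ y z) + sgn k (j * (l - 1)) • cup (circ x z) y
  circ_circ : ∀ {i j l x y z}, x ∈ 𝒢 i → y ∈ 𝒢 j → z ∈ 𝒢 l →
    circ (circ x y) z - circ x (circ y z) =
      sgn k ((j - 1) * (l - 1)) • (circ (circ x z) y - circ x (circ z y))
  exists_circ_cup : ∀ {i j l x y z}, x ∈ 𝒢 i → y ∈ 𝒢 j → z ∈ 𝒢 l → d x = 0 → d y = 0 → d z = 0 →
    ∃ w ∈ 𝒢 (i + j + l - 2), circ x (cup y z) =
      cup (circ x y) z + sgn k ((i - 1) * j) • cup y (circ x z) + sgn k (i + j) • d w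

theorem Coh.exists_isClassOf {d : C →ₗ[k] C} (ξ : Coh d) : ∃ x, IsClassOf d x ξ := by
  obtain ⟨⟨x, hx⟩, rfl⟩ := Submodule.mkQ_surjective _ ξ
  exact ⟨x, hx, rfl⟩

namespace IsClassOf

variable {d : C →ₗ[k] C} {x y : C} {ξ η : Coh d}

theorem d_eq (h : IsClassOf d x ξ) : d x = 0 := h.1

theorem add (hx : IsClassOf d x ξ) (hy : IsClassOf d y η) : IsClassOf d (x + y) (ξ + η) := by
  obtain ⟨hx, rfl⟩ := hx
  obtain ⟨hy, rfl⟩ := hy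
  exact ⟨add_mem hx hy, map_add (Coh.mk d) ⟨x, hx⟩ ⟨y, hy⟩⟩

theorem smul (c : k) (hx : IsClassOf d x ξ) : IsClassOf d (c • x) (c • ξ) := by
  obtain ⟨hx, rfl⟩ := hx
  exact ⟨Submodule.smul_mem _ c hx, map_smul (Coh.mk d) c ⟨x, hx⟩⟩

theorem zero : IsClassOf d 0 0 := ⟨zero_mem _, map_zero _⟩

theorem neg (hx : IsClassOf d x ξ) : IsClassOf d (-x) (-ξ) := by
  simpa using hx.smul (-1)

theorem eq_iff (hx : IsClassOf d x ξ) (hy : IsClassOf d y η) :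
    ξ = η ↔ x - y ∈ LinearMap.range d := by
  obtain ⟨hx, rfl⟩ := hx
  obtain ⟨hy, rfl⟩ := hy
  exact Submodule.Quotient.eq _

theorem eq (hx : IsClassOf d x ξ) (hy : IsClassOf d x η) : ξ = η :=
  (hx.eq_iff hy).2 (by rw [sub_self]; exact zero_mem _)

end IsClassOf

/-- An operation on cochains that takes cocycles to cocycles, and pairs of a cocycle and a
coboundary to coboundaries, induces an operation on cohomology. -/
theorem exists_induces (d : C →ₗ[k] C) (op : C →ₗ[k] C →ₗ[k] C)
    (h : ∀ x y, d x = 0 → d y = 0 → d (op x y) = 0)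
    (h1 : ∀ x y, d y = 0 → op (d x) y ∈ LinearMap.range d)
    (h2 : ∀ x y, d x = 0 → op x (d y) ∈ LinearMap.range d) :
    ∃ opH : Coh d →ₗ[k] Coh d →ₗ[k] Coh d, Induces d op opH := by
  let B : LinearMap.ker d →ₗ[k] LinearMap.ker d →ₗ[k] Coh d :=
    LinearMap.mk₂ k (fun x y => Coh.mk d ⟨op x y, h x y x.2 y.2⟩)
      (fun x x' y => by
        rw [← map_add]; congr 1; exact Subtype.ext (LinearMap.map_add₂ op _ _ _))
      (fun c x y => by
        rw [← map_smul]; congr 1; exact Subtype.ext (LinearMap.map_smul₂ op _ _ _))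
      (fun x y y' => by
        rw [← map_add]; congr 1; exact Subtype.ext (map_add (op x) _ _))
      (fun c x y => by
        rw [← map_smul]; congr 1; exact Subtype.ext (map_smul (op x) _ _))
  have hB : ∀ x y, B x y = 0 ↔ op x y ∈ LinearMap.range d := fun x y =>
    Submodule.Quotient.mk_eq_zero _
  let S := (LinearMap.range d).submoduleOf (LinearMap.ker d)
  let B' : LinearMap.ker d →ₗ[k] Coh d →ₗ[k] Coh d :=
    { toFun := fun x => S.liftQ (B x) (by
        rintro ⟨_, _⟩ ⟨y, rfl⟩
        exact (hB _ _).2 (h2 x y x.2))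
      map_add' := fun x y => Submodule.linearMap_qext _ (LinearMap.ext fun z => LinearMap.map_add₂ B x y z)
      map_smul' := fun c x => Submodule.linearMap_qext _ (LinearMap.ext fun z => LinearMap.map_smul₂ B c x z) }
  refine ⟨S.liftQ B' ?_, ?_⟩
  · rintro ⟨_, _⟩ ⟨x, rfl⟩
    refine LinearMap.mem_ker.2 (Submodule.linearMap_qext _ (LinearMap.ext fun z => ?_))
    exact (hB _ _).2 (h1 x z z.2)
  · rintro x y _ _ ⟨hx, rfl⟩ ⟨hy, rfl⟩
    exact ⟨h x y hx hy, rfl⟩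

namespace IsHomotopyGerstenhaber

variable {𝒢 : ℤ → Submodule k C} {d : C →ₗ[k] C} {cup circ br : C →ₗ[k] C →ₗ[k] C} {one : C}

theorem induction (H : IsHomotopyGerstenhaber 𝒢 d cup circ br one) {P : C → Prop} (x : C)
    (h0 : P 0) (hadd : ∀ x y, P x → P y → P (x + y)) (h : ∀ i, ∀ x ∈ 𝒢 i, P x) : P x :=
  Submodule.iSup_induction 𝒢 (motive := P) (H.iSup_eq_top ▸ Submodule.mem_top : x ∈ ⨆ i, 𝒢 i) h h0 hadd

/-- The projection to the component of degree `i`. -/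
def component (H : IsHomotopyGerstenhaber 𝒢 d cup circ br one) (i : ℤ) : C →ₗ[k] C :=
  Classical.choose (H.exists_component i)

theorem component_of_mem (H : IsHomotopyGerstenhaber 𝒢 d cup circ br one)
    {i : ℤ} {x : C} (hx : x ∈ 𝒢 i) : H.component i x = x :=
  (Classical.choose_spec (H.exists_component i)).1 x hx

theorem component_of_mem_ne (H : IsHomotopyGerstenhaber 𝒢 d cup circ br one)
    {i j : ℤ} (hij : j ≠ i) {x : C} (hx : x ∈ 𝒢 j) :
    H.component i x = 0 :=
  (Classical.choose_spec (H.exists_component i)).2 j hij x hx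

theorem component_mem (H : IsHomotopyGerstenhaber 𝒢 d cup circ br one)
    (i : ℤ) (x : C) : H.component i x ∈ 𝒢 i := by
  induction x using H.induction with
  | h0 => simp
  | hadd x y hx hy => rw [map_add]; exact add_mem hx hy
  | h j x hx =>
    by_cases hij : j = i
    · subst hij; rwa [H.component_of_mem hx]
    · rw [H.component_of_mem_ne hij hx]; exact zero_mem _

theorem component_d (H : IsHomotopyGerstenhaber 𝒢 d cup circ br one)
    (i : ℤ) (x : C) : H.component (i + 1) (d x) = d (H.component i x) := by
  induction x using H.induction with
  | h0 => simp
  | hadd x y hx hy => simp only [map_add, hx, hy]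
  | h j x hx =>
    by_cases hij : j = i
    · subst hij
      rw [H.component_of_mem hx, H.component_of_mem (H.d_mem hx)]
    · rw [H.component_of_mem_ne hij hx, H.component_of_mem_ne (by omega) (H.d_mem hx), map_zero]

theorem exists_sum_component (H : IsHomotopyGerstenhaber 𝒢 d cup circ br one) (x : C) :
    ∃ s : Finset ℤ, ∀ t, s ⊆ t → ∑ i ∈ t, H.component i x = x := by
  induction x using H.induction with
  | h0 => exact ⟨∅, fun t _ => by simp⟩
  | hadd x y hx hy =>
    obtain ⟨s, hs⟩ := hx
    obtain ⟨t, ht⟩ := hy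
    refine ⟨s ∪ t, fun r hr => ?_⟩
    simp only [map_add, Finset.sum_add_distrib]
    rw [hs r (Finset.union_subset_left hr), ht r (Finset.union_subset_right hr)]
  | h j x hx =>
    refine ⟨{j}, fun t ht => ?_⟩
    rw [Finset.sum_eq_single_of_mem j (ht (Finset.mem_singleton_self j))
      fun i _ hij => H.component_of_mem_ne (Ne.symm hij) hx, H.component_of_mem hx]

/-- The projections to the components are compatible with `d`, so the homogeneous components of a
cocycle are again cocycles. -/
theorem cocycle_induction (H : IsHomotopyGerstenhaber 𝒢 d cup circ br one)
    {P : ∀ x, d x = 0 → Prop} {x : C} (hx : d x = 0)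
    (h0 : P 0 (map_zero d))
    (hadd : ∀ x y hx hy, P x hx → P y hy → P (x + y) (by rw [map_add, hx, hy, add_zero]))
    (h : ∀ i, ∀ x ∈ 𝒢 i, ∀ hx, P x hx) : P x hx := by
  obtain ⟨s, hs⟩ := H.exists_sum_component x
  suffices h : ∃ h, P (∑ i ∈ s, H.component i x) h by
    obtain ⟨h, hP⟩ := h
    simp only [hs s (Finset.Subset.refl s)] at hP
    exact hP
  refine Finset.sum_induction _ (fun x => ∃ h, P x h) ?_ ⟨_, h0⟩ fun i _ =>
    ⟨_, h i _ (H.component_mem i x) (by rw [← H.component_d, hx, map_zero])⟩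
  rintro x y ⟨hx, h1⟩ ⟨hy, h2⟩
  exact ⟨_, hadd x y hx hy h1 h2⟩

theorem br_mem (H : IsHomotopyGerstenhaber 𝒢 d cup circ br one)
    {i j : ℤ} {x y : C} (hx : x ∈ 𝒢 i) (hy : y ∈ 𝒢 j) : br x y ∈ 𝒢 (i + j - 1) := by
  rw [H.br_eq hx hy]
  refine sub_mem (H.circ_mem hx hy) (Submodule.smul_mem _ _ ?_)
  rw [add_comm i j]
  exact H.circ_mem hy hx

/-- By `d_circ`, the differential of each circle product of cocycles is a graded commutator of the
cup product up to sign, and these cancel in the bracket. -/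
theorem d_br (H : IsHomotopyGerstenhaber 𝒢 d cup circ br one)
    {i j : ℤ} {x y : C} (hx : x ∈ 𝒢 i) (hy : y ∈ 𝒢 j) (hdx : d x = 0) (hdy : d y = 0) :
    d (br x y) = 0 := by
  rw [H.br_eq hx hy, map_sub, map_smul, H.d_circ hx hy, H.d_circ hy hx, hdx, hdy]
  simp only [map_zero, LinearMap.zero_apply, sgn_eq_ite, parity_simps]
  by_cases hi : Even i <;> by_cases hj : Even j <;> simp [hi, hj] <;> abel

theorem br_d_mem (H : IsHomotopyGerstenhaber 𝒢 d cup circ br one)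
    {i j : ℤ} {x y : C} (hx : x ∈ 𝒢 i) (hy : y ∈ 𝒢 j) (hdx : d x = 0) :
    br x (d y) ∈ LinearMap.range d := by
  -- Found by solving `d_circ` for `circ x (d y)` and `circ (d y) x`; the cup products cancel.
  refine ⟨-(sgn k i • circ x y) - sgn k ((i - 1) * j) • circ y x, ?_⟩
  rw [H.br_eq hx (H.d_mem hy), map_sub, map_neg, map_smul, map_smul, H.d_circ hx hy,
    H.d_circ hy hx, hdx]
  simp only [map_zero, LinearMap.zero_apply, sgn_eq_ite, parity_simps]
  by_cases hi : Even i <;> by_cases hj : Even j <;> simp [hi, hj] <;> abel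

theorem d_br_mem (H : IsHomotopyGerstenhaber 𝒢 d cup circ br one)
    {i j : ℤ} {x y : C} (hx : x ∈ 𝒢 i) (hy : y ∈ 𝒢 j) (hdy : d y = 0) :
    br (d x) y ∈ LinearMap.range d := by
  refine ⟨circ x y + sgn k (i * (j - 1) + j) • circ y x, ?_⟩
  rw [H.br_eq (H.d_mem hx) hy, map_add, map_smul, H.d_circ hx hy, H.d_circ hy hx, hdy]
  simp only [map_zero, LinearMap.zero_apply, sgn_eq_ite, parity_simps]
  by_cases hi : Even i <;> by_cases hj : Even j <;> simp [hi, hj] <;> abel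

theorem exists_cup (H : IsHomotopyGerstenhaber 𝒢 d cup circ br one) :
    ∃ cupH, Induces d cup cupH := by
  refine exists_induces d cup (fun x y hx hy => ?_) (fun x y hy => ?_) fun x y hx => ?_
  · induction x, hx using H.cocycle_induction with
    | h0 => simp
    | hadd x x' _ _ hx hx' => rw [LinearMap.map_add₂, map_add, hx, hx', add_zero]
    | h i x hxi hx =>
      induction y, hy using H.cocycle_induction with
      | h0 => simp
      | hadd y y' _ _ hy hy' => rw [map_add, map_add, hy, hy', add_zero]
      | h j y hyj hy => rw [H.d_cup hxi hyj, hx, hy]; simp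
  · induction x using H.induction with
    | h0 => simp
    | hadd x x' hx hx' => rw [map_add, LinearMap.map_add₂]; exact add_mem hx hx'
    | h i x hxi =>
      induction y, hy using H.cocycle_induction with
      | h0 => simp
      | hadd y y' _ _ hy hy' => rw [map_add]; exact add_mem hy hy'
      | h j y hyj hy => exact ⟨cup x y, by rw [H.d_cup hxi hyj, hy]; simp⟩
  · induction y using H.induction with
    | h0 => simp
    | hadd x x' hx hx' => rw [map_add, map_add]; exact add_mem hx hx'
    | h j y hyj =>
      induction x, hx using H.cocycle_induction with
      | h0 => simp
      | hadd y y' _ _ hy hy' => rw [LinearMap.map_add₂]; exact add_mem hy hy'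
      | h i x hxi hx =>
        refine ⟨sgn k i • cup x y, ?_⟩
        rw [map_smul, H.d_cup hxi hyj, hx, map_zero, LinearMap.zero_apply, zero_add, smul_smul,
          sgn_mul_self, one_smul]

theorem exists_br (H : IsHomotopyGerstenhaber 𝒢 d cup circ br one) : ∃ brH, Induces d br brH := by
  refine exists_induces d br (fun x y hx hy => ?_) (fun x y hy => ?_) fun x y hx => ?_
  · induction x, hx using H.cocycle_induction with
    | h0 => simp
    | hadd x x' _ _ hx hx' => rw [LinearMap.map_add₂, map_add, hx, hx', add_zero]
    | h i x hxi hx =>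
      induction y, hy using H.cocycle_induction with
      | h0 => simp
      | hadd y y' _ _ hy hy' => rw [map_add, map_add, hy, hy', add_zero]
      | h j y hyj hy => exact H.d_br hxi hyj hx hy
  · induction x using H.induction with
    | h0 => simp
    | hadd x x' hx hx' => rw [map_add, LinearMap.map_add₂]; exact add_mem hx hx'
    | h i x hxi =>
      induction y, hy using H.cocycle_induction with
      | h0 => simp
      | hadd y y' _ _ hy hy' => rw [map_add]; exact add_mem hy hy'
      | h j y hyj hy => exact H.d_br_mem hxi hyj hy
  · induction y using H.induction with
    | h0 => simp
    | hadd x x' hx hx' => rw [map_add, map_add]; exact add_mem hx hx'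
    | h j y hyj =>
      induction x, hx using H.cocycle_induction with
      | h0 => simp
      | hadd y y' _ _ hy hy' => rw [LinearMap.map_add₂]; exact add_mem hy hy'
      | h i x hxi hx => exact H.br_d_mem hxi hyj hx

theorem mem_component_iff {i : ℤ} {ξ : Coh d} :
    ξ ∈ Coh.component d (𝒢 i) ↔ ∃ x ∈ 𝒢 i, IsClassOf d x ξ := by
  constructor
  · rintro ⟨⟨x, hx⟩, h, rfl⟩
    exact ⟨x, h, hx, rfl⟩
  · rintro ⟨x, h, hx, rfl⟩
    exact ⟨⟨x, hx⟩, h, rfl⟩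

theorem coh_induction (H : IsHomotopyGerstenhaber 𝒢 d cup circ br one)
    {P : Coh d → Prop} (ξ : Coh d) (h0 : P 0)
    (hadd : ∀ x y, P x → P y → P (x + y)) (h : ∀ i, ∀ ξ ∈ Coh.component d (𝒢 i), P ξ) : P ξ := by
  obtain ⟨x, hx⟩ := Coh.exists_isClassOf ξ
  have : ∃ η, IsClassOf d x η ∧ P η := by
    refine H.cocycle_induction (P := fun x _ => ∃ η, IsClassOf d x η ∧ P η) hx.d_eq
      ⟨0, .zero, h0⟩ ?_ fun i x hxi hx =>
      ⟨Coh.mk d ⟨x, hx⟩, ⟨hx, rfl⟩, h i _ ⟨⟨x, hx⟩, hxi, rfl⟩⟩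
    rintro x y - - ⟨ξ, hx, hξ⟩ ⟨η, hy, hη⟩
    exact ⟨ξ + η, hx.add hy, hadd _ _ hξ hη⟩
  obtain ⟨η, hη, hP⟩ := this
  rwa [hx.eq hη]

theorem exists_coh_component (H : IsHomotopyGerstenhaber 𝒢 d cup circ br one)
    (i : ℤ) : ∃ π : Coh d →ₗ[k] Coh d,
    (∀ ξ ∈ Coh.component d (𝒢 i), π ξ = ξ) ∧
      ∀ j ≠ i, ∀ ξ ∈ Coh.component d (𝒢 j), π ξ = 0 := by
  let p : LinearMap.ker d →ₗ[k] LinearMap.ker d :=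
    (H.component i).restrict fun x (hx : d x = 0) => show d _ = 0 by
      rw [← H.component_d, hx, map_zero]
  let S := (LinearMap.range d).submoduleOf (LinearMap.ker d)
  let π : Coh d →ₗ[k] Coh d := S.mapQ S p (by
    rintro ⟨_, _⟩ ⟨x, rfl⟩
    refine ⟨H.component (i - 1) x, ?_⟩
    rw [← H.component_d, sub_add_cancel]
    rfl)
  refine ⟨π, ?_, ?_⟩
  · rintro _ ⟨x, hx, rfl⟩
    exact congrArg (Coh.mk d) (Subtype.ext (H.component_of_mem hx))
  · rintro j hj _ ⟨x, hx, rfl⟩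
    exact (congrArg (Coh.mk d) (Subtype.ext (H.component_of_mem_ne hj hx))).trans (map_zero _)

theorem isInternal (H : IsHomotopyGerstenhaber 𝒢 d cup circ br one) :
    DirectSum.IsInternal fun i => Coh.component d (𝒢 i) := by
  rw [DirectSum.isInternal_submodule_iff_iSupIndep_and_iSup_eq_top]
  constructor
  · intro i
    obtain ⟨π, h1, h2⟩ := H.exists_coh_component i
    rw [Submodule.disjoint_def]
    intro ξ hξ hξ'
    rw [← h1 ξ hξ]
    exact (iSup₂_le fun j hj η hη => h2 j hj η hη : _ ≤ LinearMap.ker π) hξ'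
  · rw [eq_top_iff]
    rintro ξ -
    induction ξ using H.coh_induction with
    | h0 => exact zero_mem _
    | hadd x y hx hy => exact add_mem hx hy
    | h i ξ hξ => exact Submodule.mem_iSup_of_mem i hξ

/-- The graded commutator of a pre-Lie product is a Lie bracket: the three cyclic pre-Lie relations
eliminate all the associators. -/
theorem jacobi (H : IsHomotopyGerstenhaber 𝒢 d cup circ br one)
    {i j l : ℤ} {x y z : C} (hx : x ∈ 𝒢 i) (hy : y ∈ 𝒢 j) (hz : z ∈ 𝒢 l) :
    sgn k ((i - 1) * (l - 1)) • br x (br y z) + sgn k ((i - 1) * (j - 1)) • br y (br z x) +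
      sgn k ((j - 1) * (l - 1)) • br z (br x y) = 0 := by
  have h1 := H.circ_circ hx hy hz
  have h2 := H.circ_circ hy hz hx
  have h3 := H.circ_circ hz hx hy
  rw [sub_eq_iff_eq_add] at h1 h2 h3
  rw [H.br_eq hx (H.br_mem hy hz), H.br_eq hy (H.br_mem hz hx), H.br_eq hz (H.br_mem hx hy),
    H.br_eq hy hz, H.br_eq hz hx, H.br_eq hx hy]
  simp only [map_sub, map_smul, LinearMap.sub_apply, LinearMap.smul_apply]
  rw [h1, h2, h3]
  simp only [sgn_eq_ite, parity_simps]
  by_cases hi : Even i <;> by_cases hj : Even j <;> by_cases hl : Even l <;>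
    simp [hi, hj, hl] <;> abel

/-- The half `x ∘ (y ∪ z)` of the bracket is a derivation up to the coboundary of `w`; the half `(y
∪ z) ∘ x` is one exactly, by `cup_circ`. -/
theorem leibniz (H : IsHomotopyGerstenhaber 𝒢 d cup circ br one)
    {i j l : ℤ} {x y z : C} (hx : x ∈ 𝒢 i) (hy : y ∈ 𝒢 j) (hz : z ∈ 𝒢 l)
    (hdx : d x = 0) (hdy : d y = 0) (hdz : d z = 0) :
    br x (cup y z) - (cup (br x y) z + sgn k ((i - 1) * j) • cup y (br x z)) ∈
      LinearMap.range d := by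
  obtain ⟨w, _, hw⟩ := H.exists_circ_cup hx hy hz hdx hdy hdz
  refine ⟨sgn k (i + j) • w, ?_⟩
  rw [H.br_eq hx (H.cup_mem hy hz), H.br_eq hx hy, H.br_eq hx hz, hw, H.cup_circ hy hz hx]
  simp only [map_sub, map_smul, LinearMap.sub_apply, LinearMap.smul_apply]
  simp only [sgn_eq_ite, parity_simps]
  by_cases hi : Even i <;> by_cases hj : Even j <;> by_cases hl : Even l <;>
    simp [hi, hj, hl] <;> abel

theorem isGerstenhaberAlgebra (H : IsHomotopyGerstenhaber 𝒢 d cup circ br one)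
    {cupH brH : Coh d →ₗ[k] Coh d →ₗ[k] Coh d} {oneH : Coh d}
    (hcup : Induces d cup cupH) (hbr : Induces d br brH) (hone : IsClassOf d one oneH) :
    IsGerstenhaberAlgebra (fun i => Coh.component d (𝒢 i)) cupH brH oneH where
  isInternal := H.isInternal
  one_mem := mem_component_iff.2 ⟨one, H.one_mem, hone⟩
  cup_mem ha hb := by
    obtain ⟨x, hx, ha⟩ := mem_component_iff.1 ha
    obtain ⟨y, hy, hb⟩ := mem_component_iff.1 hb
    exact mem_component_iff.2 ⟨_, H.cup_mem hx hy, hcup _ _ _ _ ha hb⟩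
  br_mem ha hb := by
    obtain ⟨x, hx, ha⟩ := mem_component_iff.1 ha
    obtain ⟨y, hy, hb⟩ := mem_component_iff.1 hb
    exact mem_component_iff.2 ⟨_, H.br_mem hx hy, hbr _ _ _ _ ha hb⟩
  one_cup a := by
    induction a using H.coh_induction with
    | h0 => simp
    | hadd a b ha hb => rw [map_add, ha, hb]
    | h i a ha =>
      obtain ⟨x, hx, ha⟩ := mem_component_iff.1 ha
      exact (H.one_cup hx ▸ hcup _ _ _ _ hone ha).eq ha
  cup_one a := by
    induction a using H.coh_induction with
    | h0 => simp
    | hadd a b ha hb => rw [LinearMap.map_add₂, ha, hb]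
    | h i a ha =>
      obtain ⟨x, hx, ha⟩ := mem_component_iff.1 ha
      exact (H.cup_one hx ▸ hcup _ _ _ _ ha hone).eq ha
  cup_assoc a b c := by
    induction a using H.coh_induction with
    | h0 => simp
    | hadd a a' ha ha' => simp only [LinearMap.map_add₂, ha, ha']
    | h i a ha =>
      induction b using H.coh_induction with
      | h0 => simp
      | hadd b b' hb hb' => simp only [map_add, LinearMap.add_apply, hb, hb']
      | h j b hb =>
        induction c using H.coh_induction with
        | h0 => simp
        | hadd c c' hc hc' => simp only [map_add, hc, hc']
        | h l c hc =>
          obtain ⟨x, hx, ha⟩ := mem_component_iff.1 ha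
          obtain ⟨y, hy, hb⟩ := mem_component_iff.1 hb
          obtain ⟨z, hz, hc⟩ := mem_component_iff.1 hc
          have h1 := hcup _ _ _ _ (hcup _ _ _ _ ha hb) hc
          rw [H.cup_assoc hx hy hz] at h1
          exact h1.eq (hcup _ _ _ _ ha (hcup _ _ _ _ hb hc))
  cup_comm {i j a b} ha hb := by
    obtain ⟨x, hx, ha⟩ := mem_component_iff.1 ha
    obtain ⟨y, hy, hb⟩ := mem_component_iff.1 hb
    refine ((hcup _ _ _ _ ha hb).eq_iff ((hcup _ _ _ _ hb ha).smul _)).2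
      -- On cocycles, `d_circ` exhibits the circle product as a homotopy for graded commutativity.
      ⟨sgn k i • circ x y, ?_⟩
    rw [map_smul, H.d_circ hx hy, ha.d_eq, hb.d_eq, map_zero, map_zero, LinearMap.zero_apply,
      zero_add, sub_zero, smul_smul, sgn_mul_self, one_smul]
  br_skew {i j a b} ha hb := by
    obtain ⟨x, hx, ha⟩ := mem_component_iff.1 ha
    obtain ⟨y, hy, hb⟩ := mem_component_iff.1 hb
    refine (hbr _ _ _ _ ha hb).eq ?_
    convert ((hbr _ _ _ _ hb ha).smul (sgn k ((i - 1) * (j - 1)))).neg using 1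
    rw [H.br_eq hx hy, H.br_eq hy hx, smul_sub, smul_smul, mul_comm (j - 1), sgn_mul_self, one_smul]
    abel
  jacobi {i j l a b c} ha hb hc := by
    obtain ⟨x, hx, ha⟩ := mem_component_iff.1 ha
    obtain ⟨y, hy, hb⟩ := mem_component_iff.1 hb
    obtain ⟨z, hz, hc⟩ := mem_component_iff.1 hc
    have h := (((hbr _ _ _ _ ha (hbr _ _ _ _ hb hc)).smul (sgn k ((i - 1) * (l - 1)))).add
      ((hbr _ _ _ _ hb (hbr _ _ _ _ hc ha)).smul (sgn k ((i - 1) * (j - 1))))).add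
      ((hbr _ _ _ _ hc (hbr _ _ _ _ ha hb)).smul (sgn k ((j - 1) * (l - 1))))
    rw [H.jacobi hx hy hz] at h
    exact h.eq .zero
  leibniz {i j a b} c ha hb := by
    induction c using H.coh_induction with
    | h0 => simp
    | hadd c c' hc hc' => simp only [map_add, hc, hc', smul_add]; abel
    | h l c hc =>
      obtain ⟨x, hx, ha⟩ := mem_component_iff.1 ha
      obtain ⟨y, hy, hb⟩ := mem_component_iff.1 hb
      obtain ⟨z, hz, hc⟩ := mem_component_iff.1 hc
      refine ((hbr _ _ _ _ ha (hcup _ _ _ _ hb hc)).eq_iff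
        ((hcup _ _ _ _ (hbr _ _ _ _ ha hb) hc).add
          ((hcup _ _ _ _ hb (hbr _ _ _ _ ha hc)).smul _))).2 ?_
      exact H.leibniz hx hy hz ha.d_eq hb.d_eq hc.d_eq

end IsHomotopyGerstenhaber

end Homotopy

/-! ### The singular Hochschild complex -/

section SingularCohomology

variable (k : Type u) [Field k] (A : Type v) [Ring A] [Algebra k A]

theorem Csg.isHomotopyGerstenhaber : IsHomotopyGerstenhaber (Csg.degree (k := k) (A := A)) Csg.d
    Csg.cup Csg.circ Csg.bracket (cls 0 0 unitCochain) where
  iSup_eq_top := Csg.iSup_degree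
  exists_component i := ⟨Csg.component i, fun _ => Csg.component_of_mem,
    fun _ hj _ hx => Csg.component_of_mem_ne hx hj⟩
  one_mem := Csg.one_mem
  d_mem := Csg.d_mem
  cup_mem := Csg.cup_mem
  circ_mem := Csg.circ_mem
  br_eq := Csg.bracket_eq
  d_one := Csg.d_one
  one_cup := Csg.one_cup_of_mem
  cup_one := Csg.cup_one_of_mem
  cup_assoc := Csg.cup_assoc_of_mem
  d_cup := Csg.d_cup
  d_circ := Csg.d_circ
  cup_circ := Csg.cup_circ
  circ_circ := Csg.circ_circ
  exists_circ_cup := Csg.exists_circ_cup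

end SingularCohomology

/-! ### The Hochschild complex as a part of the singular one -/

section HochschildCochains

variable {k : Type u} [Field k] {A : Type v} [Ring A] [Algebra k A]

theorem append_injective {p r P : ℕ} (h : p + r = P) :
    Function.Injective (append (k := k) (B := A) (V := Bar k A) h) := by
  have h1 := Module.Flat.lTensor_preserves_injective_linearMap (M := A)
    (concat (k := k) (V := Bar k A) h).toLinearMap (concat h).injective
  have h2 := Module.Flat.rTensor_preserves_injective_linearMap (M := Tens k (Bar k A) r)
    (forms (k := k) (B := A) (V := Bar k A) p).symm.toLinearMap (forms p).symm.injective
  exact (forms P).injective.comp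
    (h1.comp ((TensorProduct.assoc k A (Tens k (Bar k A) p) (Tens k (Bar k A) r)).injective.comp h2))

/-- Evaluate `f ⊗ id` with some `v ≠ 0` in the last slot and contract the last output with a linear
form of value `1` on `v`: this recovers `f`. -/
theorem theta_injective [Nontrivial (Bar k A)] {m p : ℕ} :
    Function.Injective (theta (k := k) (A := A) (m := m) (p := p)) := by
  obtain ⟨v, hv⟩ := exists_ne (0 : Bar k A)
  obtain ⟨φ, hφ⟩ := Module.Projective.exists_dual_eq_one k
    (show tensOne v ≠ 0 by simpa using hv)
  intro f g h
  refine LinearMap.ext fun x => ?_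
  have h1 := LinearMap.congr_fun h (concat rfl (x ⊗ₜ tensOne v))
  rw [theta_concat, theta_concat] at h1
  simpa [hφ] using congrArg ((TensorProduct.rid k (Omega k A p)).toLinearMap ∘ₗ φ.lTensor _)
    (append_injective rfl h1)

theorem extend_injective [Nontrivial (Bar k A)] (r : ℕ) {m p M P : ℕ} (hM : m + r = M)
    (hP : p + r = P) : Function.Injective (extend (k := k) (B := A) (V := Bar k A) r hM hP) := by
  induction r generalizing m p M P with
  | zero =>
    subst hM hP
    intro f g h
    refine theta_injective ?_
    have e := fun f : Cochain k A m p => extend_extend 0 1 rfl rfl rfl rfl f (zero_add 1) rfl rfl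
    exact (e f).symm.trans ((congrArg _ h).trans (e g))
  | succ r ih =>
    subst hM hP
    intro f g h
    have e := fun f : Cochain k A m p => extend_extend r 1 rfl rfl rfl rfl f rfl rfl rfl
    exact ih rfl rfl (theta_injective ((e f).trans (h.trans (e g).symm)))

namespace Hoch

theorem ofLevel_mem_degree {m : ℕ} {i : ℤ} (h : (m : ℤ) - (0 : ℕ) = i) (f : Cochain k A m 0) :
    ofLevel m 0 f ∈ Hoch.degree (k := k) (A := A) i :=
  Submodule.mem_iSup_of_mem m (Submodule.mem_iSup_of_mem (by simpa using h) ⟨f, rfl⟩)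

/-- A homogeneous element is a single cochain, and is zero in negative degrees. The degree is
written `m - 0` to match that of a singular cochain with `p = 0`. -/
theorem degree_induction {i : ℤ} {P : ∀ x : Hoch k A, x ∈ Hoch.degree i → Prop}
    (h0 : P 0 (zero_mem _)) (h : ∀ (m : ℕ) (f : Cochain k A m 0) (hm : (m : ℤ) - (0 : ℕ) = i),
      P (ofLevel m 0 f) (ofLevel_mem_degree hm f)) {x : Hoch k A} (hx : x ∈ Hoch.degree i) :
    P x hx := by
  have : x = 0 ∨ ∃ (m : ℕ) (f : Cochain k A m 0), (m : ℤ) - (0 : ℕ) = i ∧ ofLevel m 0 f = x := by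
    by_cases hi : 0 ≤ i
    · lift i to ℕ using hi
      have : Hoch.degree (k := k) (A := A) i ≤ LinearMap.range (ofLevel i 0) :=
        iSup_le fun m => iSup_le fun h => by
          obtain rfl : m = i := by omega
          exact le_rfl
      obtain ⟨f, rfl⟩ := this hx
      exact .inr ⟨i, f, by simp, rfl⟩
    · have : Hoch.degree (k := k) (A := A) i ≤ ⊥ := iSup_le fun m => iSup_le fun h => by omega
      exact .inl ((Submodule.mem_bot k).1 (this hx))
  obtain rfl | ⟨m, f, hm, rfl⟩ := this
  exacts [h0, h m f hm]

theorem iSup_degree : ⨆ i, Hoch.degree (k := k) (A := A) i = ⊤ := by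
  rw [← Submodule.ker_mkQ (⨆ i, Hoch.degree (k := k) (A := A) i), LinearMap.ker_eq_top]
  refine Level.hom_ext fun m f => ?_
  rw [Submodule.mkQ_apply, LinearMap.zero_apply, Submodule.Quotient.mk_eq_zero]
  exact Submodule.mem_iSup_of_mem _ (ofLevel_mem_degree rfl f)

/-- The projection to the homogeneous component of degree `i`. -/
def component (i : ℤ) : Hoch k A →ₗ[k] Hoch k A :=
  Level.lift fun m => if (m : ℤ) - (0 : ℕ) = i then ofLevel m 0 else 0

theorem component_of_mem {i : ℤ} {x : Hoch k A} (hx : x ∈ Hoch.degree i) : component i x = x := by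
  induction hx using degree_induction with
  | h0 => exact map_zero _
  | h m f h => rw [component, Level.lift_of, if_pos h]

theorem component_of_mem_ne {i j : ℤ} {x : Hoch k A} (hx : x ∈ Hoch.degree j) (hij : j ≠ i) :
    component i x = 0 := by
  induction hx using degree_induction with
  | h0 => exact map_zero _
  | h m f h =>
    rw [component, Level.lift_of, if_neg (by rwa [h])]
    rfl

/-- The circle product of `C^*(A, A)`. -/
def circL : Hoch k A →ₗ[k] Hoch k A →ₗ[k] Hoch k A :=
  Level.lift fun m => (Level.lift fun n => ((Hoch.circ m n).compr₂ (ofLevel (m + n - 1) 0)).flip).flip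

theorem circL_of {m n : ℕ} (f : Cochain k A m 0) (g : Cochain k A n 0) :
    circL (ofLevel m 0 f) (ofLevel n 0 g) = ofLevel (m + n - 1) 0 (Hoch.circ m n f g) := by
  rw [circL, Level.lift_of, LinearMap.flip_apply, Level.lift_of]
  rfl

theorem d_of {m : ℕ} (f : Cochain k A m 0) :
    Hoch.d (ofLevel m 0 f) = ofLevel (m + 1) 0 (hochschild (lifts k A) f) := by
  rw [Hoch.d, Level.lift_of]
  rfl

theorem cup_of {m n : ℕ} (f : Cochain k A m 0) (g : Cochain k A n 0) :
    Hoch.cup (ofLevel m 0 f) (ofLevel n 0 g) =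
      ofLevel (n + m) 0 (TateHochschild.cup rfl rfl f g) := by
  rw [Hoch.cup, Level.lift_of, LinearMap.flip_apply, Level.lift_of]
  rfl

theorem one_mem : ofLevel 0 0 unitCochain ∈ Hoch.degree (k := k) (A := A) 0 :=
  ofLevel_mem_degree (by simp) _

theorem d_mem {i : ℤ} {x : Hoch k A} (hx : x ∈ Hoch.degree i) :
    Hoch.d x ∈ Hoch.degree (i + 1) := by
  induction hx using degree_induction with
  | h0 => rw [map_zero]; exact zero_mem _
  | h m f h => rw [d_of]; exact ofLevel_mem_degree (by push_cast at h ⊢; omega) _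

theorem cup_mem {i j : ℤ} {x y : Hoch k A} (hx : x ∈ Hoch.degree i) (hy : y ∈ Hoch.degree j) :
    Hoch.cup x y ∈ Hoch.degree (i + j) := by
  induction hx using degree_induction with
  | h0 => rw [LinearMap.map_zero₂]; exact zero_mem _
  | h m f hm =>
    induction hy using degree_induction with
    | h0 => rw [map_zero]; exact zero_mem _
    | h n g hn => rw [cup_of]; exact ofLevel_mem_degree (by push_cast at hm hn ⊢; omega) _

theorem circ_zero_left {n : ℕ} (f : Cochain k A 0 0) (g : Cochain k A n 0) :
    Hoch.circ 0 n f g = 0 := by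
  simp [Hoch.circ]

theorem circ_mem {i j : ℤ} {x y : Hoch k A} (hx : x ∈ Hoch.degree i) (hy : y ∈ Hoch.degree j) :
    circL x y ∈ Hoch.degree (i + j - 1) := by
  induction hx using degree_induction with
  | h0 => rw [LinearMap.map_zero₂]; exact zero_mem _
  | h m f hm =>
    induction hy using degree_induction with
    | h0 => rw [map_zero]; exact zero_mem _
    | h n g hn =>
      rw [circL_of]
      -- For `m = n = 0` the truncated `m + n - 1` is `0` instead of `-1`; the product itself is
      -- zero then.
      obtain _ | m := m
      · rw [circ_zero_left, map_zero]
        exact zero_mem _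
      · exact ofLevel_mem_degree (by push_cast at hm hn ⊢; omega) _

theorem bracket_eq {i j : ℤ} {x y : Hoch k A} (hx : x ∈ Hoch.degree i) (hy : y ∈ Hoch.degree j) :
    Hoch.bracket x y = circL x y - sgn k ((i - 1) * (j - 1)) • circL y x := by
  induction hx using degree_induction with
  | h0 => simp
  | h m f hm =>
    induction hy using degree_induction with
    | h0 => simp
    | h n g hn =>
      rw [Nat.cast_zero, sub_zero] at hm hn
      subst hm hn
      rw [Hoch.bracket, Level.lift_of, LinearMap.flip_apply, Level.lift_of, circL_of, circL_of]
      rfl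

/-! ### The map to the singular cochains -/

theorem toCsg_mem {i : ℤ} {x : Hoch k A} (hx : x ∈ Hoch.degree i) :
    toCsg 0 x ∈ Csg.degree (k := k) (A := A) i := by
  induction hx using degree_induction with
  | h0 => rw [map_zero]; exact zero_mem _
  | h m f hm => exact Csg.cls_mem_degree hm f

theorem toCsg_cup (x y : Hoch k A) :
    toCsg 0 (Hoch.cup x y) = Csg.cup (toCsg 0 x) (toCsg 0 y) := by
  have : Hoch.cup.compr₂ (toCsg 0) =
      (Csg.cup (k := k) (A := A)).compl₁₂ (toCsg 0) (toCsg 0) :=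
    Level.hom_ext fun m f => Level.hom_ext fun n g => by
      rw [LinearMap.compr₂_apply, LinearMap.compl₁₂_apply, cup_of]
      exact (Csg.cup_cls f g).symm
  exact LinearMap.congr_fun₂ this x y

theorem toGerm_circ_cls {m n : ℕ} (f : Cochain k A m 0) (g : Cochain k A n 0) :
    Csg.toGerm (Csg.circ (cls m 0 f) (cls n 0 g)) =
      ∑ a ∈ Finset.range m, germ (opB f) * germ (insAt a (opB g)) := by
  have h := congrArg germ (opB_mul_insB_sub f (HasParity.opB g))
  simp only [map_sub, map_mul, map_smul, map_sum, Finset.range_zero, Finset.sum_empty, smul_zero,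
    sub_zero] at h
  rw [← h, Csg.toGerm_circ (Csg.cls_mem_degree rfl f) (Csg.cls_mem_degree rfl g)
    ⟨(Csg.toGerm_cls g).symm, HasParity.opB g⟩, Csg.toGerm_cls]

/-- The singular product uses `θ g`, which has an output slot, while Gerstenhaber's product uses `g`
itself and allows `n = 0`. Both have as germ the sum of the insertions of `g` into the inputs of
`f`. -/
theorem toCsg_circL (x y : Hoch k A) :
    toCsg 0 (circL x y) = Csg.circ (toCsg 0 x) (toCsg 0 y) := by
  have : circL.compr₂ (toCsg 0) = (Csg.circ (k := k) (A := A)).compl₁₂ (toCsg 0) (toCsg 0) :=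
    Level.hom_ext fun m f => Level.hom_ext fun n g => by
      rw [LinearMap.compr₂_apply, LinearMap.compl₁₂_apply]
      have hf := ofLevel_mem_degree rfl f
      have hg := ofLevel_mem_degree rfl g
      refine Csg.eq_of_toGerm_eq (toCsg_mem (circ_mem hf hg))
        (Csg.circ_mem (toCsg_mem hf) (toCsg_mem hg)) ?_
      refine Eq.trans ?_ (toGerm_circ_cls f g).symm
      rw [circL_of]
      refine (Csg.toGerm_cls _).trans ?_
      rw [Hoch.circ]
      simp only [LinearMap.sum_apply, LinearMap.smul_apply, map_sum, map_smul, germ_opB_circIn,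
        Finset.sum_range, smul_smul, ← sgn_add]
      refine Finset.sum_congr rfl fun a _ => ?_
      convert one_smul k _
      rw [← sgn_zero]
      exact sgn_congr ⟨(n - 1) * a, by push_cast; ring⟩
  exact LinearMap.congr_fun₂ this x y

theorem toCsg_bracket (x y : Hoch k A) :
    toCsg 0 (Hoch.bracket x y) = Csg.bracket (toCsg 0 x) (toCsg 0 y) := by
  have : Hoch.bracket.compr₂ (toCsg 0) =
      (Csg.bracket (k := k) (A := A)).compl₁₂ (toCsg 0) (toCsg 0) :=
    Level.hom_ext fun m f => Level.hom_ext fun n g => by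
      have hf := ofLevel_mem_degree rfl f
      have hg := ofLevel_mem_degree rfl g
      rw [LinearMap.compr₂_apply, LinearMap.compl₁₂_apply, bracket_eq hf hg,
        Csg.bracket_eq (toCsg_mem hf) (toCsg_mem hg), map_sub, map_smul, toCsg_circL, toCsg_circL]
  exact LinearMap.congr_fun₂ this x y

theorem eq_zero_of_cls_eq_zero [Nontrivial (Bar k A)] {m p : ℕ} {f : Cochain k A m p}
    (h : cls m p f = 0) : f = 0 := by
  have h0 := Csg.toGerm_cls f
  rw [h, map_zero, eq_comm, germ_eq_zero_iff] at h0
  obtain ⟨r, hr⟩ := extend_eq_zero_of_op_mem_Ev h0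
  exact extend_injective r rfl rfl (by rw [hr, map_zero])

theorem eq_of_toCsg_eq [Nontrivial (Bar k A)] {i : ℤ} {x y : Hoch k A} (hx : x ∈ Hoch.degree i)
    (hy : y ∈ Hoch.degree i) (h : toCsg 0 x = toCsg 0 y) : x = y := by
  rw [← sub_eq_zero, ← map_sub] at h
  rw [← sub_eq_zero]
  have hxy := sub_mem hx hy
  generalize x - y = z at h hxy ⊢
  induction hxy using degree_induction with
  | h0 => rfl
  | h m f hm =>
    rw [eq_zero_of_cls_eq_zero h, map_zero]

/-- Since `c < a`, place `c` is still an input after `g` has been inserted at place `a`, even for `n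
= 0`. So a double insertion needs no extra strands and stays in `C^*(A, A)`. -/
theorem exists_toGerm_eq {m n q a c : ℕ} (f : Cochain k A m 0) (g : Cochain k A n 0)
    (h : Cochain k A q 0) (ha : a < m) (hc : c < a) :
    ∃ w ∈ Hoch.degree (m + n + q - 2), Csg.toGerm (toCsg 0 w) =
      germ (opB f) * germ (insAt a (opB g)) * germ (insAt c (opB h)) := by
  have h1 := germ_opB_circIn rfl rfl ⟨c, by omega⟩ (circIn rfl rfl ⟨a, ha⟩ f g) h
  rw [germ_opB_circIn rfl rfl ⟨a, ha⟩ f g, smul_mul_assoc, smul_smul,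
    ← inv_smul_eq_iff₀ (mul_ne_zero (by rw [sgn_eq_ite]; split_ifs <;> simp)
      (by rw [sgn_eq_ite]; split_ifs <;> simp))] at h1
  rw [← h1]
  refine ⟨(sgn k (c * (q - (0 + 1 : ℕ))) * sgn k (a * (n - (0 + 1 : ℕ))))⁻¹ •
    ofLevel (m + n - 1 + q - 1) 0 (circIn rfl rfl ⟨c, by omega⟩
    (circIn rfl rfl ⟨a, ha⟩ f g) h), Submodule.smul_mem _ _ (ofLevel_mem_degree ?_ _), ?_⟩
  · push_cast
    omega
  · rw [map_smul, map_smul]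
    exact congrArg _ (Csg.toGerm_cls _)

/-- The singular statement alone would give a homotopy in the larger complex. For `p = 0` the
homotopy is the sum of the double insertions, which lie in `C^*(A, A)`, and the identity descends by
injectivity. -/
theorem exists_circ_cup [Nontrivial (Bar k A)] {i j l : ℤ} {x y z : Hoch k A}
    (hx : x ∈ Hoch.degree i) (hy : y ∈ Hoch.degree j) (hz : z ∈ Hoch.degree l) (hdx : Hoch.d x = 0)
    (hdy : Hoch.d y = 0) (hdz : Hoch.d z = 0) : ∃ w ∈ Hoch.degree (i + j + l - 2),
      circL x (Hoch.cup y z) = Hoch.cup (circL x y) z + sgn k ((i - 1) * j) •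
        Hoch.cup y (circL x z) + sgn k (i + j) • Hoch.d w := by
  have key : ∃ w ∈ Hoch.degree (k := k) (A := A) (i + j + l - 2),
      Csg.circ (toCsg 0 x) (Csg.cup (toCsg 0 y) (toCsg 0 z)) =
      Csg.cup (Csg.circ (toCsg 0 x) (toCsg 0 y)) (toCsg 0 z) + sgn k ((i - 1) * j) •
        Csg.cup (toCsg 0 y) (Csg.circ (toCsg 0 x) (toCsg 0 z)) +
          sgn k (i + j) • Csg.d (toCsg 0 w) := by
    induction hx using degree_induction with
    | h0 => exact ⟨0, zero_mem _, by simp⟩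
    | h m f hm =>
    induction hy using degree_induction with
    | h0 => exact ⟨0, zero_mem _, by simp⟩
    | h n g hn =>
    induction hz using degree_induction with
    | h0 => exact ⟨0, zero_mem _, by simp⟩
    | h q h hq =>
    subst hm hn hq
    choose! w hw hw' using fun a (ha : a < m) c (hc : c < a) => exists_toGerm_eq f g h ha hc
    have hW : ∑ a ∈ Finset.range m, ∑ c ∈ Finset.range a, w a c ∈
        Hoch.degree (k := k) (A := A) (m - (0 : ℕ) + (n - (0 : ℕ)) + (q - (0 : ℕ)) - 2) := by
      simp only [Nat.cast_zero, sub_zero]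
      exact sum_mem fun a ha => sum_mem fun c hc =>
        hw a (Finset.mem_range.1 ha) c (Finset.mem_range.1 hc)
    have hy := Csg.cls_mem_degree rfl g
    have hz := Csg.cls_mem_degree rfl h
    have lg : Csg.IsLift (cls n 0 g) _ (opB g) := ⟨(Csg.toGerm_cls g).symm, HasParity.opB g⟩
    have lh : Csg.IsLift (cls q 0 h) _ (opB h) := ⟨(Csg.toGerm_cls h).symm, HasParity.opB h⟩
    refine ⟨_, hW, Csg.circ_cup_of_homotopy (Csg.cls_mem_degree rfl f) hy hz
      ((d_toCsg _).trans (by rw [hdx, map_zero]))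
      ((d_toCsg _).trans (by rw [hdy, map_zero]))
      ((d_toCsg _).trans (by rw [hdz, map_zero])) lg lh (toCsg_mem hW) ?_⟩
    refine Eq.trans ?_ (Csg.homotopyGerm_eq f hy hz lg lh).symm
    simp only [Finset.range_zero, Finset.sum_empty, smul_zero, sub_zero, map_sum]
    exact Finset.sum_congr rfl fun a ha => Finset.sum_congr rfl fun c hc =>
        hw' a (Finset.mem_range.1 ha) c (Finset.mem_range.1 hc)
  obtain ⟨w, hw, h⟩ := key
  refine ⟨w, hw, eq_of_toCsg_eq (i := i + j + l - 1) ?_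
    (add_mem (add_mem ?_ (Submodule.smul_mem _ _ ?_)) (Submodule.smul_mem _ _ ?_)) ?_⟩
  · convert circ_mem hx (cup_mem hy hz) using 2; ring
  · convert cup_mem (circ_mem hx hy) hz using 2; ring
  · convert cup_mem hy (circ_mem hx hz) using 2; ring
  · convert d_mem hw using 2; ring
  · simpa only [map_add, map_smul, toCsg_circL, toCsg_cup, d_toCsg] using h

variable (k A) in
theorem isHomotopyGerstenhaber_of_nontrivial [Nontrivial (Bar k A)] :
    IsHomotopyGerstenhaber (Hoch.degree (k := k) (A := A)) Hoch.d Hoch.cup circL Hoch.bracket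
      (ofLevel 0 0 unitCochain) where
  iSup_eq_top := iSup_degree
  exists_component i := ⟨component i, fun _ => component_of_mem,
    fun _ hj _ hx => component_of_mem_ne hx hj⟩
  one_mem := one_mem
  d_mem := d_mem
  cup_mem := cup_mem
  circ_mem := circ_mem
  br_eq := bracket_eq
  d_one := eq_of_toCsg_eq (d_mem one_mem) (zero_mem _) (by
    rw [← d_toCsg, map_zero]
    exact Csg.d_one)
  one_cup {i x} hx := eq_of_toCsg_eq (cup_mem one_mem hx) (by rwa [zero_add]) (by
    rw [toCsg_cup]
    exact Csg.one_cup_of_mem (toCsg_mem hx))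
  cup_one {i x} hx := eq_of_toCsg_eq (cup_mem hx one_mem) (by rwa [add_zero]) (by
    rw [toCsg_cup]
    exact Csg.cup_one_of_mem (toCsg_mem hx))
  cup_assoc {i j l x y z} hx hy hz :=
    eq_of_toCsg_eq (cup_mem (cup_mem hx hy) hz) (add_assoc i j l ▸ cup_mem hx (cup_mem hy hz)) (by
      simp only [toCsg_cup]
      exact Csg.cup_assoc_of_mem (toCsg_mem hx) (toCsg_mem hy) (toCsg_mem hz))
  d_cup {i j x y} hx hy := by
    refine eq_of_toCsg_eq (d_mem (cup_mem hx hy)) (add_mem ?_ (Submodule.smul_mem _ _ ?_)) ?_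
    · rw [add_right_comm]
      exact cup_mem (d_mem hx) hy
    · rw [add_assoc]
      exact cup_mem hx (d_mem hy)
    · simp only [map_add, map_smul, toCsg_cup, ← d_toCsg]
      exact Csg.d_cup (toCsg_mem hx) (toCsg_mem hy)
  d_circ {i j x y} hx hy := by
    refine eq_of_toCsg_eq (i := i + j) ?_ (add_mem ?_ (Submodule.smul_mem _ _ (sub_mem (sub_mem
      (cup_mem hx hy) (Submodule.smul_mem _ _ (add_comm i j ▸ cup_mem hy hx))) ?_))) ?_
    · convert d_mem (circ_mem hx hy) using 2; ring
    · convert circ_mem (d_mem hx) hy using 2; ring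
    · convert circ_mem hx (d_mem hy) using 2; ring
    · simp only [map_add, map_sub, map_smul, toCsg_cup, toCsg_circL, ← d_toCsg]
      exact Csg.d_circ (toCsg_mem hx) (toCsg_mem hy)
  cup_circ {i j l x y z} hx hy hz := by
    refine eq_of_toCsg_eq (circ_mem (cup_mem hx hy) hz) (add_mem ?_ (Submodule.smul_mem _ _ ?_)) ?_
    · convert cup_mem hx (circ_mem hy hz) using 2; ring
    · convert cup_mem (circ_mem hx hz) hy using 2; ring
    · simp only [map_add, map_smul, toCsg_cup, toCsg_circL]
      exact Csg.cup_circ (toCsg_mem hx) (toCsg_mem hy) (toCsg_mem hz)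
  circ_circ {i j l x y z} hx hy hz := by
    refine eq_of_toCsg_eq (i := i + j + l - 2) (sub_mem ?_ ?_)
      (Submodule.smul_mem _ _ (sub_mem ?_ ?_)) ?_
    · convert circ_mem (circ_mem hx hy) hz using 2; ring
    · convert circ_mem hx (circ_mem hy hz) using 2; ring
    · convert circ_mem (circ_mem hx hz) hy using 2; ring
    · convert circ_mem hx (circ_mem hz hy) using 2; ring
    · simp only [map_sub, map_smul, toCsg_circL]
      exact Csg.circ_circ (toCsg_mem hx) (toCsg_mem hy) (toCsg_mem hz)
  exists_circ_cup := exists_circ_cup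

/-! ### Algebras of dimension at most one -/

/-- If `Ā = 0`, then `A = k · 1` and `Ā^{⊗m} = 0` for `m > 0`, so only the cochains without inputs
remain. -/
theorem exists_smul_one [Subsingleton (Bar k A)] (x : Hoch k A) :
    ∃ c : k, c • ofLevel 0 0 unitCochain = x := by
  have hT : ∀ m, Subsingleton (Cochain k A (m + 1) 0) := fun m => ⟨fun f g => by
    refine ext_concat (add_comm 1 m) fun u w => ?_
    obtain ⟨v, rfl⟩ := tensOne.surjective u
    rw [Subsingleton.elim v 0, map_zero, TensorProduct.zero_tmul, map_zero, map_zero, map_zero]⟩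
  have : (⊤ : Submodule k (Hoch k A)) ≤ Submodule.span k {ofLevel 0 0 unitCochain} := by
    rw [← Submodule.ker_mkQ (Submodule.span k _), top_le_iff, LinearMap.ker_eq_top]
    refine Level.hom_ext fun m f => ?_
    rw [Submodule.mkQ_apply, LinearMap.zero_apply, Submodule.Quotient.mk_eq_zero]
    obtain _ | m := m
    · have hf : ∀ w : Omega k A 0, ∃ c : k, c • unitCochain (unitTens (k := k) (A := A)) = w := by
        intro w
        have hA : ∀ a : A, ∃ c : k, c • (1 : A) = a := fun a => by
          have : (Submodule.Quotient.mk a : Bar k A) = 0 := Subsingleton.elim _ _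
          exact Submodule.mem_span_singleton.1 ((Submodule.Quotient.mk_eq_zero _).1 this)
        induction w using forms_induction with
        | h0 => exact ⟨0, zero_smul _ _⟩
        | hadd x y hx hy =>
          obtain ⟨c, rfl⟩ := hx
          obtain ⟨e, rfl⟩ := hy
          exact ⟨c + e, add_smul _ _ _⟩
        | h a t =>
          obtain ⟨c, rfl⟩ := hA a
          induction t using tens_zero_induction with | h e => ?_
          refine ⟨c * e, ?_⟩
          rw [TensorProduct.tmul_smul, ← TensorProduct.smul_tmul', map_smul, map_smul, smul_smul,
            mul_comm]
          rfl
      obtain ⟨c, hc⟩ := hf (f unitTens)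
      refine Submodule.mem_span_singleton.2 ⟨c, ?_⟩
      rw [← map_smul]
      congr 1
      refine LinearMap.ext fun t => ?_
      induction t using tens_zero_induction with | h e => ?_
      rw [map_smul, map_smul, LinearMap.smul_apply, hc]
    · rw [Subsingleton.elim f 0, map_zero]
      exact zero_mem _
  exact Submodule.mem_span_singleton.1 (this trivial)

theorem eq_zero_of_mem_of_ne [Subsingleton (Bar k A)] {i : ℤ} (hi : i ≠ 0) {x : Hoch k A}
    (hx : x ∈ Hoch.degree i) : x = 0 := by
  rw [← component_of_mem hx]
  obtain ⟨c, rfl⟩ := exists_smul_one x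
  rw [map_smul, component_of_mem_ne one_mem hi.symm, smul_zero]

theorem circL_eq_zero [Subsingleton (Bar k A)] (x y : Hoch k A) : circL x y = 0 := by
  obtain ⟨a, rfl⟩ := exists_smul_one x
  obtain ⟨b, rfl⟩ := exists_smul_one y
  rw [LinearMap.map_smul₂, map_smul, circL_of, circ_zero_left, map_zero, smul_zero, smul_zero]

theorem d_eq_zero [Subsingleton (Bar k A)] (x : Hoch k A) : Hoch.d x = 0 := by
  obtain ⟨a, rfl⟩ := exists_smul_one x
  rw [map_smul, eq_zero_of_mem_of_ne (by norm_num) (d_mem one_mem), smul_zero]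

theorem unitCochain_cup_unitCochain : TateHochschild.cup (k := k) (A := A) (rfl : 0 + 0 = 0)
    (rfl : 0 + 0 = 0) unitCochain unitCochain = unitCochain := by
  refine LinearMap.ext fun t => ?_
  induction t using tens_zero_induction with | h c => ?_
  rw [map_smul, map_smul, cup_apply, ← concat_unitTens_left (add_zero 0) (unitTens (k := k) (A := A))]
  rw [LinearMap.comp_apply, LinearMap.comp_apply, LinearMap.comp_apply, extend_concat]
  simp [unitCochain, append_forms, leftMul_forms, extend_concat]

theorem one_cup_one : Hoch.cup (ofLevel 0 0 unitCochain) (ofLevel 0 0 unitCochain) =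
    ofLevel (k := k) (A := A) 0 0 unitCochain := by
  rw [cup_of]
  exact congrArg (ofLevel 0 0) unitCochain_cup_unitCochain

theorem smul_one_cup_smul_one (a b : k) : Hoch.cup (a • ofLevel 0 0 unitCochain)
    (b • ofLevel 0 0 unitCochain) = (a * b) • ofLevel (k := k) (A := A) 0 0 unitCochain := by
  rw [LinearMap.map_smul₂, map_smul, one_cup_one, smul_smul]

theorem cup_comm [Subsingleton (Bar k A)] (x y : Hoch k A) : Hoch.cup x y = Hoch.cup y x := by
  obtain ⟨a, rfl⟩ := exists_smul_one x
  obtain ⟨b, rfl⟩ := exists_smul_one y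
  rw [smul_one_cup_smul_one, smul_one_cup_smul_one, mul_comm]

theorem one_cup [Subsingleton (Bar k A)] (x : Hoch k A) :
    Hoch.cup (ofLevel 0 0 unitCochain) x = x := by
  obtain ⟨a, rfl⟩ := exists_smul_one x
  rw [map_smul, one_cup_one]

theorem cup_assoc [Subsingleton (Bar k A)] (x y z : Hoch k A) :
    Hoch.cup (Hoch.cup x y) z = Hoch.cup x (Hoch.cup y z) := by
  obtain ⟨a, rfl⟩ := exists_smul_one x
  obtain ⟨b, rfl⟩ := exists_smul_one y
  obtain ⟨c, rfl⟩ := exists_smul_one z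
  simp only [smul_one_cup_smul_one, mul_assoc]

variable (k A) in
theorem isHomotopyGerstenhaber_of_subsingleton [Subsingleton (Bar k A)] :
    IsHomotopyGerstenhaber (Hoch.degree (k := k) (A := A)) Hoch.d Hoch.cup circL Hoch.bracket
      (ofLevel 0 0 unitCochain) where
  iSup_eq_top := iSup_degree
  exists_component i := ⟨component i, fun _ => component_of_mem,
    fun _ hj _ hx => component_of_mem_ne hx hj⟩
  one_mem := one_mem
  d_mem := d_mem
  cup_mem := cup_mem
  circ_mem := circ_mem
  br_eq := bracket_eq
  d_one := d_eq_zero _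
  one_cup _ := one_cup _
  cup_one {i x} _ := (cup_comm _ _).trans (one_cup x)
  cup_assoc _ _ _ := cup_assoc _ _ _
  d_cup _ _ := by simp [d_eq_zero]
  d_circ {i j x y} hx hy := by
    rw [d_eq_zero, d_eq_zero, circL_eq_zero, circL_eq_zero, zero_add, sub_zero, eq_comm,
      smul_eq_zero_iff_right (by rw [sgn_eq_ite]; split_ifs <;> simp), sub_eq_zero]
    -- In degree `0` the sign is trivial and the cup product commutes; in other degrees `x = 0`.
    by_cases hi : i = 0
    · rw [hi, zero_mul, sgn_zero, one_smul, cup_comm]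
    · rw [eq_zero_of_mem_of_ne hi hx]
      simp
  cup_circ _ _ _ := by simp [circL_eq_zero]
  circ_circ _ _ _ := by simp [circL_eq_zero]
  exists_circ_cup _ _ _ _ _ _ := ⟨0, zero_mem _, by simp [circL_eq_zero]⟩

variable (k A) in
theorem isHomotopyGerstenhaber :
    IsHomotopyGerstenhaber (Hoch.degree (k := k) (A := A)) Hoch.d Hoch.cup circL Hoch.bracket
      (ofLevel 0 0 unitCochain) := by
  cases subsingleton_or_nontrivial (Bar k A)
  · exact isHomotopyGerstenhaber_of_subsingleton k A
  · exact isHomotopyGerstenhaber_of_nontrivial k A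

end Hoch

end HochschildCochains

/-! ### The comparison map and the theorem -/

theorem isGerstenhaberHom_rho (k : Type u) [Field k] (A : Type v) [Ring A]
    [Algebra k A] {cup₀ br₀ : HH k A →ₗ[k] HH k A →ₗ[k] HH k A} {one₀ : HH k A}
    {cup br : HHsg k A →ₗ[k] HHsg k A →ₗ[k] HHsg k A} {one : HHsg k A}
    (hcup₀ : Induces Hoch.d Hoch.cup cup₀) (hbr₀ : Induces Hoch.d Hoch.bracket br₀)
    (hone₀ : IsClassOf Hoch.d (ofLevel 0 0 unitCochain) one₀) (hcup : Induces Csg.d Csg.cup cup)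
    (hbr : Induces Csg.d Csg.bracket br) (hone : IsClassOf Csg.d (cls 0 0 unitCochain) one) :
    IsGerstenhaberHom (HH.degree k A) cup₀ br₀ one₀ (HHsg.degree k A) cup br one (rho k A) where
  map_mem ha := by
    obtain ⟨x, hx, h⟩ := IsHomotopyGerstenhaber.mem_component_iff.1 ha
    exact IsHomotopyGerstenhaber.mem_component_iff.2 ⟨_, Hoch.toCsg_mem hx, Coh.map_mk (toCsg 0) d_toCsg h⟩
  map_one := (Coh.map_mk (toCsg 0) d_toCsg hone₀).eq hone
  map_cup a b := by
    obtain ⟨x, hx⟩ := Coh.exists_isClassOf a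
    obtain ⟨y, hy⟩ := Coh.exists_isClassOf b
    have h := Coh.map_mk (toCsg 0) d_toCsg (hcup₀ _ _ _ _ hx hy)
    rw [Hoch.toCsg_cup] at h
    exact h.eq (hcup _ _ _ _ (Coh.map_mk (toCsg 0) d_toCsg hx) (Coh.map_mk (toCsg 0) d_toCsg hy))
  map_br a b := by
    obtain ⟨x, hx⟩ := Coh.exists_isClassOf a
    obtain ⟨y, hy⟩ := Coh.exists_isClassOf b
    have h := Coh.map_mk (toCsg 0) d_toCsg (hbr₀ _ _ _ _ hx hy)
    rw [Hoch.toCsg_bracket] at h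
    exact h.eq (hbr _ _ _ _ (Coh.map_mk (toCsg 0) d_toCsg hx) (Coh.map_mk (toCsg 0) d_toCsg hy))

end TateHochschild

end

open TateHochschild

theorem corollary5p3 (k : Type u) [Field k] (A : Type v) [Ring A] [Algebra k A] :
    ∃ (cup₀ bracket₀ : HH k A →ₗ[k] HH k A →ₗ[k] HH k A) (one₀ : HH k A)
      (cup bracket : HHsg k A →ₗ[k] HHsg k A →ₗ[k] HHsg k A) (one : HHsg k A),
      (Induces Hoch.d Hoch.cup cup₀ ∧ Induces Hoch.d Hoch.bracket bracket₀ ∧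
        IsClassOf Hoch.d (ofLevel 0 0 unitCochain) one₀) ∧
      (Induces Csg.d Csg.cup cup ∧ Induces Csg.d Csg.bracket bracket ∧
        IsClassOf Csg.d (cls 0 0 unitCochain) one) ∧
      IsGerstenhaberAlgebra (HH.degree k A) cup₀ bracket₀ one₀ ∧
      IsGerstenhaberAlgebra (HHsg.degree k A) cup bracket one ∧
      IsGerstenhaberHom (HH.degree k A) cup₀ bracket₀ one₀
        (HHsg.degree k A) cup bracket one (rho k A) := by
  have H₀ := Hoch.isHomotopyGerstenhaber k A
  have H := Csg.isHomotopyGerstenhaber k A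
  obtain ⟨cup₀, hcup₀⟩ := H₀.exists_cup
  obtain ⟨br₀, hbr₀⟩ := H₀.exists_br
  obtain ⟨cup, hcup⟩ := H.exists_cup
  obtain ⟨br, hbr⟩ := H.exists_br
  have hone₀ : IsClassOf Hoch.d (ofLevel 0 0 unitCochain) (Coh.mk _ ⟨_, H₀.d_one⟩) := ⟨_, rfl⟩
  have hone : IsClassOf Csg.d (cls 0 0 unitCochain) (Coh.mk _ ⟨_, H.d_one⟩) := ⟨_, rfl⟩
  exact ⟨cup₀, br₀, _, cup, br, _, ⟨hcup₀, hbr₀, hone₀⟩, ⟨hcup, hbr, hone⟩,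
    H₀.isGerstenhaberAlgebra hcup₀ hbr₀ hone₀, H.isGerstenhaberAlgebra hcup hbr hone,
    isGerstenhaberHom_rho k A hcup₀ hbr₀ hone₀ hcup hbr hone⟩
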